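/- Setting. Let $T>0$, $d\ge 0$, $N\ge 1$, and let $H:[0,T]\times T^*\mathbb R^d\to\mathbb R$ be a $C^2$ function with compact support, $T^*\mathbb R^d=\mathbb R^d\times\mathbb R^d\ni(x,y)$. Let $c_H:=\sup|D^2H_\tau(x,y)|$ (supremum over $\tau\in[0,T]$ and $(x,y)$, where $D^2$ is the second derivative in $(x,y)$ and $|\cdot|$ is the operator norm for the Euclidean norm), and let $\varphi_H^{s,\tau}=(X_s^\tau,Y_s^\tau)$, $s,\tau\in[0,T]$, be the flow of the time-dependent Hamiltonian vector field $(\partial_yH_\tau,-\partial_xH_\tau)$. For $0\le s\le t\le T$ with $(t-s)\,c_H<\ln 2$, the map $\alpha_s^t:(x,y)\mapsto(X_s^t(x,y),y)$ is a bijection of $T^*\mathbb R^d$, and we put $$\phi_H^{s,t}(X,y)=\int_s^t\Big((Y_s^\tau-y)\cdot\dot X_s^\tau-H(\tau,X_s^\tau,Y_s^\tau)\Big)\,d\tau ,\qquad (X_s^\tau,Y_s^\tau)=\varphi_H^{s,\tau}\big((\alpha_s^t)^{-1}(X,y)\big).$$ Let $v:\mathbb R^d\to\mathbb R$ be globally Lipschitz,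 and let $0\le t_0\le t_1\le\dots\le t_N\le T$ with $(t_{i+1}-t_i)\,c_H<\ln 2$ for all $i$. For $x\in\mathbb R^d$ and $\eta=\big((x_i,y_i)\big)_{0\le i<N}\in(T^*\mathbb R^d)^N$, with $x_N:=x$, put $$S(x,\eta)=v(x_0)+\sum_{0\le i<N}\phi_H^{t_i,t_{i+1}}(x_{i+1},y_i)+\sum_{0\le i<N}(x_{i+1}-x_i)\cdot y_i ,$$ $$Q(\eta)=-x_{N-1}\cdot y_{N-1}+\sum_{0\le i<N-1}(x_{i+1}-x_i)\cdot y_i ,$$ and let $k_\infty$ be the Morse index of the quadratic form $Q$. Clarke derivative. For a real function $f$ on a finite-dimensional Euclidean space $X$, $\partial f(a)\subset X^*$ is the convex hull of the set of limits of sequences $df(a_n)$, where $a_n\to a$ and $f$ is differentiable at $a_n$. A number $c$ is a critical value of $f$ if $c=f(a)$ for some $a$ with $0\in\partial f(a)$. Minmax. For $f:(T^*\mathbb R^d)^N\to\mathbb R$ let $f^a=\{f\le a\}$. A descending cycle of $f$ at level $a$ is a relative singular cycle $\sigma$ of dimension $k_\infty$ of the pair $(f^a,f^{-a})$ whose class generates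 $H_{k_\infty}(f^a,f^{-a};\mathbb Z_2)$; $|\sigma|$ denotes its image. We say that the minmax of $f$ is well defined if, for all sufficiently large $a$, $H_i(f^a,f^{-a};\mathbb Z_2)$ is isomorphic to $\mathbb Z_2$ for $i=k_\infty$ and zero for $i\ne k_\infty$, and the infimum of $\max_{|\sigma|}f$ over the descending cycles $\sigma$ at level $a$ is a real number which does not depend on the (large) $a$. This number is then the minmax of $f$. Let $R_S(x)$ be the minmax of $S(x,\cdot)$. Truncations. Let $K\subset\mathbb R^d$ be compact and let $\theta\in C_c^\infty\big((T^*\mathbb R^d)^N,[0,1]\big)$ be equal to $1$ in a neighbourhood of $0$. For $a>0$ put $$S_K(x,\eta)=\psi_K(x,\eta)+Q(\eta),\qquad \psi_K(x,\eta)=\theta\big(\tfrac{\eta}{a}\big)\,\psi(x,\eta),\qquad \psi(x,\eta)=S(x,\eta)-Q(\eta).$$ Call $a>0$ a truncation constant for $(K,\theta)$ if there is a real $b$ such that $\theta(\eta/a)=1$ whenever $|\eta|\le b$ (so $S_K=S$ there), while $|w|<|DQ(\eta)|$ for all $x\in K$, all $|\eta|\ge b$ and all $w\in\partial_\eta\psi(x,\eta)\cup\partial_\eta\psi_K(x,\eta)$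 (Clarke derivatives with respect to $\eta$). Let $R_{S_K}(x)$ be the minmax of $S_K(x,\cdot)$. Proposition. (i) For every $x\in\mathbb R^d$ the minmax $R_S(x)$ is well defined, and it is a critical value, in Clarke's sense, of $\eta\mapsto S(x,\eta)$. (ii) For every compact $K\subset\mathbb R^d$ and every $\theta$ as above, all sufficiently large $a$ are truncation constants for $(K,\theta)$; and for every truncation constant $a$ and every $x\in K$, the minmax $R_{S_K}(x)$ is well defined and $R_S(x)=R_{S_K}(x)$. -/

import Mathlib

open Set Filter Topology MeasureTheory
open scoped NNReal ContDiff

noncomputable section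

/-! ### Clarke's generalized derivative -/

section Clarke

variable {X : Type*} [NormedAddCommGroup X] [NormedSpace ℝ X]

/-- Clarke's generalized derivative of `f` at `a`: the convex hull of the set of limits of
`df (x n)`, where `x n → a` runs through points of differentiability of `f`. -/
def clarkeDeriv (f : X → ℝ) (a : X) : Set (X →L[ℝ] ℝ) :=
  convexHull ℝ {y | (a, y) ∈ closure
    {p : X × (X →L[ℝ] ℝ) | DifferentiableAt ℝ f p.1 ∧ p.2 = fderiv ℝ f p.1}}

/-- `c` is a critical value of `f` in Clarke's sense: `c = f x` for some `x` with `0 ∈ ∂f(x)`. -/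
def IsClarkeCriticalValue (f : X → ℝ) (c : ℝ) : Prop :=
  ∃ x : X, (0 : X →L[ℝ] ℝ) ∈ clarkeDeriv f x ∧ f x = c

end Clarke

/-! ### Relative singular homology of pairs of subsets, with coefficients in `ℤ/2` -/

section Homology

variable {X : Type*} [TopologicalSpace X]

/-- Singular `n`-simplices of `X`. -/
abbrev SingSimplex (n : ℕ) (X : Type*) [TopologicalSpace X] : Type _ :=
  C(stdSimplex ℝ (Fin (n + 1)), X)

/-- Singular `n`-chains of `X` with coefficients in `ℤ/2`. -/
abbrev SingChain (n : ℕ) (X : Type*) [TopologicalSpace X] : Type _ :=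
  SingSimplex n X →₀ ZMod 2

/-- The `i`-th face of a singular `(n+1)`-simplex. -/
def SingSimplex.face {n : ℕ} (τ : SingSimplex (n + 1) X) (i : Fin (n + 2)) : SingSimplex n X :=
  τ.comp ⟨stdSimplex.map i.succAbove, stdSimplex.continuous_map i.succAbove⟩

/-- The singular boundary operator (the signs are irrelevant mod 2); it is zero in degree `0`. -/
def singBoundary : (n : ℕ) → (SingChain n X →ₗ[ZMod 2] SingChain (n - 1) X)
  | 0 => 0
  | n + 1 => Finsupp.linearCombination (ZMod 2)
      fun τ : SingSimplex (n + 1) X => ∑ i : Fin (n + 2), Finsupp.single (τ.face i) (1 : ZMod 2)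

/-- The singular `n`-chains of the subspace `U`, seen inside those of `X`. -/
def chainsIn (n : ℕ) (U : Set X) : Submodule (ZMod 2) (SingChain n X) :=
  Finsupp.supported (ZMod 2) (ZMod 2) {τ : SingSimplex n X | range τ ⊆ U}

/-- Relative singular cycles of the pair `(U, V)`. -/
def relCycles (n : ℕ) (U V : Set X) : Submodule (ZMod 2) (SingChain n X) :=
  chainsIn n U ⊓ (chainsIn (n - 1) V).comap (singBoundary n)

/-- Relative singular boundaries of the pair `(U, V)`. -/
def relBoundaries (n : ℕ) (U V : Set X) : Submodule (ZMod 2) (SingChain n X) :=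
  (chainsIn (n + 1) U).map (singBoundary (n + 1)) ⊔ chainsIn n V

/-- The quotient `Z / (Z ∩ B)` of two submodules of a module. -/
abbrev SubQuotient {R M : Type*} [Ring R] [AddCommGroup M] [Module R M]
    (Z B : Submodule R M) : Type _ :=
  Z ⧸ B.submoduleOf Z

/-- The relative singular homology `H_n(U, V; ℤ/2)`, relative cycles modulo relative boundaries,
of a pair of subsets `V ⊆ U` of `X`. -/
abbrev RelHomology (n : ℕ) (U V : Set X) : Type _ :=
  SubQuotient (relCycles n U V) (relBoundaries n U V)

/-- The homology class of a relative cycle. -/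
def relClass {n : ℕ} {U V : Set X} (σ : relCycles n U V) : RelHomology n U V :=
  Submodule.Quotient.mk σ

/-- The image `|σ|` of a chain: the union of the images of the simplices occurring in it. -/
def chainImage {n : ℕ} (σ : SingChain n X) : Set X :=
  ⋃ τ ∈ σ.support, range (τ : SingSimplex n X)

/-! ### The minmax -/

/-- The sublevel set `f^a`. -/
def sublevel (f : X → ℝ) (a : ℝ) : Set X := {η | f η ≤ a}

/-- The numbers `max_{|σ|} f`, where `σ` runs through the descending cycles of dimension `n` at
level `a`, i.e. the relative cycles of `(f^a, f^{-a})` whose class generates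
`H_n(f^a, f^{-a}; ℤ/2)`. -/
def descendingMaxima (f : X → ℝ) (n : ℕ) (a : ℝ) : Set ℝ :=
  {m | ∃ σ : relCycles n (sublevel f a) (sublevel f (-a)),
    Submodule.span (ZMod 2) {relClass σ} = ⊤ ∧
    IsGreatest (f '' chainImage (σ : SingChain n X)) m}

/-- The minmax `inf_{[σ] = A} max_{|σ|} f`, where `A` generates
`H_n(f^∞, f^{-∞}; ℤ/2)`, the pair `(f^∞, f^{-∞})` standing for `(f^a, f^{-a})` with `a` large. -/
def minmax (f : X → ℝ) (n : ℕ) : ℝ :=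
  limUnder atTop fun a : ℝ => sInf (descendingMaxima f n a)

/-- The minmax of `f` (in dimension `n`) is well defined: for all large `a`, the homology
`H_i(f^a, f^{-a}; ℤ/2)` is `ℤ/2` if `i = n` and zero otherwise, the numbers `max_{|σ|} f` attached
to the descending cycles exist and have a finite infimum, and this infimum does not depend on `a`
(`IsGLB s r` in `ℝ` entails that `s` is nonempty and bounded below). -/
def MinmaxWellDefined (f : X → ℝ) (n : ℕ) : Prop :=
  ∃ a₀ : ℝ, ∀ a ≥ a₀,
    Nonempty (RelHomology n (sublevel f a) (sublevel f (-a)) ≃ₗ[ZMod 2] ZMod 2) ∧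
    (∀ i, i ≠ n → Subsingleton (RelHomology i (sublevel f a) (sublevel f (-a)))) ∧
    IsGLB (descendingMaxima f n a) (minmax f n)

end Homology

/-! ### Hamiltonian flows and their generating functions -/

/-- The Euclidean space `ℝ^d`. -/
abbrev Base (d : ℕ) : Type := EuclideanSpace ℝ (Fin d)

/-- `T*ℝ^d = ℝ^d × ℝ^d` with its Euclidean norm: the coordinates of a point `(x, y)`, where `y` is
the momentum, are those of `x` (indexed by `Sum.inl`) and those of `y` (indexed by `Sum.inr`). -/
abbrev Phase (d : ℕ) : Type := EuclideanSpace ℝ (Fin d ⊕ Fin d)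

section Hamiltonian

variable {d : ℕ}

/-- The point `(x, y)` of `T*ℝ^d`. -/
def Phase.mk (x y : Base d) : Phase d := WithLp.toLp 2 (Sum.elim x y)

/-- The position `x` of `(x, y)`. -/
def Phase.pos (z : Phase d) : Base d := WithLp.toLp 2 fun j => z (Sum.inl j)

/-- The momentum `y` of `(x, y)`. -/
def Phase.mom (z : Phase d) : Base d := WithLp.toLp 2 fun j => z (Sum.inr j)

/-- The Hamiltonian vector field `(∂_y h, -∂_x h)`. -/
def hamField (h : Phase d → ℝ) (z : Phase d) : Phase d :=
  Phase.mk (Phase.mom (gradient h z)) (-Phase.pos (gradient h z))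

/-- `γ` solves Hamilton's equations of `H` on `[0, T]`, with value `z` at time `s`. -/
def IsHamTrajectory (H : ℝ → Phase d → ℝ) (T s : ℝ) (z : Phase d) (γ : ℝ → Phase d) : Prop :=
  γ s = z ∧ ∀ τ ∈ Icc 0 T, HasDerivWithinAt γ (hamField (H τ) (γ τ)) (Icc 0 T) τ

open Classical in
/-- The Hamiltonian flow `φ_H^{s,τ}`, for `s, τ ∈ [0, T]`: the value at time `τ` of the solution
of Hamilton's equations that takes the value `z` at time `s` (and `z` if there is none). -/
def hamFlow (H : ℝ → Phase d → ℝ) (T s τ : ℝ) (z : Phase d) : Phase d :=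
  if h : ∃ γ, IsHamTrajectory H T s z γ then h.choose τ else z

/-- `c_H = sup |D²H_τ(z)|` over `τ ∈ [0, T]` and `z ∈ T*ℝ^d`. -/
def hamBound (H : ℝ → Phase d → ℝ) (T : ℝ) : ℝ :=
  sSup {r | ∃ τ ∈ Icc 0 T, ∃ z, r = ‖fderiv ℝ (fderiv ℝ (H τ)) z‖}

/-- The map `α_s^t : (x, y) ↦ (X_s^t(x, y), y)`. -/
def alphaMap (H : ℝ → Phase d → ℝ) (T s t : ℝ) (z : Phase d) : Phase d :=
  Phase.mk (Phase.pos (hamFlow H T s t z)) (Phase.mom z)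

/-- The generating function
`φ_H^{s,t}(X, y) = ∫_s^t ((Y_s^τ - y) · Ẋ_s^τ - H(τ, X_s^τ, Y_s^τ)) dτ` of `φ_H^{s,t}`,
where `(X_s^τ, Y_s^τ) = φ_H^{s,τ} ((α_s^t)⁻¹(X, y))` and the dot is the derivative in `τ`. -/
def genFun (H : ℝ → Phase d → ℝ) (T s t : ℝ) (X y : Base d) : ℝ :=
  let z : Phase d := Function.invFun (alphaMap H T s t) (Phase.mk X y)
  ∫ τ in s..t,
    (inner ℝ (Phase.mom (hamFlow H T s τ z) - y)
        (derivWithin (fun τ' => Phase.pos (hamFlow H T s τ' z)) (Icc 0 T) τ)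
      - H τ (hamFlow H T s τ z))

end Hamiltonian

/-! ### The generating family and its truncations -/

/-- The fibre `(T*ℝ^d)^N`, with its Euclidean norm; its points are `η = (x_i, y_i)_{0 ≤ i < N}`. -/
abbrev Fibre (d N : ℕ) : Type := EuclideanSpace ℝ (Fin N × (Fin d ⊕ Fin d))

section Family

variable {d N : ℕ}

/-- The component `x_i` of `η`. -/
def Fibre.pos (η : Fibre d N) (i : Fin N) : Base d := WithLp.toLp 2 fun j => η (i, Sum.inl j)

/-- The component `y_i` of `η`. -/
def Fibre.mom (η : Fibre d N) (i : Fin N) : Base d := WithLp.toLp 2 fun j => η (i, Sum.inr j)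

/-- The points `x_0, …, x_{N-1}, x_N` attached to `η` and `x`, where `x_N := x`. -/
def node (x : Base d) (η : Fibre d N) : Fin (N + 1) → Base d :=
  Fin.snoc (α := fun _ => Base d) (Fibre.pos η) x

/-- The generating family
`S(x, η) = v(x_0) + ∑_{i<N} φ_H^{t_i,t_{i+1}}(x_{i+1}, y_i) + ∑_{i<N} (x_{i+1} - x_i) · y_i`,
with `x_N := x`. -/
def genFamily (H : ℝ → Phase d → ℝ) (T : ℝ) (v : Base d → ℝ) (t : Fin (N + 1) → ℝ)
    (x : Base d) (η : Fibre d N) : ℝ :=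
  v (node x η 0)
    + ∑ i : Fin N, genFun H T (t i.castSucc) (t i.succ) (node x η i.succ) (Fibre.mom η i)
    + ∑ i : Fin N, inner ℝ (node x η i.succ - node x η i.castSucc) (Fibre.mom η i)

theorem node_add (η η' : Fibre d N) (j : Fin (N + 1)) :
    node 0 (η + η') j = node 0 η j + node 0 η' j := by
  refine Fin.lastCases ?_ (fun i => ?_) j
  · simp [node]
  · simp only [node, Fin.snoc_castSucc]; rfl

theorem node_smul (c : ℝ) (η : Fibre d N) (j : Fin (N + 1)) :
    node 0 (c • η) j = c • node 0 η j := by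
  refine Fin.lastCases ?_ (fun i => ?_) j
  · simp [node]
  · simp only [node, Fin.snoc_castSucc]; rfl

theorem Fibre.mom_add (η η' : Fibre d N) (i : Fin N) :
    Fibre.mom (η + η') i = Fibre.mom η i + Fibre.mom η' i := rfl

theorem Fibre.mom_smul (c : ℝ) (η : Fibre d N) (i : Fin N) :
    Fibre.mom (c • η) i = c • Fibre.mom η i := rfl

/-- The quadratic form
`Q(η) = -x_{N-1} · y_{N-1} + ∑_{i<N-1} (x_{i+1} - x_i) · y_i`,
that is, `∑_{i<N} (x_{i+1} - x_i) · y_i` with `x_N := 0`. -/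
def quadForm (d N : ℕ) : QuadraticForm ℝ (Fibre d N) :=
  LinearMap.BilinMap.toQuadraticMap <| LinearMap.mk₂ ℝ
    (fun η η' : Fibre d N =>
      ∑ i : Fin N, inner ℝ (node 0 η i.succ - node 0 η i.castSucc) (Fibre.mom η' i))
    (fun η₁ η₂ η' => by
      simp only [node_add, ← Finset.sum_add_distrib, ← inner_add_left]
      exact Finset.sum_congr rfl fun i _ => by congr 1; abel)
    (fun c η η' => by
      simp only [node_smul, ← smul_sub, real_inner_smul_left, Finset.mul_sum, smul_eq_mul])
    (fun η η₁ η₂ => by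
      simp only [Fibre.mom_add, inner_add_right, Finset.sum_add_distrib])
    (fun c η η' => by
      simp only [Fibre.mom_smul, real_inner_smul_right, Finset.mul_sum, smul_eq_mul])

/-- The truncation `S_K(x, η) = θ(η / a) (S(x, η) - Q(η)) + Q(η)` of the family `S`. -/
def truncFamily (S : Base d → Fibre d N → ℝ) (θ : Fibre d N → ℝ) (a : ℝ)
    (x : Base d) (η : Fibre d N) : ℝ :=
  θ (a⁻¹ • η) * (S x η - quadForm d N η) + quadForm d N η

/-- `θ` is a cut-off function: smooth with compact support, values in `[0, 1]`, and equal to `1`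
in a neighbourhood of `0`. -/
def IsCutoff (θ : Fibre d N → ℝ) : Prop :=
  ContDiff ℝ ∞ θ ∧ HasCompactSupport θ ∧ (∀ η, θ η ∈ Icc (0 : ℝ) 1) ∧ ∀ᶠ η in 𝓝 0, θ η = 1

/-- The constant `a` is large enough for the truncation over `K`: there is a ball
`{|η| ≤ b}` on which `θ(η / a) = 1`, hence `S_K = S`, whereas for `x ∈ K` and `|η| ≥ b` the Clarke
derivatives in `η` of `S - Q` and of `S_K - Q = θ(η / a) (S - Q)` are smaller than `|DQ(η)|`. -/
def IsTruncationConstant (S : Base d → Fibre d N → ℝ) (K : Set (Base d)) (θ : Fibre d N → ℝ)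
    (a : ℝ) : Prop :=
  0 < a ∧ ∃ b : ℝ, (∀ η : Fibre d N, ‖η‖ ≤ b → θ (a⁻¹ • η) = 1) ∧
    ∀ x ∈ K, ∀ η : Fibre d N, b ≤ ‖η‖ →
      ∀ w ∈ clarkeDeriv (fun η' => S x η' - quadForm d N η') η ∪
          clarkeDeriv (fun η' => truncFamily S θ a x η' - quadForm d N η') η,
        ‖w‖ < ‖fderiv ℝ (fun η' => quadForm d N η') η‖

end Family

end

/-! Write S(x,·) = Q + ψ. The quadratic form Q is nondegenerate, so |DQ(η)| ≥ c|η| with c > 0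
(`exists_quadForm_nondegenerate`), while ψ is globally Lipschitz in η
(`exists_lipschitz_genFamily_sub`). The second fact rests on the generating functions being
Lipschitz: for short times α_s^t is the identity plus a contraction, so its inverse is Lipschitz,
and the action along a trajectory is a Lipschitz function of its initial point. Thus, outside a
large ball, DQ dominates every Clarke derivative of ψ.

If two Lipschitz functions ψ₀, ψ₁ agree on a ball outside of which DQ dominates both, a single map,
a cut-off step along the normalized gradient of Q, decreases Q + ψ₀ and Q + ψ₁ together, by a
definite amount outside the ball (`exists_commonDescent`). Iterating it compares the sublevel sets,
and hence the homology and the minmax, of the two functions (`CommonDescent.minmax`). The number of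
iterations needed is not uniform on a sublevel set, but chains have compact images, so finitely many
steps suffice for each chain. Since the functions are only Lipschitz, the decrease comes from a mean
value inequality proved by averaging over small translations and Rademacher's theorem.

Comparing ψ with a compactly supported truncation shows that the minmax is well defined: at large
levels the sublevel sets of the truncated function are those of Q, whose relative homology is one
copy of ℤ/2 in the degree of the Morse index (`relHomology_quadraticForm`). That computation reduces
to ℝ^k relative to its punctured subspace, by induction on k, using homotopy invariance, a
connecting isomorphism, and excision by barycentric subdivision. Comparing ψ with ψ_K gives the
equality of the minmaxes in (ii). Large truncation constants exist because truncation at scale a ≥ 1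
keeps a Lipschitz constant independent of a (`exists_isTruncationConstant`).

Finally, were the minmax γ not a Clarke critical value, compactness near level γ would give locally
constant descent directions. Glued by a partition of unity, they push the sublevel γ + ε below γ - ε
(`exists_deformation`), and an almost optimal descending cycle pushed in this way contradicts the
definition of γ. -/

noncomputable section

/-! ### Augmented linear chains modulo two -/

section LinearChains

/-- Formal sums modulo two of `n`-tuples of points; `n = 0` is the augmentation. -/
abbrev LinChain (n : ℕ) (V : Type*) : Type _ := (Fin n → V) →₀ ZMod 2

variable {V W : Type*}

theorem linChain_add_self {ι : Type*} (x : ι →₀ ZMod 2) : x + x = 0 := by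
  ext i
  exact CharTwo.add_self_eq_zero (x i)

/-- The simplicial boundary. -/
def linBoundary (n : ℕ) : LinChain (n + 1) V →ₗ[ZMod 2] LinChain n V :=
  Finsupp.linearCombination (ZMod 2)
    fun v => ∑ i : Fin (n + 1), Finsupp.single (fun j => v (i.succAbove j)) (1 : ZMod 2)

/-- The cone with apex `b`. -/
def linCone (n : ℕ) (b : V) : LinChain n V →ₗ[ZMod 2] LinChain (n + 1) V :=
  Finsupp.lmapDomain (ZMod 2) (ZMod 2) (fun v => (Fin.cons b v : Fin (n + 1) → V))

/-- Push-forward of linear chains. -/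
def linMap (n : ℕ) (φ : V → W) : LinChain n V →ₗ[ZMod 2] LinChain n W :=
  Finsupp.lmapDomain (ZMod 2) (ZMod 2) (fun v => φ ∘ v)

@[simp] theorem linBoundary_single (n : ℕ) (v : Fin (n + 1) → V) :
    linBoundary n (Finsupp.single v 1) =
      ∑ i : Fin (n + 1), Finsupp.single (fun j => v (i.succAbove j)) (1 : ZMod 2) := by
  simp [linBoundary]

@[simp] theorem linCone_single (n : ℕ) (b : V) (v : Fin n → V) (c : ZMod 2) :
    linCone n b (Finsupp.single v c) = Finsupp.single (Fin.cons b v : Fin (n + 1) → V) c := by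
  simp [linCone]

@[simp] theorem linMap_single (n : ℕ) (φ : V → W) (v : Fin n → V) (c : ZMod 2) :
    linMap n φ (Finsupp.single v c) = Finsupp.single (φ ∘ v) c := by
  simp [linMap]

theorem linBoundary_linCone_zero (b : V) (x : LinChain 0 V) :
    linBoundary 0 (linCone 0 b x) = x := by
  induction x using Finsupp.induction_linear with
  | zero => simp
  | add f g hf hg => simp [hf, hg]
  | single v c =>
    rw [show Finsupp.single v c = c • Finsupp.single v (1 : ZMod 2) by simp]
    simp only [map_smul, linCone_single, linBoundary_single]
    rw [Fin.sum_univ_succ, Finset.univ_eq_empty, Finset.sum_empty, add_zero]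
    congr 2

theorem linBoundary_linCone_succ (n : ℕ) (b : V) (x : LinChain (n + 1) V) :
    linBoundary (n + 1) (linCone (n + 1) b x) = x + linCone n b (linBoundary n x) := by
  induction x using Finsupp.induction_linear with
  | zero => simp
  | add f g hf hg => simp only [map_add, hf, hg]; abel
  | single v c =>
    rw [show Finsupp.single v c = c • Finsupp.single v (1 : ZMod 2) by simp]
    simp only [map_smul, linCone_single, linBoundary_single, ← smul_add]
    congr 1
    rw [Fin.sum_univ_succ, map_sum]
    congr 1
    refine Finset.sum_congr rfl fun i _ => ?_
    rw [linCone_single]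
    congr 1
    ext j
    refine Fin.cases ?_ (fun j => ?_) j <;> simp

/-- Every simplex is the cone over its tail with apex its first vertex; two applications of the cone
formula leave each term twice, which is zero mod 2, and the induction disposes of the rest. -/
theorem linBoundary_linBoundary : ∀ (n : ℕ) (x : LinChain (n + 2) V),
    linBoundary n (linBoundary (n + 1) x) = 0
  | n, x => by
    induction x using Finsupp.induction_linear with
    | zero => simp
    | add f g hf hg => simp [hf, hg]
    | single v c =>
      rw [← Fin.cons_self_tail v, ← linCone_single, linBoundary_linCone_succ, map_add]
      cases n with
      | zero => rw [linBoundary_linCone_zero]; exact linChain_add_self _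
      | succ n =>
        rw [linBoundary_linCone_succ, linBoundary_linBoundary n, map_zero, add_zero]
        exact linChain_add_self _

theorem linMap_linBoundary (n : ℕ) (φ : V → W) (x : LinChain (n + 1) V) :
    linMap n φ (linBoundary n x) = linBoundary n (linMap (n + 1) φ x) := by
  induction x using Finsupp.induction_linear with
  | zero => simp
  | add f g hf hg => simp [hf, hg]
  | single v c =>
    rw [show Finsupp.single v c = c • Finsupp.single v (1 : ZMod 2) by simp]
    simp only [map_smul, linMap_single, linBoundary_single, map_sum]
    rfl

theorem linMap_linCone (n : ℕ) (φ : V → W) (b : V) (x : LinChain n V) :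
    linMap (n + 1) φ (linCone n b x) = linCone n (φ b) (linMap n φ x) := by
  induction x using Finsupp.induction_linear with
  | zero => simp
  | add f g hf hg => simp [hf, hg]
  | single v c =>
    simp only [linMap_single, linCone_single]
    congr 1
    ext j
    refine Fin.cases ?_ (fun j => ?_) j <;> simp

variable (b : ∀ n, (Fin (n + 1) → V) → W) (M : ∀ n, LinChain n V →ₗ[ZMod 2] LinChain n W)

/-- The homotopy operator obtained by coning off, with apices `b`, the chain map `M`. -/
def linHomotopy : ∀ n, LinChain n V →ₗ[ZMod 2] LinChain (n + 1) W
  | 0 => 0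
  | n + 1 => Finsupp.linearCombination (ZMod 2) fun v =>
      linCone (n + 1) (b n v)
        (M (n + 1) (Finsupp.single v 1) + linHomotopy n (linBoundary n (Finsupp.single v 1)))

theorem linHomotopy_succ_single (n : ℕ) (v : Fin (n + 1) → V) :
    linHomotopy b M (n + 1) (Finsupp.single v 1) = linCone (n + 1) (b n v)
        (M (n + 1) (Finsupp.single v 1)
          + linHomotopy b M n (linBoundary n (Finsupp.single v 1))) := by
  rw [linHomotopy, Finsupp.linearCombination_single, one_smul]

/-- By induction `M v + h ∂v` is a cycle, and coning off a cycle produces a chain that it bounds.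
The hypothesis that `M` vanishes on the augmentation starts the induction. -/
theorem linBoundary_linHomotopy (hM0 : M 0 = 0)
    (hM : ∀ n x, linBoundary n (M (n + 1) x) = M n (linBoundary n x)) :
    ∀ (n : ℕ) (x : LinChain (n + 1) V), linBoundary (n + 1) (linHomotopy b M (n + 1) x) =
      M (n + 1) x + linHomotopy b M n (linBoundary n x)
  | n, x => by
    induction x using Finsupp.induction_linear with
    | zero => simp
    | add f g hf hg => simp only [map_add, hf, hg]; abel
    | single v c =>
      rw [show Finsupp.single v c = c • Finsupp.single v (1 : ZMod 2) by simp]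
      simp only [map_smul, ← smul_add]
      congr 1
      rw [linHomotopy_succ_single, linBoundary_linCone_succ]
      convert add_zero _
      convert (linCone n (b n v)).map_zero
      rw [map_add, hM]
      cases n with
      | zero => simp [hM0, linHomotopy]
      | succ n =>
        rw [linBoundary_linHomotopy hM0 hM n, linBoundary_linBoundary, map_zero, add_zero]
        exact linChain_add_self _

/-- Naturality, provided that the apices correspond. It is what lets the operator descend from model
simplices to singular chains, compatibly with faces. -/
theorem linMap_linHomotopy {V' W' : Type*} (b' : ∀ n, (Fin (n + 1) → V') → W')
    (M' : ∀ n, LinChain n V' →ₗ[ZMod 2] LinChain n W') (φ : V → V') (χ : W → W')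
    (hb : ∀ n v, χ (b n v) = b' n (φ ∘ v)) (hM : ∀ n x, linMap n χ (M n x) = M' n (linMap n φ x)) :
    ∀ (n : ℕ) (x : LinChain n V),
      linMap (n + 1) χ (linHomotopy b M n x) = linHomotopy b' M' n (linMap n φ x)
  | 0, x => by simp [linHomotopy]
  | n + 1, x => by
    induction x using Finsupp.induction_linear with
    | zero => simp
    | add f g hf hg => simp only [map_add, hf, hg]
    | single v c =>
      rw [show Finsupp.single v c = c • Finsupp.single v (1 : ZMod 2) by simp]
      simp only [map_smul]
      congr 1
      rw [linHomotopy_succ_single, linMap_linCone, map_add, hM,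
        linMap_linHomotopy b' M' φ χ hb hM n, linMap_linBoundary, linMap_single,
        linHomotopy_succ_single, hb]

variable (b : ∀ n, (Fin (n + 1) → V) → V)

/-- Subdivision of linear chains, with "barycentres" `b`. -/
def linSubdiv : ∀ n, LinChain n V →ₗ[ZMod 2] LinChain n V
  | 0 => LinearMap.id
  | n + 1 => Finsupp.linearCombination (ZMod 2) fun v =>
      linCone n (b n v) (linSubdiv n (linBoundary n (Finsupp.single v 1)))

theorem linSubdiv_succ_single (n : ℕ) (v : Fin (n + 1) → V) :
    linSubdiv b (n + 1) (Finsupp.single v 1) =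
      linCone n (b n v) (linSubdiv b n (linBoundary n (Finsupp.single v 1))) := by
  rw [linSubdiv, Finsupp.linearCombination_single, one_smul]

/-- The subdivided boundary is a cycle by induction, so the cone over it has it as boundary. -/
theorem linBoundary_linSubdiv : ∀ (n : ℕ) (x : LinChain (n + 1) V),
    linBoundary n (linSubdiv b (n + 1) x) = linSubdiv b n (linBoundary n x)
  | n, x => by
    induction x using Finsupp.induction_linear with
    | zero => simp
    | add f g hf hg => simp only [map_add, hf, hg]
    | single v c =>
      rw [show Finsupp.single v c = c • Finsupp.single v (1 : ZMod 2) by simp]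
      simp only [map_smul]
      congr 1
      rw [linSubdiv_succ_single]
      cases n with
      | zero => rw [linBoundary_linCone_zero]
      | succ n =>
        rw [linBoundary_linCone_succ, linBoundary_linSubdiv n, linBoundary_linBoundary]
        simp

theorem linMap_linSubdiv {V' : Type*} (b' : ∀ n, (Fin (n + 1) → V') → V') (φ : V → V')
    (hb : ∀ n v, φ (b n v) = b' n (φ ∘ v)) : ∀ (n : ℕ) (x : LinChain n V),
      linMap n φ (linSubdiv b n x) = linSubdiv b' n (linMap n φ x)
  | 0, x => by simp [linSubdiv]
  | n + 1, x => by
    induction x using Finsupp.induction_linear with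
    | zero => simp
    | add f g hf hg => simp only [map_add, hf, hg]
    | single v c =>
      rw [show Finsupp.single v c = c • Finsupp.single v (1 : ZMod 2) by simp]
      simp only [map_smul]
      congr 1
      rw [linSubdiv_succ_single, linMap_linCone, linMap_linSubdiv b' φ hb n, linMap_linBoundary,
        linMap_single, linSubdiv_succ_single, hb]

end LinearChains

/-! ### Affine simplices and singular subdivision -/

section AffineSimplices

variable {E F : Type*} [NormedAddCommGroup E] [NormedSpace ℝ E] [NormedAddCommGroup F]
  [NormedSpace ℝ F] {C : Set E} {D : Set F} {X Y : Type*} [TopologicalSpace X] [TopologicalSpace Y]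

/-- The point with barycentric coordinates `t` with respect to the points `v i` of a convex set. -/
def affComb (hC : Convex ℝ C) {n : ℕ} (v : Fin (n + 1) → C) (t : stdSimplex ℝ (Fin (n + 1))) : C :=
  ⟨∑ i, t i • (v i : E), hC.sum_mem (fun i _ => t.2.1 i) t.2.2 fun i _ => (v i).2⟩

/-- The affine simplex with vertices `v i`. -/
def affSimplex (hC : Convex ℝ C) {n : ℕ} (v : Fin (n + 1) → C) :
    C(stdSimplex ℝ (Fin (n + 1)), C) where
  toFun := affComb hC v
  continuous_toFun := by
    refine Continuous.subtype_mk ?_ _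
    refine continuous_finsetSum _ fun i _ => ?_
    exact ((continuous_apply i).comp continuous_subtype_val).smul continuous_const

/-- The singular chain carried by a linear chain. -/
def realize (hC : Convex ℝ C) (f : C(C, X)) (n : ℕ) :
    LinChain (n + 1) C →ₗ[ZMod 2] SingChain n X :=
  Finsupp.lmapDomain (ZMod 2) (ZMod 2) fun v => f.comp (affSimplex hC v)

@[simp] theorem realize_single (hC : Convex ℝ C) (f : C(C, X)) (n : ℕ) (v : Fin (n + 1) → C)
    (c : ZMod 2) : realize hC f n (Finsupp.single v c) =
      Finsupp.single (f.comp (affSimplex hC v)) c := by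
  simp [realize]

theorem affSimplex_face (hC : Convex ℝ C) (f : C(C, X)) {n : ℕ} (v : Fin (n + 2) → C)
    (i : Fin (n + 2)) : SingSimplex.face (f.comp (affSimplex hC v)) i =
      f.comp (affSimplex hC fun j => v (i.succAbove j)) := by
  ext t
  simp only [SingSimplex.face, ContinuousMap.comp_apply]
  congr 1
  apply Subtype.ext
  change ∑ j, (stdSimplex.map i.succAbove t) j • (v j : E) = ∑ j, t j • (v (i.succAbove j) : E)
  rw [Fin.sum_univ_succAbove _ i]
  -- A point of the face opposite to vertex `i` has zero `i`-th barycentric coordinate, and its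
  -- other coordinates are those of `t`.
  have h0 : (stdSimplex.map i.succAbove t) i = 0 := by
    rw [stdSimplex.map_coe, FunOnFinite.linearMap_apply_apply]
    refine Finset.sum_eq_zero fun j hj => ?_
    simp [Fin.succAbove_ne] at hj
  have h1 : ∀ j, (stdSimplex.map i.succAbove t) (i.succAbove j) = t j := fun j => by
    rw [stdSimplex.map_coe, FunOnFinite.linearMap_apply_apply]
    rw [Finset.sum_eq_single j]
    · intro k hk hkj
      simp only [Finset.mem_filter] at hk
      exact absurd (Fin.succAbove_right_injective hk.2) hkj
    · simp
  simp [h0, h1]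

theorem singBoundary_single (n : ℕ) (τ : SingSimplex (n + 1) X) :
    singBoundary (n + 1) (Finsupp.single τ 1) = ∑ i, Finsupp.single (τ.face i) (1 : ZMod 2) := by
  change Finsupp.linearCombination _ _ _ = _
  simp

theorem singBoundary_realize (hC : Convex ℝ C) (f : C(C, X)) (n : ℕ) (x : LinChain (n + 2) C) :
    singBoundary (n + 1) (realize hC f (n + 1) x) = realize hC f n (linBoundary (n + 1) x) := by
  induction x using Finsupp.induction_linear with
  | zero => simp
  | add f g hf hg => simp only [map_add, hf, hg]
  | single v c =>
    rw [show Finsupp.single v c = c • Finsupp.single v (1 : ZMod 2) by simp]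
    simp only [map_smul, realize_single, linBoundary_single, map_sum]
    rw [singBoundary_single]
    simp only [affSimplex_face]

/-- A map between convex sets is affine if it commutes with barycentric combinations. -/
def IsAffComb (hC : Convex ℝ C) (hD : Convex ℝ D) (φ : C → D) : Prop :=
  ∀ (n : ℕ) (v : Fin (n + 1) → C) (t : stdSimplex ℝ (Fin (n + 1))),
    φ (affComb hC v t) = affComb hD (φ ∘ v) t

theorem realize_comp (hC : Convex ℝ C) (hD : Convex ℝ D) (φ : C(C, D)) (hφ : IsAffComb hC hD φ)
    (f : C(D, X)) (n : ℕ) (x : LinChain (n + 1) C) :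
    realize hC (f.comp φ) n x = realize hD f n (linMap (n + 1) φ x) := by
  induction x using Finsupp.induction_linear with
  | zero => simp
  | add f g hf hg => simp only [map_add, hf, hg]
  | single v c =>
    simp only [linMap_single, realize_single]
    congr 1
    ext t
    exact congrArg f (hφ n v t)

theorem realize_mem (hC : Convex ℝ C) (f : C(C, X)) (n : ℕ) (x : LinChain (n + 1) C) :
    realize hC f n x ∈ chainsIn n (range f) := by
  induction x using Finsupp.induction_linear with
  | zero => simp
  | add f g hf hg => rw [map_add]; exact add_mem hf hg
  | single v c =>
    rw [realize_single]
    refine Finsupp.single_mem_supported _ _ ?_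
    rintro _ ⟨t, rfl⟩
    exact ⟨_, rfl⟩

/-- Push-forward of singular chains. -/
def singMap (n : ℕ) (f : C(X, Y)) : SingChain n X →ₗ[ZMod 2] SingChain n Y :=
  Finsupp.lmapDomain (ZMod 2) (ZMod 2) fun τ => f.comp τ

@[simp] theorem singMap_single (n : ℕ) (f : C(X, Y)) (τ : SingSimplex n X) (c : ZMod 2) :
    singMap n f (Finsupp.single τ c) = Finsupp.single (f.comp τ) c := by
  simp [singMap]

theorem singMap_realize (hC : Convex ℝ C) (g : C(X, Y)) (f : C(C, X)) (n : ℕ)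
    (x : LinChain (n + 1) C) : singMap n g (realize hC f n x) = realize hC (g.comp f) n x := by
  induction x using Finsupp.induction_linear with
  | zero => simp
  | add f g hf hg => simp only [map_add, hf, hg]
  | single v c => simp only [realize_single, singMap_single]; rfl

theorem singMap_singBoundary (n : ℕ) (f : C(X, Y)) (x : SingChain (n + 1) X) :
    singMap n f (singBoundary (n + 1) x) = singBoundary (n + 1) (singMap (n + 1) f x) := by
  induction x using Finsupp.induction_linear with
  | zero => simp
  | add f g hf hg => simp only [map_add, hf, hg]
  | single v c =>
    rw [show Finsupp.single v c = c • Finsupp.single v (1 : ZMod 2) by simp]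
    simp only [map_smul, singMap_single, singBoundary_single, map_sum]
    rfl

theorem singMap_id (n : ℕ) (x : SingChain n X) : singMap n (ContinuousMap.id X) x = x := by
  induction x using Finsupp.induction_linear with
  | zero => simp
  | add f g hf hg => simp only [map_add, hf, hg]
  | single v c => simp

theorem singMap_comp {Z : Type*} [TopologicalSpace Z] (n : ℕ) (g : C(Y, Z)) (f : C(X, Y))
    (x : SingChain n X) : singMap n g (singMap n f x) = singMap n (g.comp f) x := by
  induction x using Finsupp.induction_linear with
  | zero => simp
  | add f g hf hg => simp only [map_add, hf, hg]
  | single v c => simp only [singMap_single]; rfl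

/-- The vertices of the standard simplex. -/
def stdVertices (n : ℕ) (i : Fin (n + 1)) : stdSimplex ℝ (Fin (n + 1)) := stdSimplex.vertex i

theorem convex_std (n : ℕ) : Convex ℝ (stdSimplex ℝ (Fin (n + 1))) := convex_stdSimplex ℝ _

theorem affComb_stdVertices (n : ℕ) (t : stdSimplex ℝ (Fin (n + 1))) :
    affComb (convex_std n) (stdVertices n) t = t := by
  apply Subtype.ext
  change ∑ i, t i • (Pi.single i 1 : Fin (n + 1) → ℝ) = t.1
  ext j
  simp [Pi.single_apply]
  rfl

/-- Each singular simplex is the image of the universal affine simplex. Operators that are natural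
for affine maps need only be defined on the latter. -/
theorem realize_stdVertices (n : ℕ) (τ : SingSimplex n X) :
    realize (convex_std n) τ n (Finsupp.single (stdVertices n) 1) = Finsupp.single τ 1 := by
  rw [realize_single]
  congr 1
  ext t
  exact congrArg τ (affComb_stdVertices n t)

/-- The inclusion of the `i`-th face of the standard simplex. -/
def faceMap (n : ℕ) (i : Fin (n + 2)) :
    C(stdSimplex ℝ (Fin (n + 1)), stdSimplex ℝ (Fin (n + 2))) :=
  ⟨stdSimplex.map i.succAbove, stdSimplex.continuous_map i.succAbove⟩

theorem isAffComb_faceMap (n : ℕ) (i : Fin (n + 2)) :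
    IsAffComb (convex_std n) (convex_std (n + 1)) (faceMap n i) := by
  intro m v t
  apply Subtype.ext
  change FunOnFinite.linearMap ℝ ℝ i.succAbove (∑ j, t j • (v j : Fin (n + 1) → ℝ)) =
    ∑ j, t j • FunOnFinite.linearMap ℝ ℝ i.succAbove (v j)
  simp only [map_sum, map_smul]

theorem faceMap_comp_stdVertices (n : ℕ) (i : Fin (n + 2)) :
    faceMap n i ∘ stdVertices n = fun j => stdVertices (n + 1) (i.succAbove j) := by
  ext1 j
  exact stdSimplex.map_vertex i.succAbove j

theorem linBoundary_stdVertices (n : ℕ) :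
    linBoundary (n + 1) (Finsupp.single (stdVertices (n + 1)) 1) =
      ∑ i, linMap (n + 1) (faceMap n i) (Finsupp.single (stdVertices n) 1) := by
  simp only [linBoundary_single, linMap_single, faceMap_comp_stdVertices]

theorem singBoundary_singBoundary (n : ℕ) (x : SingChain n X) :
    singBoundary (n - 1) (singBoundary n x) = 0 := by
  match n with
  -- In degrees 0 and 1 the outer operator is the boundary in degree 0, which is zero by definition.
  | 0 => rfl
  | 1 => rfl
  | n + 2 =>
    change singBoundary (n + 1) _ = 0
    induction x using Finsupp.induction_linear with
    | zero => simp
    | add f g hf hg => simp only [map_add, hf, hg, add_zero]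
    | single τ c =>
      rw [show Finsupp.single τ c = c • Finsupp.single τ (1 : ZMod 2) by simp]
      simp only [map_smul]
      rw [← realize_stdVertices, singBoundary_realize, singBoundary_realize,
        linBoundary_linBoundary, map_zero, smul_zero]

/-- The barycentre of an affine simplex. -/
def affBary (hC : Convex ℝ C) (n : ℕ) (v : Fin (n + 1) → C) : C :=
  affComb hC v stdSimplex.barycenter

/-- The iterated barycentric subdivision of linear chains. -/
def linSd (hC : Convex ℝ C) (m n : ℕ) : LinChain n C →ₗ[ZMod 2] LinChain n C :=
  (linSubdiv (affBary hC) n) ^ m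

theorem linBoundary_linSd (hC : Convex ℝ C) (m n : ℕ) (x : LinChain (n + 1) C) :
    linBoundary n (linSd hC m (n + 1) x) = linSd hC m n (linBoundary n x) := by
  induction m with
  | zero => rfl
  | succ m ih => simp only [linSd, pow_succ', Module.End.mul_apply] at ih ⊢
                 rw [linBoundary_linSubdiv, ih]

theorem linMap_linSd (hC : Convex ℝ C) (hD : Convex ℝ D) (φ : C → D) (hφ : IsAffComb hC hD φ)
    (m n : ℕ) (x : LinChain n C) : linMap n φ (linSd hC m n x) = linSd hD m n (linMap n φ x) := by
  induction m with
  | zero => rfl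
  | succ m ih =>
    simp only [linSd, pow_succ', Module.End.mul_apply] at ih ⊢
    rw [linMap_linSubdiv (affBary hC) (affBary hD) φ (fun n v => hφ n v _), ih]

/-- The iterated barycentric subdivision of singular chains. -/
def singSd (m n : ℕ) : SingChain n X →ₗ[ZMod 2] SingChain n X :=
  Finsupp.linearCombination (ZMod 2) fun τ =>
    realize (convex_std n) τ n (linSd (convex_std n) m (n + 1) (Finsupp.single (stdVertices n) 1))

theorem singSd_single (m n : ℕ) (τ : SingSimplex n X) : singSd m n (Finsupp.single τ 1) =
    realize (convex_std n) τ n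
      (linSd (convex_std n) m (n + 1) (Finsupp.single (stdVertices n) 1)) := by
  simp [singSd]

theorem singBoundary_singSd (m n : ℕ) (x : SingChain (n + 1) X) :
    singBoundary (n + 1) (singSd m (n + 1) x) = singSd m n (singBoundary (n + 1) x) := by
  induction x using Finsupp.induction_linear with
  | zero => simp
  | add f g hf hg => simp only [map_add, hf, hg]
  | single τ c =>
    rw [show Finsupp.single τ c = c • Finsupp.single τ (1 : ZMod 2) by simp]
    simp only [map_smul]
    congr 1
    rw [singSd_single, singBoundary_realize, linBoundary_linSd, linBoundary_stdVertices,
      map_sum, map_sum, singBoundary_single, map_sum]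
    refine Finset.sum_congr rfl fun i _ => ?_
    rw [singSd_single, ← linMap_linSd _ _ _ (isAffComb_faceMap n i), ← realize_comp _ _ _
      (isAffComb_faceMap n i)]
    rfl

end AffineSimplices

/-! ### The prism operator -/

section Prism

variable {E F : Type*} [NormedAddCommGroup E] [NormedSpace ℝ E] [NormedAddCommGroup F]
  [NormedSpace ℝ F] {C : Set E} {D : Set F} {X Y : Type*} [TopologicalSpace X] [TopologicalSpace Y]

/-- The prism over a convex set. -/
abbrev prism (C : Set E) : Set (E × ℝ) := C ×ˢ Icc (0 : ℝ) 1

theorem convex_prism (hC : Convex ℝ C) : Convex ℝ (prism C) := hC.prod (convex_Icc 0 1)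

/-- The section of a prism at height `s`. -/
def prismSection (C : Set E) (s : Icc (0 : ℝ) 1) : C(C, prism C) where
  toFun x := ⟨(x, s), x.2, s.2⟩
  continuous_toFun := by fun_prop

theorem isAffComb_prismSection (hC : Convex ℝ C) (s : Icc (0 : ℝ) 1) :
    IsAffComb hC (convex_prism hC) (prismSection C s) := by
  intro n v t
  apply Subtype.ext
  change ((∑ i, t i • (v i : E), (s : ℝ)) : E × ℝ) = ∑ i, t i • ((v i : E), (s : ℝ))
  rw [Prod.ext_iff]
  simp [Prod.fst_sum, Prod.snd_sum, ← Finset.sum_mul]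

/-- The prism over an affine map. -/
def prismMap (φ : C(C, D)) : C(prism C, prism D) where
  toFun p := ⟨(φ ⟨p.1.1, p.2.1⟩, p.1.2), (φ _).2, p.2.2⟩
  continuous_toFun := by fun_prop

theorem isAffComb_prismMap (hC : Convex ℝ C) (hD : Convex ℝ D) (φ : C(C, D))
    (hφ : IsAffComb hC hD φ) :
    IsAffComb (convex_prism hC) (convex_prism hD) (prismMap φ) := by
  intro n v t
  apply Subtype.ext
  have h1 := congrArg Subtype.val (hφ n (fun i => ⟨(v i).1.1, (v i).2.1⟩) t)
  have h2 : affComb hC (fun i => (⟨(v i).1.1, (v i).2.1⟩ : C)) t =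
      ⟨(affComb (convex_prism hC) v t).1.1, (affComb (convex_prism hC) v t).2.1⟩ := by
    apply Subtype.ext
    simp [affComb, Prod.fst_sum]
  rw [h2] at h1
  refine Prod.ext (h1.trans ?_) ?_
  · simp [affComb, Prod.fst_sum, prismMap]
  · simp [affComb, Prod.snd_sum, prismMap]

/-- The chain map whose null-homotopy is the prism operator. -/
def prismEnds (hC : Convex ℝ C) (m n : ℕ) : LinChain n C →ₗ[ZMod 2] LinChain n (prism C) :=
  linMap n (prismSection C 0) ∘ₗ linSd hC m n + linMap n (prismSection C 1)

/-- The apices of the prism operator. -/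
def prismApex (hC : Convex ℝ C) (n : ℕ) (v : Fin (n + 1) → C) : prism C :=
  prismSection C 0 (affBary hC n v)

/-- The prism operator on linear chains, from the `m`-th subdivision of the bottom to the top. -/
def linPrism (hC : Convex ℝ C) (m n : ℕ) : LinChain n C →ₗ[ZMod 2] LinChain (n + 1) (prism C) :=
  linHomotopy (prismApex hC) (prismEnds hC m) n

/-- Both ends of the prism have the same augmentation, so their sum vanishes mod 2. This is the base
case that `linBoundary_linHomotopy` requires. -/
theorem prismEnds_zero (hC : Convex ℝ C) (m : ℕ) : prismEnds hC m 0 = 0 := by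
  have h : ∀ x : LinChain 0 C, linSd hC m 0 x = x := fun x => by
    induction m with
    | zero => rfl
    | succ m ih => simp only [linSd, pow_succ', Module.End.mul_apply] at ih ⊢
                   rw [ih]; rfl
  ext v : 2
  simp only [prismEnds, LinearMap.comp_apply, LinearMap.add_apply, h]
  simp only [Finsupp.lsingle_apply, linMap_single, LinearMap.zero_apply]
  rw [Subsingleton.elim (prismSection C 1 ∘ v) (prismSection C 0 ∘ v)]
  exact linChain_add_self _

theorem linBoundary_linPrism (hC : Convex ℝ C) (m n : ℕ) (x : LinChain (n + 1) C) :
    linBoundary (n + 1) (linPrism hC m (n + 1) x) =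
      prismEnds hC m (n + 1) x + linPrism hC m n (linBoundary n x) := by
  refine linBoundary_linHomotopy _ _ (prismEnds_zero hC m) (fun n x => ?_) n x
  simp only [prismEnds, LinearMap.comp_apply, LinearMap.add_apply, map_add, ← linMap_linBoundary,
    linBoundary_linSd]

theorem linMap_linPrism (hC : Convex ℝ C) (hD : Convex ℝ D) (φ : C(C, D))
    (hφ : IsAffComb hC hD φ) (m n : ℕ) (x : LinChain n C) :
    linMap (n + 1) (prismMap φ) (linPrism hC m n x) = linPrism hD m n (linMap n φ x) := by
  have h : ∀ (s : Icc (0 : ℝ) 1) n (y : LinChain n C),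
      linMap n (prismMap φ) (linMap n (prismSection C s) y) =
        linMap n (prismSection D s) (linMap n φ y) := by
    intro s n y
    induction y using Finsupp.induction_linear with
    | zero => simp
    | add f g hf hg => simp only [map_add, hf, hg]
    | single v c => simp only [linMap_single]; rfl
  refine linMap_linHomotopy _ _ _ _ φ (prismMap φ) (fun n v => ?_) (fun n x => ?_) n x
  · exact congrArg (prismSection D 0) (hφ n v stdSimplex.barycenter)
  · simp only [prismEnds, LinearMap.comp_apply, LinearMap.add_apply, map_add, h,
      linMap_linSd hC hD φ hφ]

/-- The homotopy `H` composed with the prism over a singular simplex. -/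
def prismComp (H : C(ℝ × X, Y)) {n : ℕ} (τ : SingSimplex n X) :
    C(prism (stdSimplex ℝ (Fin (n + 1))), Y) where
  toFun p := H (p.1.2, τ ⟨p.1.1, p.2.1⟩)
  continuous_toFun := by fun_prop

/-- The map at time `s` of the homotopy `H`. -/
def homotopyAt (H : C(ℝ × X, Y)) (s : ℝ) : C(X, Y) where
  toFun x := H (s, x)
  continuous_toFun := by fun_prop

/-- The prism operator on singular chains. -/
def singPrism (H : C(ℝ × X, Y)) (m n : ℕ) : SingChain n X →ₗ[ZMod 2] SingChain (n + 1) Y :=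
  Finsupp.linearCombination (ZMod 2) fun τ =>
    realize (convex_prism (convex_std n)) (prismComp H τ) (n + 1)
      (linPrism (convex_std n) m (n + 1) (Finsupp.single (stdVertices n) 1))

theorem singPrism_single (H : C(ℝ × X, Y)) (m n : ℕ) (τ : SingSimplex n X) :
    singPrism H m n (Finsupp.single τ 1) =
      realize (convex_prism (convex_std n)) (prismComp H τ) (n + 1)
        (linPrism (convex_std n) m (n + 1) (Finsupp.single (stdVertices n) 1)) := by
  simp [singPrism]

theorem realize_prismEnds (H : C(ℝ × X, Y)) (m n : ℕ) (τ : SingSimplex n X) :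
    realize (convex_prism (convex_std n)) (prismComp H τ) n
      (prismEnds (convex_std n) m (n + 1) (Finsupp.single (stdVertices n) 1)) =
      singMap n (homotopyAt H 0) (singSd m n (Finsupp.single τ 1)) +
        singMap n (homotopyAt H 1) (Finsupp.single τ 1) := by
  simp only [prismEnds, LinearMap.comp_apply, LinearMap.add_apply, map_add]
  rw [← realize_comp _ _ _ (isAffComb_prismSection _ 0), ← realize_comp _ _ _
    (isAffComb_prismSection _ 1), singSd_single, ← realize_stdVertices n τ, singMap_realize,
    singMap_realize]
  rfl

/-- Degree 0 stands apart since there is no prism over a (-1)-chain: the corresponding linear term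
is zero by the definition of `linHomotopy`. -/
theorem singBoundary_singPrism_zero (H : C(ℝ × X, Y)) (m : ℕ) (x : SingChain 0 X) :
    singBoundary 1 (singPrism H m 0 x) =
      singMap 0 (homotopyAt H 0) (singSd m 0 x) + singMap 0 (homotopyAt H 1) x := by
  induction x using Finsupp.induction_linear with
  | zero => simp
  | add f g hf hg => simp only [map_add, hf, hg]; abel
  | single τ c =>
    rw [show Finsupp.single τ c = c • Finsupp.single τ (1 : ZMod 2) by simp]
    simp only [map_smul, ← smul_add]
    congr 1
    rw [singPrism_single, singBoundary_realize, linBoundary_linPrism, ← realize_prismEnds]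
    simp [linPrism, linHomotopy]

/-- One operator serves both for homotopy invariance (no subdivision) and for the fact that
subdivision is homologous to the identity (constant homotopy). -/
theorem singBoundary_singPrism_succ (H : C(ℝ × X, Y)) (m n : ℕ) (x : SingChain (n + 1) X) :
    singBoundary (n + 2) (singPrism H m (n + 1) x) =
      singMap (n + 1) (homotopyAt H 0) (singSd m (n + 1) x) +
        singMap (n + 1) (homotopyAt H 1) x + singPrism H m n (singBoundary (n + 1) x) := by
  induction x using Finsupp.induction_linear with
  | zero => simp
  | add f g hf hg => simp only [map_add, hf, hg]; abel
  | single τ c =>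
    rw [show Finsupp.single τ c = c • Finsupp.single τ (1 : ZMod 2) by simp]
    simp only [map_smul, ← smul_add]
    congr 1
    rw [singPrism_single, singBoundary_realize, linBoundary_linPrism, ← realize_prismEnds, map_add]
    congr 1
    rw [linBoundary_stdVertices, map_sum, map_sum, singBoundary_single, map_sum]
    refine Finset.sum_congr rfl fun i _ => ?_
    rw [singPrism_single, ← linMap_linPrism _ _ _ (isAffComb_faceMap n i), ← realize_comp _ _ _
      (isAffComb_prismMap _ _ _ (isAffComb_faceMap n i))]
    rfl

theorem singSd_zero (n : ℕ) (x : SingChain n X) : singSd 0 n x = x := by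
  induction x using Finsupp.induction_linear with
  | zero => simp
  | add f g hf hg => simp only [map_add, hf, hg]
  | single τ c =>
    rw [show Finsupp.single τ c = c • Finsupp.single τ (1 : ZMod 2) by simp]
    simp only [map_smul]
    congr 1
    rw [singSd_single]
    exact realize_stdVertices n τ

end Prism

/-! ### Small simplices -/

section SmallSimplices

variable {E : Type*} [NormedAddCommGroup E] [NormedSpace ℝ E] {C : Set E}
  {X : Type*} [TopologicalSpace X]

/-- Linear chains all of whose simplices have diameter at most `r`. -/
def meshChains (C : Set E) (n : ℕ) (r : ℝ) : Submodule (ZMod 2) (LinChain n C) :=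
  Finsupp.supported (ZMod 2) (ZMod 2)
    {v : Fin n → C | ∀ i j, dist (v i : E) (v j) ≤ r}

/-- Linear chains all of whose vertices lie in `A`. -/
def vertexChains (C : Set E) (n : ℕ) (A : Set E) : Submodule (ZMod 2) (LinChain n C) :=
  Finsupp.supported (ZMod 2) (ZMod 2) {v : Fin n → C | ∀ i, (v i : E) ∈ A}

theorem Finsupp.map_mem_of_single_mem {ι M : Type*} [AddCommGroup M] [Module (ZMod 2) M]
    (φ : (ι →₀ ZMod 2) →ₗ[ZMod 2] M) (N : Submodule (ZMod 2) M) {s : Set ι} {x : ι →₀ ZMod 2}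
    (hx : x ∈ Finsupp.supported (ZMod 2) (ZMod 2) s)
    (h : ∀ i ∈ s, φ (Finsupp.single i 1) ∈ N) : φ x ∈ N := by
  rw [Finsupp.supported_eq_span_single] at hx
  have : Submodule.span (ZMod 2) ((fun i => Finsupp.single i (1 : ZMod 2)) '' s) ≤ N.comap φ := by
    rw [Submodule.span_le]
    rintro _ ⟨i, hi, rfl⟩
    exact h i hi
  exact this hx

theorem affComb_mem_convexHull (hC : Convex ℝ C) {n : ℕ} (v : Fin (n + 1) → C)
    (t : stdSimplex ℝ (Fin (n + 1))) :
    (affComb hC v t : E) ∈ convexHull ℝ (range fun i => (v i : E)) :=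
  (convex_convexHull ℝ _).sum_mem (fun i _ => t.2.1 i) t.2.2
    fun i _ => subset_convexHull ℝ _ ⟨i, rfl⟩

/-- The difference between a vertex and the barycentre is the average of n + 1 edge vectors, one of
which is zero; hence the factor n/(n+1). A common bound N ≥ n is allowed because the estimate is
applied to faces of all dimensions. -/
theorem dist_affBary_le (hC : Convex ℝ C) {n N : ℕ} (hn : n ≤ N) (v : Fin (n + 1) → C) {r : ℝ}
    (hv : ∀ i j, dist (v i : E) (v j) ≤ r) (i : Fin (n + 1)) :
    dist (v i : E) (affBary hC n v) ≤ N / (N + 1) * r := by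
  have hr : 0 ≤ r := dist_nonneg.trans (hv i i)
  have e : (v i : E) - affBary hC n v = ((n : ℝ) + 1)⁻¹ • ∑ j, ((v i : E) - v j) := by
    have h1 : (affBary hC n v : E) = ((n : ℝ) + 1)⁻¹ • ∑ j, (v j : E) := by
      rw [Finset.smul_sum]
      change ∑ j, (stdSimplex.barycenter : stdSimplex ℝ (Fin (n + 1))).1 j • (v j : E) = _
      simp only [stdSimplex.barycenter_apply, Fintype.card_fin, Nat.cast_add, Nat.cast_one]
    rw [h1, Finset.sum_sub_distrib, smul_sub]
    congr 1
    simp only [Finset.sum_const, Finset.card_univ, Fintype.card_fin]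
    rw [← Nat.cast_smul_eq_nsmul ℝ, smul_smul]
    have : ((n : ℝ) + 1) ≠ 0 := by positivity
    simp [this]
  rw [dist_eq_norm, e, norm_smul, norm_inv, Real.norm_of_nonneg (by positivity)]
  have h2 : ‖∑ j, ((v i : E) - v j)‖ ≤ n * r := by
    rw [Fin.sum_univ_succAbove _ i, sub_self, zero_add]
    refine (norm_sum_le _ _).trans ?_
    refine (Finset.sum_le_sum (g := fun _ => r) fun j _ => ?_).trans_eq (by simp)
    · rw [← dist_eq_norm]; exact hv _ _
  calc ((n : ℝ) + 1)⁻¹ * ‖∑ j, ((v i : E) - v j)‖ ≤ ((n : ℝ) + 1)⁻¹ * (n * r) := by gcongr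
    _ = n / (n + 1) * r := by ring
    _ ≤ N / (N + 1) * r := by
      gcongr ?_ * r
      rw [div_le_div_iff₀ (by positivity) (by positivity)]
      have : (n : ℝ) ≤ N := by exact_mod_cast hn
      nlinarith

/-- An edge of the subdivision either lies in a subdivided face or joins the barycentre to a vertex
of one. The location of the vertices is carried through the induction in order to bound edges of the
second kind. -/
theorem linSubdiv_single_mem (hC : Convex ℝ C) {N : ℕ} {r : ℝ} :
    ∀ (n : ℕ), n ≤ N + 1 → ∀ v : Fin n → C, (∀ i j, dist (v i : E) (v j) ≤ r) →
      linSubdiv (affBary hC) n (Finsupp.single v 1) ∈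
        vertexChains C n (convexHull ℝ (range fun i => (v i : E))) ⊓
          meshChains C n (N / (N + 1) * r)
  | 0, _, v, _ => by
    refine ⟨?_, ?_⟩ <;> exact Finsupp.single_mem_supported _ _ (fun i => i.elim0)
  | n + 1, hn, v, hv => by
    have hr : 0 ≤ r := dist_nonneg.trans (hv 0 0)
    rw [linSubdiv_succ_single, linBoundary_single, map_sum, map_sum]
    refine sum_mem fun i _ => ?_
    have ih := linSubdiv_single_mem hC (N := N) n (by omega) (fun j => v (i.succAbove j))
      fun j k => hv _ _
    rw [vertexChains, meshChains, ← Finsupp.supported_inter] at ih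
    refine Finsupp.map_mem_of_single_mem _ _ ih fun w hw => ?_
    rw [linCone_single]
    have hsub : convexHull ℝ (range fun j => (v (i.succAbove j) : E)) ⊆
        convexHull ℝ (range fun i => (v i : E)) :=
      convexHull_mono (by rintro _ ⟨j, rfl⟩; exact ⟨_, rfl⟩)
    have hb : (affBary hC n v : E) ∈ convexHull ℝ (range fun i => (v i : E)) :=
      affComb_mem_convexHull hC v _
    have hd : ∀ j, dist (w j : E) (affBary hC n v) ≤ N / (N + 1) * r := fun j => by
      -- The distance from the barycentre to a point of the simplex is at most its distance to some
      -- vertex.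
      obtain ⟨_, ⟨k, rfl⟩, hk⟩ := convexHull_exists_dist_ge (hsub (hw.1 j)) (affBary hC n v : E)
      exact hk.trans (dist_affBary_le hC (by omega) v hv k)
    refine ⟨Finsupp.single_mem_supported _ _ ?_, Finsupp.single_mem_supported _ _ ?_⟩
    · exact fun j => Fin.cases hb (fun j => by simpa using hsub (hw.1 j)) j
    · intro j k
      refine Fin.cases ?_ (fun j => ?_) j <;> refine Fin.cases ?_ (fun k => ?_) k
      · simp only [Fin.cons_zero, dist_self]; positivity
      · rw [dist_comm]; simpa using hd k
      · simpa using hd j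
      · simpa using hw.2 j k

theorem linSd_mem_meshChains (hC : Convex ℝ C) (n m : ℕ) {r : ℝ}
    {x : LinChain (n + 1) C} (hx : x ∈ meshChains C (n + 1) r) :
    linSd hC m (n + 1) x ∈ meshChains C (n + 1) ((n / (n + 1)) ^ m * r) := by
  induction m with
  | zero => simpa [linSd] using hx
  | succ m ih =>
    have h : linSd hC (m + 1) (n + 1) x =
        linSubdiv (affBary hC) (n + 1) (linSd hC m (n + 1) x) := by
      simp only [linSd, pow_succ', Module.End.mul_apply]
    rw [h]
    refine Finsupp.map_mem_of_single_mem _ _ ih fun v hv => ?_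
    have := (linSubdiv_single_mem hC (N := n) (n + 1) le_rfl v hv).2
    rwa [← mul_assoc, ← pow_succ'] at this

theorem chainsIn_mono {n : ℕ} {U V : Set X} (h : U ⊆ V) : chainsIn n U ≤ chainsIn n V :=
  Finsupp.supported_mono fun _ hτ => hτ.trans h

/-- The mesh of the m-th subdivision of the standard simplex decays like (n/(n+1))^m, hence falls
below a Lebesgue number of the pulled back cover. -/
theorem exists_singSd_single_mem {U V : Set X} (hU : IsOpen U) (hV : IsOpen V) {n : ℕ}
    (τ : SingSimplex n X) (hτ : range τ ⊆ U ∪ V) :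
    ∃ m₀, ∀ m ≥ m₀, singSd m n (Finsupp.single τ 1) ∈ chainsIn n U ⊔ chainsIn n V := by
  obtain ⟨δ, hδ, hδ'⟩ := lebesgue_number_lemma_of_metric
    (isCompact_univ (X := stdSimplex ℝ (Fin (n + 1)))) (ι := Bool)
    (c := fun b => τ ⁻¹' (cond b U V))
    (fun b => (by cases b <;> assumption : IsOpen (cond b U V)).preimage τ.continuous)
    (fun t _ => by
      rcases hτ ⟨t, rfl⟩ with h | h
      · exact mem_iUnion.2 ⟨true, h⟩
      · exact mem_iUnion.2 ⟨false, h⟩)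
  have hlim : Tendsto (fun m : ℕ => ((n : ℝ) / (n + 1)) ^ m) atTop (𝓝 0) :=
    tendsto_pow_atTop_nhds_zero_of_lt_one (by positivity)
      ((div_lt_one (by positivity)).2 (by linarith))
  obtain ⟨m₀, hm₀⟩ := eventually_atTop.1 (hlim.eventually (gt_mem_nhds hδ))
  refine ⟨m₀, fun m hm => ?_⟩
  have hx : Finsupp.single (stdVertices n) (1 : ZMod 2) ∈
      meshChains (stdSimplex ℝ (Fin (n + 1))) (n + 1) 1 :=
    Finsupp.single_mem_supported _ _ fun i j =>
      (Metric.dist_le_diam_of_mem (bounded_stdSimplex _) (stdVertices n i).2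
        (stdVertices n j).2).trans diam_stdSimplex_le
  have hx' := linSd_mem_meshChains (convex_std n) n m hx
  rw [singSd_single]
  refine Finsupp.map_mem_of_single_mem _ _ hx' fun v hv => ?_
  rw [realize_single]
  obtain ⟨b, hb⟩ := hδ' (v 0) trivial
  have hr : range (τ.comp (affSimplex (convex_std n) v)) ⊆ cond b U V := by
    rintro _ ⟨t, rfl⟩
    refine hb (?_ : dist (affComb (convex_std n) v t) (v 0) < δ)
    obtain ⟨_, ⟨k, rfl⟩, hk⟩ := convexHull_exists_dist_ge
      (affComb_mem_convexHull (convex_std n) v t) (v 0 : Fin (n + 1) → ℝ)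
    refine (hk.trans (hv k 0)).trans_lt ?_
    simpa using hm₀ m hm
  cases b
  · exact Submodule.mem_sup_right (Finsupp.single_mem_supported _ _ hr)
  · exact Submodule.mem_sup_left (Finsupp.single_mem_supported _ _ hr)

theorem exists_singSd_mem {U V : Set X} (hU : IsOpen U) (hV : IsOpen V) {n : ℕ}
    {x : SingChain n X} (hx : x ∈ chainsIn n (U ∪ V)) :
    ∃ m₀, ∀ m ≥ m₀, singSd m n x ∈ chainsIn n U ⊔ chainsIn n V := by
  rw [chainsIn, Finsupp.supported_eq_span_single] at hx
  induction hx using Submodule.span_induction with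
  | mem x h =>
    obtain ⟨τ, hτ, rfl⟩ := h
    exact exists_singSd_single_mem hU hV τ hτ
  | zero => exact ⟨0, fun m _ => by simp⟩
  | add x y _ _ ihx ihy =>
    obtain ⟨m₁, h₁⟩ := ihx
    obtain ⟨m₂, h₂⟩ := ihy
    refine ⟨max m₁ m₂, fun m hm => ?_⟩
    rw [map_add]
    exact add_mem (h₁ m (le_trans (le_max_left _ _) hm)) (h₂ m (le_trans (le_max_right _ _) hm))
  | smul c x _ ihx =>
    obtain ⟨m₁, h₁⟩ := ihx
    exact ⟨m₁, fun m hm => by rw [map_smul]; exact Submodule.smul_mem _ _ (h₁ m hm)⟩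

end SmallSimplices

/-! ### Relative homology: functoriality, homotopy invariance, excision -/

section Relative

variable {X Y : Type*} [TopologicalSpace X] [TopologicalSpace Y]

/-- Isomorphisms in homology are checked on representatives: `φ` must preserve and reflect
boundaries among cycles, and reach every cycle modulo boundaries. -/
theorem nonempty_subQuotient_equiv {M M' : Type*} [AddCommGroup M] [Module (ZMod 2) M]
    [AddCommGroup M'] [Module (ZMod 2) M'] {Z B : Submodule (ZMod 2) M}
    {Z' B' : Submodule (ZMod 2) M'} (φ : M →ₗ[ZMod 2] M') (hZ : ∀ x ∈ Z, φ x ∈ Z')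
    (hB : ∀ x ∈ Z, x ∈ B → φ x ∈ B') (hinj : ∀ x ∈ Z, φ x ∈ B' → x ∈ B)
    (hsurj : ∀ y ∈ Z', ∃ x ∈ Z, φ x - y ∈ B') :
    Nonempty (SubQuotient Z B ≃ₗ[ZMod 2] SubQuotient Z' B') := by
  let ψ : SubQuotient Z B →ₗ[ZMod 2] SubQuotient Z' B' :=
    Submodule.mapQ _ _ (φ.restrict hZ) fun x hx => hB x.1 x.2 hx
  refine ⟨LinearEquiv.ofBijective ψ ⟨?_, ?_⟩⟩
  · rw [← LinearMap.ker_eq_bot, Submodule.eq_bot_iff]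
    intro x hx
    induction x using Submodule.Quotient.induction_on with
    | _ x =>
      replace hx : Submodule.Quotient.mk (p := B'.submoduleOf Z') (φ.restrict hZ x) = 0 := hx
      rw [Submodule.Quotient.mk_eq_zero] at hx
      rw [Submodule.Quotient.mk_eq_zero]
      exact hinj x.1 x.2 hx
  · intro y
    induction y using Submodule.Quotient.induction_on with
    | _ y =>
      obtain ⟨x, hx, h⟩ := hsurj y.1 y.2
      refine ⟨Submodule.Quotient.mk ⟨x, hx⟩, ?_⟩
      exact (Submodule.Quotient.eq _).2 h

theorem relClass_eq_zero {n : ℕ} {U V : Set X} (σ : relCycles n U V) :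
    relClass σ = 0 ↔ (σ : SingChain n X) ∈ relBoundaries n U V := by
  rw [relClass, Submodule.Quotient.mk_eq_zero]
  rfl

theorem subsingleton_relHomology {n : ℕ} {U V : Set X}
    (h : ∀ x ∈ relCycles n U V, x ∈ relBoundaries n U V) :
    Subsingleton (RelHomology n U V) := by
  refine ⟨fun x y => ?_⟩
  induction x using Submodule.Quotient.induction_on with
  | _ x =>
    induction y using Submodule.Quotient.induction_on with
    | _ y => exact (Submodule.Quotient.eq _).2 (h _ (x - y).2)

theorem mem_relBoundaries_of_subsingleton {n : ℕ} {U V : Set X}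
    [h : Subsingleton (RelHomology n U V)] {x : SingChain n X} (hx : x ∈ relCycles n U V) :
    x ∈ relBoundaries n U V :=
  (relClass_eq_zero ⟨x, hx⟩).1 (Subsingleton.elim _ _)

theorem singMap_mem_chainsIn (f : C(X, Y)) {n : ℕ} {U : Set X} {U' : Set Y} (h : MapsTo f U U')
    {x : SingChain n X} (hx : x ∈ chainsIn n U) : singMap n f x ∈ chainsIn n U' := by
  refine Finsupp.map_mem_of_single_mem _ _ hx fun τ hτ => ?_
  rw [singMap_single]
  refine Finsupp.single_mem_supported _ _ ?_
  rintro _ ⟨t, rfl⟩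
  exact h (hτ ⟨t, rfl⟩)

theorem singSd_mem_chainsIn (m : ℕ) {n : ℕ} {U : Set X}
    {x : SingChain n X} (hx : x ∈ chainsIn n U) : singSd m n x ∈ chainsIn n U := by
  refine Finsupp.map_mem_of_single_mem _ _ hx fun τ hτ => ?_
  rw [singSd_single]
  exact chainsIn_mono hτ (realize_mem _ _ _ _)

theorem singPrism_mem_chainsIn (H : C(ℝ × X, Y)) (m : ℕ) {n : ℕ} {U : Set X} {U' : Set Y}
    (h : ∀ s ∈ Icc (0 : ℝ) 1, ∀ x ∈ U, H (s, x) ∈ U')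
    {x : SingChain n X} (hx : x ∈ chainsIn n U) : singPrism H m n x ∈ chainsIn (n + 1) U' := by
  refine Finsupp.map_mem_of_single_mem _ _ hx fun τ hτ => ?_
  rw [singPrism_single]
  refine chainsIn_mono ?_ (realize_mem _ _ _ _)
  rintro _ ⟨p, rfl⟩
  exact h _ p.2.2 _ (hτ ⟨_, rfl⟩)

theorem singMap_boundary (n : ℕ) (f : C(X, Y)) (x : SingChain n X) :
    singBoundary n (singMap n f x) = singMap (n - 1) f (singBoundary n x) := by
  cases n with
  | zero => exact ((singMap _ f).map_zero).symm
  | succ n => exact (singMap_singBoundary n f x).symm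

theorem singSd_boundary (m n : ℕ) (x : SingChain n X) :
    singBoundary n (singSd m n x) = singSd m (n - 1) (singBoundary n x) := by
  cases n with
  | zero => exact ((singSd m _).map_zero).symm
  | succ n => exact singBoundary_singSd m n x

theorem singBoundary_mem_chainsIn {n : ℕ} {U : Set X} {x : SingChain n X}
    (hx : x ∈ chainsIn n U) : singBoundary n x ∈ chainsIn (n - 1) U := by
  cases n with
  | zero => exact zero_mem _
  | succ n =>
    refine Finsupp.map_mem_of_single_mem _ _ hx fun τ hτ => ?_
    rw [singBoundary_single]
    refine sum_mem fun i _ => Finsupp.single_mem_supported _ _ ?_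
    rintro _ ⟨t, rfl⟩
    exact hτ ⟨_, rfl⟩

theorem singMap_mem_relCycles (f : C(X, Y)) {n : ℕ} {U V : Set X} {U' V' : Set Y}
    (hU : MapsTo f U U') (hV : MapsTo f V V') {x : SingChain n X} (hx : x ∈ relCycles n U V) :
    singMap n f x ∈ relCycles n U' V' := by
  refine ⟨singMap_mem_chainsIn f hU hx.1, ?_⟩
  change singBoundary n _ ∈ chainsIn (n - 1) V'
  rw [singMap_boundary]
  exact singMap_mem_chainsIn f hV hx.2

/-- The boundary operator in positive degrees. -/
def singBd (n : ℕ) : SingChain (n + 1) X →ₗ[ZMod 2] SingChain n X := singBoundary (n + 1)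

theorem singBoundary_singBd (n : ℕ) (x : SingChain (n + 1) X) :
    singBoundary n (singBd n x) = 0 :=
  singBoundary_singBoundary (n + 1) x

theorem singBd_mem_chainsIn {n : ℕ} {U : Set X} {x : SingChain (n + 1) X}
    (hx : x ∈ chainsIn (n + 1) U) : singBd n x ∈ chainsIn n U :=
  singBoundary_mem_chainsIn hx

theorem mem_relBoundaries {n : ℕ} {U V : Set X} {x : SingChain n X} :
    x ∈ relBoundaries n U V ↔ ∃ β ∈ chainsIn (n + 1) U, ∃ ρ ∈ chainsIn n V,
      singBd n β + ρ = x := by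
  rw [relBoundaries, Submodule.mem_sup]
  simp only [Submodule.mem_map, exists_exists_and_eq_and]
  rfl

theorem singMap_mem_relBoundaries (f : C(X, Y)) {n : ℕ} {U V : Set X} {U' V' : Set Y}
    (hU : MapsTo f U U') (hV : MapsTo f V V') {x : SingChain n X}
    (hx : x ∈ relBoundaries n U V) : singMap n f x ∈ relBoundaries n U' V' := by
  obtain ⟨β, hβ, ρ, hρ, rfl⟩ := mem_relBoundaries.1 hx
  refine mem_relBoundaries.2 ⟨singMap (n + 1) f β, singMap_mem_chainsIn f hU hβ,
    singMap n f ρ, singMap_mem_chainsIn f hV hρ, ?_⟩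
  rw [map_add]
  congr 1
  exact (singMap_singBoundary n f β).symm

theorem relBoundaries_mono {n : ℕ} {U V U' V' : Set X} (hU : U ⊆ U') (hV : V ⊆ V') :
    relBoundaries n U V ≤ relBoundaries n U' V' :=
  sup_le_sup (Submodule.map_mono (chainsIn_mono hU)) (chainsIn_mono hV)

theorem relCycles_mono {n : ℕ} {U V U' V' : Set X} (hU : U ⊆ U') (hV : V ⊆ V') :
    relCycles n U V ≤ relCycles n U' V' :=
  inf_le_inf (chainsIn_mono hU) (Submodule.comap_mono (chainsIn_mono hV))

/-- Homotopy invariance, combined with subdivision. -/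
theorem homotopy_mem_relBoundaries (H : C(ℝ × X, Y)) (m : ℕ) {n : ℕ} {U V : Set X} {U' V' : Set Y}
    (hU : ∀ s ∈ Icc (0 : ℝ) 1, ∀ x ∈ U, H (s, x) ∈ U')
    (hV : ∀ s ∈ Icc (0 : ℝ) 1, ∀ x ∈ V, H (s, x) ∈ V')
    {x : SingChain n X} (hx : x ∈ relCycles n U V) :
    singMap n (homotopyAt H 0) (singSd m n x) + singMap n (homotopyAt H 1) x ∈
      relBoundaries n U' V' := by
  have h1 := singPrism_mem_chainsIn H m hU hx.1
  cases n with
  | zero =>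
    exact mem_relBoundaries.2 ⟨_, h1, 0, zero_mem _, by
      rw [add_zero]; exact singBoundary_singPrism_zero H m x⟩
  | succ n =>
    -- The prism over the boundary of `x` is a chain of `V'`, so it may be discarded; added twice it
    -- cancels mod 2.
    refine mem_relBoundaries.2 ⟨_, h1, _, singPrism_mem_chainsIn H m hV hx.2, ?_⟩
    have := singBoundary_singPrism_succ H m n x
    change singBd (n + 1) _ = _ at this
    rw [this, add_assoc]
    exact (congrArg _ (linChain_add_self _)).trans (add_zero _)

/-- This is the prism formula for the constant homotopy. -/
theorem add_singSd_mem_relBoundaries (m : ℕ) {n : ℕ} {U V : Set X} {x : SingChain n X}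
    (hx : x ∈ relCycles n U V) : singSd m n x + x ∈ relBoundaries n U V := by
  have := homotopy_mem_relBoundaries (⟨Prod.snd, continuous_snd⟩ : C(ℝ × X, X)) m
    (U' := U) (V' := V) (fun _ _ x h => h) (fun _ _ x h => h) hx
  have h (s : ℝ) : homotopyAt (⟨Prod.snd, continuous_snd⟩ : C(ℝ × X, X)) s =
    ContinuousMap.id X := rfl
  rwa [h, h, singMap_id, singMap_id] at this

theorem homotopy_add_mem_relBoundaries (H : C(ℝ × X, Y)) {n : ℕ} {U V : Set X} {U' V' : Set Y}
    (hU : ∀ s ∈ Icc (0 : ℝ) 1, ∀ x ∈ U, H (s, x) ∈ U')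
    (hV : ∀ s ∈ Icc (0 : ℝ) 1, ∀ x ∈ V, H (s, x) ∈ V')
    {x : SingChain n X} (hx : x ∈ relCycles n U V) :
    singMap n (homotopyAt H 0) x + singMap n (homotopyAt H 1) x ∈ relBoundaries n U' V' := by
  simpa only [singSd_zero] using homotopy_mem_relBoundaries H 0 hU hV hx

/-- A homotopy equivalence of pairs induces an isomorphism in homology. -/
theorem nonempty_relHomology_equiv (n : ℕ) {U V : Set X} {U' V' : Set Y} (f : C(X, Y))
    (hfU : MapsTo f U U') (hfV : MapsTo f V V') (g : C(Y, X)) (hgU : MapsTo g U' U)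
    (hgV : MapsTo g V' V) (H : C(ℝ × X, X)) (hH0 : ∀ x, H (0, x) = x) (hH1 : ∀ x, H (1, x) = g (f x))
    (hHU : ∀ s ∈ Icc (0 : ℝ) 1, ∀ x ∈ U, H (s, x) ∈ U)
    (hHV : ∀ s ∈ Icc (0 : ℝ) 1, ∀ x ∈ V, H (s, x) ∈ V)
    (H' : C(ℝ × Y, Y)) (hH'0 : ∀ y, H' (0, y) = y) (hH'1 : ∀ y, H' (1, y) = f (g y))
    (hHU' : ∀ s ∈ Icc (0 : ℝ) 1, ∀ y ∈ U', H' (s, y) ∈ U')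
    (hHV' : ∀ s ∈ Icc (0 : ℝ) 1, ∀ y ∈ V', H' (s, y) ∈ V') :
    Nonempty (RelHomology n U V ≃ₗ[ZMod 2] RelHomology n U' V') := by
  refine nonempty_subQuotient_equiv (singMap n f)
    (fun x hx => singMap_mem_relCycles f hfU hfV hx)
    (fun x _ hx => singMap_mem_relBoundaries f hfU hfV hx) (fun x hx hx' => ?_) (fun y hy => ?_)
  · have h1 := homotopy_add_mem_relBoundaries H hHU hHV hx
    have h2 := singMap_mem_relBoundaries g hgU hgV hx'
    rw [singMap_comp] at h2
    rw [show homotopyAt H 0 = ContinuousMap.id X from ContinuousMap.ext hH0, singMap_id,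
      show homotopyAt H 1 = g.comp f from ContinuousMap.ext hH1] at h1
    exact (Submodule.add_mem_iff_left _ h2).1 h1
  · refine ⟨singMap n g y, singMap_mem_relCycles g hgU hgV hy, ?_⟩
    have h1 := homotopy_add_mem_relBoundaries H' hHU' hHV' hy
    rw [show homotopyAt H' 0 = ContinuousMap.id Y from ContinuousMap.ext hH'0, singMap_id,
      show homotopyAt H' 1 = f.comp g from ContinuousMap.ext hH'1] at h1
    rw [singMap_comp, ZModModule.sub_eq_add, add_comm]
    exact h1

/-- Excision. -/
theorem nonempty_excision_equiv (n : ℕ) {U V : Set X} (hU : IsOpen U) (hV : IsOpen V) :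
    Nonempty (RelHomology n V (U ∩ V) ≃ₗ[ZMod 2] RelHomology n (U ∪ V) U) := by
  -- If a chain of `U` plus a chain of `V` is a chain of `U`, the second summand lies in `U ∩ V`.
  have key : ∀ k (y z : SingChain k X), y ∈ chainsIn k U → z ∈ chainsIn k V →
      ∀ w, w ∈ chainsIn k U → w = y + z → z ∈ chainsIn k (U ∩ V) := by
    intro k y z hy hz w hw h
    have hz' : z ∈ chainsIn k U := by
      rw [h] at hw
      exact (Submodule.add_mem_iff_right _ hy).1 hw
    have : chainsIn k (U ∩ V) = chainsIn k U ⊓ chainsIn k V := by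
      rw [chainsIn, chainsIn, chainsIn, ← Finsupp.supported_inter]
      congr 1
      ext τ
      exact subset_inter_iff
    rw [this]
    exact ⟨hz', hz⟩
  refine nonempty_subQuotient_equiv LinearMap.id
    (fun x hx => relCycles_mono subset_union_right inter_subset_left hx)
    (fun x _ hx => relBoundaries_mono subset_union_right inter_subset_left hx)
    (fun x hx hx' => ?_) (fun y hy => ?_)
  -- Injectivity: split a subdivision of the bounding chain as β₁ + β₂. Then `singSd m n x + ∂β₂ =
  -- ∂β₁ + singSd m n ρ` lies in both `V` and `U`, so the subdivided `x` bounds β₂ modulo `U ∩ V`.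
  · obtain ⟨β, hβ, ρ, hρ, h⟩ := mem_relBoundaries.1 hx'
    obtain ⟨m, hm⟩ := exists_singSd_mem hU hV hβ
    obtain ⟨β₁, h₁, β₂, h₂, h12⟩ := Submodule.mem_sup.1 (hm m le_rfl)
    have e : singSd m n x = singBd n β₁ + singBd n β₂ + singSd m n ρ := by
      rw [← map_add, h12]
      replace h : singBd n β + ρ = x := h
      rw [← h, map_add]
      congr 1
      exact (singBoundary_singSd m n β).symm
    refine (Submodule.add_mem_iff_right _ ?_).1 (add_singSd_mem_relBoundaries m hx)
    refine mem_relBoundaries.2 ⟨β₂, h₂, singSd m n x + singBd n β₂, ?_, ?_⟩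
    · refine key n (singBd n β₁ + singSd m n ρ) _
        (add_mem (singBd_mem_chainsIn h₁) (singSd_mem_chainsIn m hρ))
        (add_mem (singSd_mem_chainsIn m hx.1) (singBd_mem_chainsIn h₂)) 0 (zero_mem _) ?_
      rw [e]
      have a1 := linChain_add_self (singBd n β₁)
      have a2 := linChain_add_self (singBd n β₂)
      have a3 := linChain_add_self (singSd m n ρ)
      calc (0 : SingChain n X) = (singBd n β₁ + singBd n β₁) +
            (singBd n β₂ + singBd n β₂) +
            (singSd m n ρ + singSd m n ρ) := by rw [a1, a2, a3]; simp
        _ = _ := by abel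
    · have a2 := linChain_add_self (singBd n β₂)
      calc _ = singSd m n x + (singBd n β₂ + singBd n β₂) := by abel
        _ = _ := by rw [a2, add_zero]
  -- Surjectivity: the part in `V` of a subdivision of `y` represents the class of `y`, the part in
  -- `U` being negligible.
  · obtain ⟨m, hm⟩ := exists_singSd_mem hU hV hy.1
    obtain ⟨y₁, h₁, y₂, h₂, h12⟩ := Submodule.mem_sup.1 (hm m le_rfl)
    refine ⟨y₂, ⟨h₂, ?_⟩, ?_⟩
    · refine key (n - 1) (singBoundary n y₁) _ (singBoundary_mem_chainsIn h₁)
        (singBoundary_mem_chainsIn h₂) (singSd m (n - 1) (singBoundary n y))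
        (singSd_mem_chainsIn m hy.2) ?_
      rw [← singSd_boundary, ← h12, map_add]
    · have h3 := add_singSd_mem_relBoundaries m hy
      rw [← h12] at h3
      rw [LinearMap.id_apply, ZModModule.sub_eq_add]
      have h4 : y₁ ∈ relBoundaries n (U ∪ V) U :=
        mem_relBoundaries.2 ⟨0, zero_mem _, y₁, h₁, by simp⟩
      refine (Submodule.add_mem_iff_right _ h4).1 ?_
      rwa [← add_assoc]

/-- The connecting isomorphism of a triple `(U, W, V)` when the pair `(U, V)` is acyclic. -/
theorem nonempty_connecting_equiv (n : ℕ) {U W V : Set X} (hVW : V ⊆ W) (hWU : W ⊆ U)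
    (h : ∀ k, Subsingleton (RelHomology k U V)) :
    Nonempty (RelHomology (n + 1) U W ≃ₗ[ZMod 2] RelHomology n W V) := by
  refine nonempty_subQuotient_equiv (singBd n) (fun x hx => ⟨hx.2, ?_⟩)
    (fun x _ hx' => ?_) (fun x hx hx' => ?_) (fun y hy => ?_)
  · change singBoundary n (singBd n x) ∈ chainsIn (n - 1) V
    rw [singBoundary_singBd]
    exact zero_mem _
  · obtain ⟨β, hβ, ρ, hρ, rfl⟩ := mem_relBoundaries.1 hx'
    have : singBd n (singBd (n + 1) β) = 0 := singBoundary_singBd (n + 1) β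
    rw [map_add, this, zero_add]
    exact mem_relBoundaries.2 ⟨ρ, hρ, 0, zero_mem _, add_zero _⟩
  · obtain ⟨β, hβ, ρ, hρ, e⟩ := mem_relBoundaries.1 hx'
    -- Correcting `x` by the chain β of `W` makes it a cycle relative to `V`, to which the
    -- acyclicity of `(U, V)` applies.
    have hc : x + β ∈ relCycles (n + 1) U V := by
      refine ⟨add_mem hx.1 (chainsIn_mono hWU hβ), ?_⟩
      change singBd n (x + β) ∈ chainsIn n V
      rw [map_add, ← e]
      have : singBd n β + ρ + singBd n β = ρ := by
        have a := linChain_add_self (singBd n β)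
        calc _ = singBd n β + singBd n β + ρ := by abel
          _ = ρ := by rw [a, zero_add]
      rw [this]
      exact hρ
    have := relBoundaries_mono (subset_refl U) hVW (mem_relBoundaries_of_subsingleton hc)
    refine (Submodule.add_mem_iff_left _ ?_).1 this
    exact mem_relBoundaries.2 ⟨0, zero_mem _, β, hβ, by simp⟩
  -- A relative cycle of `(W, V)` bounds in `U` modulo `V`; the bounding chain is the required
  -- preimage.
  · have hy' : y ∈ relCycles n U V := ⟨chainsIn_mono hWU hy.1, hy.2⟩
    obtain ⟨β, hβ, ρ, hρ, e⟩ := mem_relBoundaries.1 (mem_relBoundaries_of_subsingleton hy')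
    refine ⟨β, ⟨hβ, ?_⟩, mem_relBoundaries.2 ⟨0, zero_mem _, ρ, hρ, ?_⟩⟩
    · change singBd n β ∈ chainsIn n W
      rw [← e] at hy
      exact (Submodule.add_mem_iff_left _ (chainsIn_mono hVW hρ)).1 hy.1
    · rw [← e, map_zero, zero_add, ZModModule.sub_eq_add, ← add_assoc, linChain_add_self, zero_add]

end Relative

/-! ### The homology of `ℝ^k` relative to the complement of the origin -/

section PuncturedSpace

theorem subsingleton_relHomology_of_contraction {X : Type*} [TopologicalSpace X] (n : ℕ)
    {U V : Set X} (H : C(ℝ × X, X)) (hH0 : ∀ x, H (0, x) = x) (hH1 : ∀ x, H (1, x) ∈ V)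
    (hHU : ∀ s ∈ Icc (0 : ℝ) 1, ∀ x ∈ U, H (s, x) ∈ U)
    (hHV : ∀ s ∈ Icc (0 : ℝ) 1, ∀ x ∈ V, H (s, x) ∈ V) :
    Subsingleton (RelHomology n U V) := by
  refine subsingleton_relHomology fun x hx => ?_
  have h1 := homotopy_add_mem_relBoundaries H hHU hHV hx
  rw [show homotopyAt H 0 = ContinuousMap.id X from ContinuousMap.ext hH0, singMap_id] at h1
  refine (Submodule.add_mem_iff_left _ ?_).1 h1
  exact mem_relBoundaries.2 ⟨0, zero_mem _, singMap n (homotopyAt H 1) x,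
    singMap_mem_chainsIn (U := U) _ (fun x _ => hH1 x) hx.1, by simp⟩

instance {n : ℕ} : Unique (SingSimplex n (Fin 0 → ℝ)) where
  default := ⟨fun _ => 0, continuous_const⟩
  uniq _ := by ext; exact congrFun (Subsingleton.elim _ _) _

theorem singChain_point_eq {n : ℕ} (x : SingChain n (Fin 0 → ℝ)) :
    x = x default • Finsupp.single default 1 := by
  refine Finsupp.ext fun τ => ?_
  rw [Subsingleton.elim τ default, Finsupp.smul_apply, Finsupp.single_eq_same, smul_eq_mul, mul_one]

theorem singBd_point (n : ℕ) : singBd n (Finsupp.single default 1 : SingChain (n + 1) (Fin 0 → ℝ)) =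
    ((n + 2 : ℕ) : ZMod 2) • Finsupp.single default 1 := by
  have : ∀ i, SingSimplex.face (default : SingSimplex (n + 1) (Fin 0 → ℝ)) i = default :=
    fun i => Subsingleton.elim _ _
  refine (singBoundary_single n _).trans ?_
  simp only [this, Finset.sum_const, Finset.card_univ, Fintype.card_fin]
  rw [Nat.cast_smul_eq_nsmul]

theorem relHomology_point_zero {U V : Set (Fin 0 → ℝ)} (hU : U = univ) (hV : V = ∅) :
    Nonempty (RelHomology 0 U V ≃ₗ[ZMod 2] ZMod 2) := by
  have hZ : relCycles 0 U V = ⊤ := by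
    rw [eq_top_iff]
    rintro x -
    refine ⟨?_, zero_mem (chainsIn 0 V)⟩
    subst hU
    exact fun τ _ => subset_univ _
  have hB : relBoundaries 0 U V = ⊥ := by
    rw [eq_bot_iff]
    intro x hx
    obtain ⟨β, -, ρ, hρ, rfl⟩ := mem_relBoundaries.1 hx
    have h1 : ρ = 0 := by
      subst hV
      ext
      by_contra h
      have := hρ (Finsupp.mem_support_iff.2 h)
      exact this ⟨stdSimplex.vertex 0, rfl⟩
    rw [h1, add_zero, singChain_point_eq β, map_smul, singBd_point]
    simp only [show (((0 + 2 : ℕ) : ZMod 2)) = 0 from rfl, zero_smul, smul_zero]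
    exact zero_mem _
  refine ⟨(Submodule.quotEquivOfEqBot _ ?_).trans ((LinearEquiv.ofTop _ hZ).trans
    (Finsupp.uniqueLinearEquiv (ZMod 2) (ZMod 2) default))⟩
  rw [hB, Submodule.eq_bot_iff]
  intro x hx
  exact Subtype.ext ((Submodule.mem_bot (ZMod 2)).1 hx)

/-- The boundary of the unique (n+1)-simplex of a point is n + 2 times the unique n-simplex. So,
according to parity, a chain in positive degree either is a boundary or is a cycle only when it
vanishes. -/
theorem relHomology_point_succ (n : ℕ) {U V : Set (Fin 0 → ℝ)} (hU : U = univ) (hV : V = ∅) :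
    Subsingleton (RelHomology (n + 1) U V) := by
  refine subsingleton_relHomology fun x hx => ?_
  rcases Nat.even_or_odd n with hn | hn
  · refine mem_relBoundaries.2 ⟨x default • Finsupp.single default 1, ?_, 0, zero_mem _, ?_⟩
    · subst hU
      exact fun τ _ => subset_univ _
    · have : ((n + 1 + 2 : ℕ) : ZMod 2) = 1 := by
        obtain ⟨m, rfl⟩ := hn
        rw [ZMod.natCast_eq_one_iff_odd] ; exact ⟨m + 1, by ring⟩
      rw [map_smul, singBd_point, this, one_smul, add_zero, ← singChain_point_eq]
  · have h0 : singBd n x = 0 := by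
      have := hx.2
      subst hV
      ext
      by_contra h
      have := this (Finsupp.mem_support_iff.2 h)
      exact this ⟨stdSimplex.vertex 0, rfl⟩
    have : ((n + 2 : ℕ) : ZMod 2) = 1 := by
      obtain ⟨m, rfl⟩ := hn
      rw [ZMod.natCast_eq_one_iff_odd] ; exact ⟨m + 1, by ring⟩
    rw [singChain_point_eq x, map_smul, singBd_point, this, one_smul] at h0
    have h1 := DFunLike.congr_fun h0 default
    simp only [Finsupp.smul_apply, Finsupp.single_eq_same, Finsupp.coe_zero, Pi.zero_apply,
      smul_eq_mul, mul_one] at h1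
    rw [singChain_point_eq x, h1, zero_smul]
    exact zero_mem _

variable {k : ℕ}

/-- The complement of a closed half-line in `ℝ^(k+1)`. -/
def slitSpace (k : ℕ) (ε : ℝ) : Set (Fin (k + 1) → ℝ) := {w | Fin.tail w ≠ 0 ∨ 0 < ε * w 0}

theorem continuous_fin_tail : Continuous (Fin.tail : (Fin (k + 1) → ℝ) → Fin k → ℝ) :=
  continuous_pi fun i => continuous_apply i.succ

theorem isOpen_slitSpace (ε : ℝ) : IsOpen (slitSpace k ε) :=
  ((isClosed_singleton (x := (0 : Fin k → ℝ))).isOpen_compl.preimage continuous_fin_tail).union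
    (isOpen_lt (f := fun _ => (0 : ℝ))
      (g := fun w : Fin (k + 1) → ℝ => ε * w 0) continuous_const (by fun_prop))

/-- The straight-line homotopy to a point on the half-line opposite to the removed one preserves the
slit space and ends inside it. -/
theorem subsingleton_relHomology_slitSpace (n : ℕ) :
    Subsingleton (RelHomology n univ (slitSpace k 1)) := by
  let e : Fin (k + 1) → ℝ := Fin.cons 1 0
  have hc : Continuous fun p : ℝ × (Fin (k + 1) → ℝ) => (1 - p.1) • p.2 + p.1 • e := by
    fun_prop
  refine subsingleton_relHomology_of_contraction n ⟨_, hc⟩ (fun x => by simp) (fun x => ?_)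
    (fun _ _ _ _ => trivial) (fun s hs x hx => ?_)
  · right
    simp [e]
  · change (1 - s) • x + s • e ∈ slitSpace k 1
    have ht : Fin.tail ((1 - s) • x + s • e) = (1 - s) • Fin.tail x := by
      ext i; simp [Fin.tail, e]
    have h0 : ((1 - s) • x + s • e) 0 = (1 - s) * x 0 + s := by simp [e]
    rcases eq_or_lt_of_le hs.2 with rfl | h1
    · right; rw [h0]; norm_num
    · rcases hx with hx | hx
      · left
        rw [ht]
        exact smul_ne_zero (by linarith) hx
      · right
        rw [h0]
        nlinarith [hs.1]

theorem slitSpace_union : slitSpace k 1 ∪ slitSpace k (-1) = {w | w ≠ 0} := by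
  ext w
  simp only [slitSpace, mem_union, mem_ofPred_eq]
  constructor
  · rintro (h | h) rfl <;> simp at h <;> exact h rfl
  · intro h
    by_contra hc
    simp only [not_or, not_lt, ne_eq, not_not] at hc
    apply h
    ext i
    refine Fin.cases ?_ (fun i => congrFun hc.1.1 i) i
    change w 0 = 0
    linarith [hc.1.2, hc.2.2]

theorem slitSpace_inter : slitSpace k 1 ∩ slitSpace k (-1) = {w | Fin.tail w ≠ 0} := by
  ext w
  simp only [slitSpace, mem_inter_iff, mem_ofPred_eq]
  constructor
  · rintro ⟨h | h, h' | h'⟩ <;> first | assumption | (exfalso; linarith)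
  · exact fun h => ⟨Or.inl h, Or.inl h⟩

/-- Forgetting the first coordinate is a homotopy equivalence of pairs; its section takes first
coordinate -1, on the half-line that `slitSpace k (-1)` retains. -/
theorem nonempty_slitSpace_equiv (n : ℕ) :
    Nonempty (RelHomology n (slitSpace k (-1)) {w | Fin.tail w ≠ 0} ≃ₗ[ZMod 2]
      RelHomology n univ {w : Fin k → ℝ | w ≠ 0}) := by
  have hcons : Continuous fun w : Fin k → ℝ => (Fin.cons (-1) w : Fin (k + 1) → ℝ) :=
    continuous_pi fun i => Fin.cases (by simpa using continuous_const)
      (fun i => by simpa using continuous_apply i) i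
  have htail : ∀ (s : ℝ) (x : Fin (k + 1) → ℝ),
      Fin.tail ((1 - s) • x + s • (Fin.cons (-1) (Fin.tail x) : Fin (k + 1) → ℝ)) = Fin.tail x := by
    intro s x
    ext i
    simp [Fin.tail]
    ring
  have hH : Continuous fun p : ℝ × (Fin (k + 1) → ℝ) =>
      (1 - p.1) • p.2 + p.1 • (Fin.cons (-1) (Fin.tail p.2) : Fin (k + 1) → ℝ) :=
    ((continuous_const.sub continuous_fst).smul continuous_snd).add
      (continuous_fst.smul ((hcons.comp continuous_fin_tail).comp continuous_snd))
  refine nonempty_relHomology_equiv n ⟨Fin.tail, continuous_fin_tail⟩ (fun _ _ => trivial)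
    (fun w hw => hw) ⟨_, hcons⟩ (fun w _ => Or.inr (by simp)) (fun w hw => hw)
    ⟨_, hH⟩ (fun x => by simp) (fun x => by simp) (fun s hs x hx => ?_) (fun s hs x hx => ?_)
    ⟨Prod.snd, continuous_snd⟩ (fun _ => rfl) (fun y => by simp)
    (fun _ _ _ _ => trivial) (fun _ _ _ h => h)
  · rcases hx with hx | hx
    · exact Or.inl (by simpa only [ContinuousMap.coe_mk, htail] using hx)
    · right
      simp only [ContinuousMap.coe_mk, Pi.add_apply, Pi.smul_apply, Fin.cons_zero, smul_eq_mul]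
      rcases eq_or_lt_of_le hs.2 with rfl | h1
      · norm_num
      · nlinarith [hs.1]
  · change Fin.tail _ ≠ 0
    rw [ContinuousMap.coe_mk, htail]
    exact hx

/-- The two slit spaces cover the punctured space. The chain of isomorphisms is: the connecting map
of the triple (whole space, punctured space, one slit space), excision to the other slit space, and
projection along the first axis. -/
theorem nonempty_punctured_succ_equiv (n : ℕ) :
    Nonempty (RelHomology (n + 1) univ {w : Fin (k + 1) → ℝ | w ≠ 0} ≃ₗ[ZMod 2]
      RelHomology n univ {w : Fin k → ℝ | w ≠ 0}) := by
  obtain ⟨e₁⟩ := nonempty_connecting_equiv n (subset_union_left (t := slitSpace k (-1)))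
    (subset_univ _) (fun j => subsingleton_relHomology_slitSpace j)
  obtain ⟨e₂⟩ := nonempty_excision_equiv n (isOpen_slitSpace (k := k) 1) (isOpen_slitSpace (-1))
  obtain ⟨e₃⟩ := nonempty_slitSpace_equiv (k := k) n
  rw [slitSpace_inter] at e₂
  rw [slitSpace_union] at e₁ e₂
  exact ⟨e₁.trans (e₂.symm.trans e₃)⟩

/-- The homology of `ℝ^k` relative to the complement of the origin. -/
theorem relHomology_punctured : ∀ (k : ℕ),
    Nonempty (RelHomology k univ {w : Fin k → ℝ | w ≠ 0} ≃ₗ[ZMod 2] ZMod 2) ∧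
      ∀ n, n ≠ k → Subsingleton (RelHomology n univ {w : Fin k → ℝ | w ≠ 0})
  | 0 => by
    have h : {w : Fin 0 → ℝ | w ≠ 0} = ∅ := by
      ext w; simp [Subsingleton.elim w 0]
    refine ⟨relHomology_point_zero rfl h, fun n hn => ?_⟩
    obtain ⟨n, rfl⟩ := Nat.exists_eq_succ_of_ne_zero hn
    exact relHomology_point_succ n rfl h
  | k + 1 => by
    obtain ⟨⟨e⟩, h⟩ := relHomology_punctured k
    refine ⟨?_, fun n hn => ?_⟩
    · obtain ⟨e'⟩ := nonempty_punctured_succ_equiv (k := k) k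
      exact ⟨e'.trans e⟩
    · cases n with
      | zero =>
        -- In degree 0 every chain is a relative cycle, so it already bounds modulo the smaller slit
        -- space.
        have := subsingleton_relHomology_slitSpace (k := k) 0
        refine subsingleton_relHomology fun x hx => ?_
        rw [← slitSpace_union]
        refine relBoundaries_mono (subset_refl _) subset_union_left
          (mem_relBoundaries_of_subsingleton ⟨hx.1, zero_mem (chainsIn 0 (slitSpace k 1))⟩)
      | succ n =>
        obtain ⟨e'⟩ := nonempty_punctured_succ_equiv (k := k) n
        have := h n (by omega)
        exact e'.toEquiv.subsingleton

end PuncturedSpace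

/-! ### Deformations and the minmax -/

section Deformation

variable {X : Type*} [TopologicalSpace X]

/-- Iterates of a continuous map. -/
def iterMap (g : C(X, X)) (k : ℕ) : C(X, X) := ⟨g^[k], g.continuous.iterate k⟩

theorem mem_chainsIn_chainImage {n : ℕ} (σ : SingChain n X) : σ ∈ chainsIn n (chainImage σ) :=
  fun _ hτ => subset_biUnion_of_mem (u := fun τ : SingSimplex n X => range τ) hτ

theorem chainImage_subset {n : ℕ} {σ : SingChain n X} {U : Set X} (h : σ ∈ chainsIn n U) :
    chainImage σ ⊆ U :=
  iUnion₂_subset fun _ hτ => h hτ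

theorem isCompact_chainImage {n : ℕ} (σ : SingChain n X) : IsCompact (chainImage σ) :=
  σ.support.isCompact_biUnion fun τ _ => isCompact_range τ.continuous

theorem chainImage_nonempty {n : ℕ} {σ : SingChain n X} (h : σ ≠ 0) : (chainImage σ).Nonempty := by
  obtain ⟨τ, hτ⟩ := Finsupp.support_nonempty_iff.2 h
  exact ⟨τ (stdSimplex.vertex 0), mem_biUnion hτ ⟨_, rfl⟩⟩

/-- Each iteration changes the cycle by a boundary of the same pair, since the homotopy preserves
both sets; the sums telescope mod 2. -/
theorem add_singMap_iterMap_mem (H : C(ℝ × X, X)) (hH0 : ∀ x, H (0, x) = x) {n : ℕ}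
    {U V : Set X} (hU : ∀ s ∈ Icc (0 : ℝ) 1, ∀ x ∈ U, H (s, x) ∈ U)
    (hV : ∀ s ∈ Icc (0 : ℝ) 1, ∀ x ∈ V, H (s, x) ∈ V) {x : SingChain n X}
    (hx : x ∈ relCycles n U V) (k : ℕ) :
    x + singMap n (iterMap (homotopyAt H 1) k) x ∈ relBoundaries n U V := by
  have h1 : (1 : ℝ) ∈ Icc (0 : ℝ) 1 := ⟨zero_le_one, le_rfl⟩
  have step : ∀ y ∈ relCycles n U V, y + singMap n (homotopyAt H 1) y ∈ relBoundaries n U V := by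
    intro y hy
    have := homotopy_add_mem_relBoundaries H hU hV hy
    rwa [show homotopyAt H 0 = ContinuousMap.id X from ContinuousMap.ext hH0, singMap_id] at this
  have hk : ∀ k, iterMap (homotopyAt H 1) (k + 1) =
      (homotopyAt H 1).comp (iterMap (homotopyAt H 1) k) := fun k =>
    ContinuousMap.ext fun x => Function.iterate_succ_apply' _ _ _
  have key : singMap n (iterMap (homotopyAt H 1) k) x ∈ relCycles n U V ∧
      x + singMap n (iterMap (homotopyAt H 1) k) x ∈ relBoundaries n U V := by
    induction k with
    | zero =>
      rw [show iterMap (homotopyAt H 1) 0 = ContinuousMap.id X from rfl, singMap_id,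
        linChain_add_self]
      exact ⟨hx, zero_mem _⟩
    | succ k ih =>
      rw [hk, ← singMap_comp]
      refine ⟨singMap_mem_relCycles (homotopyAt H 1) (hU 1 h1) (hV 1 h1) ih.1, ?_⟩
      have := add_mem ih.2 (step _ ih.1)
      rwa [add_assoc, ← add_assoc _ _ (singMap n (homotopyAt H 1) _), linChain_add_self,
        zero_add] at this
  exact key.2

/-- Every compact subset of `A'` is eventually mapped into `A` by the iterates of `g`. -/
def EventuallyMaps (g : X → X) (A' A : Set X) : Prop :=
  ∀ K : Set X, IsCompact K → K ⊆ A' → ∃ k, ∀ j ≥ k, MapsTo g^[j] K A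

theorem EventuallyMaps.inter {g : X → X} {A' A B : Set X} (hA : EventuallyMaps g A' A) (hB : EventuallyMaps g A' B) :
    EventuallyMaps g A' (A ∩ B) := fun K hK hKA => by
  obtain ⟨k, hk⟩ := hA K hK hKA
  obtain ⟨l, hl⟩ := hB K hK hKA
  exact ⟨max k l, fun j hj x hx => ⟨hk j (le_of_max_le_left hj) hx, hl j (le_of_max_le_right hj) hx⟩⟩

theorem eventuallyMaps_self {g : X → X} {A : Set X} (h : MapsTo g A A) : EventuallyMaps g A A :=
  fun _ _ hKA => ⟨0, fun j _ _ hx => h.iterate j (hKA hx)⟩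

theorem EventuallyMaps.exists_singMap_mem {g : C(X, X)} {A' A : Set X} (h : EventuallyMaps g A' A) {n : ℕ}
    {x : SingChain n X} (hx : x ∈ chainsIn n A') :
    ∃ k, ∀ j ≥ k, singMap n (iterMap g j) x ∈ chainsIn n A := by
  obtain ⟨k, hk⟩ := h _ (isCompact_chainImage x) (chainImage_subset hx)
  exact ⟨k, fun j hj => singMap_mem_chainsIn _ (hk j hj) (mem_chainsIn_chainImage x)⟩

theorem EventuallyMaps.exists_singMap_mem_relCycles {g : C(X, X)} {A' A B' B : Set X}
    (hA : EventuallyMaps g A' A) (hB : EventuallyMaps g B' B) {n : ℕ} {x : SingChain n X}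
    (hx : x ∈ relCycles n A' B') :
    ∃ k, ∀ j ≥ k, singMap n (iterMap g j) x ∈ relCycles n A B := by
  obtain ⟨k, hk⟩ := hA.exists_singMap_mem hx.1
  obtain ⟨l, hl⟩ := hB.exists_singMap_mem hx.2
  refine ⟨max k l, fun j hj => ⟨hk j (le_of_max_le_left hj), ?_⟩⟩
  change singBoundary n _ ∈ chainsIn (n - 1) B
  rw [singMap_boundary]
  exact hl j (le_of_max_le_right hj)

/-- A bounding chain in the larger pair has compact image, so finitely many iterations carry it into
the smaller pair, where `x` is homologous to its own iterate. -/
theorem mem_relBoundaries_of_eventuallyMaps (H : C(ℝ × X, X)) (hH0 : ∀ x, H (0, x) = x) {n : ℕ}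
    {A B A' B' : Set X} (hA : ∀ s ∈ Icc (0 : ℝ) 1, ∀ x ∈ A, H (s, x) ∈ A)
    (hB : ∀ s ∈ Icc (0 : ℝ) 1, ∀ x ∈ B, H (s, x) ∈ B)
    (hA' : EventuallyMaps (homotopyAt H 1) A' A) (hB' : EventuallyMaps (homotopyAt H 1) B' B)
    {x : SingChain n X} (hx : x ∈ relCycles n A B) (hx' : x ∈ relBoundaries n A' B') :
    x ∈ relBoundaries n A B := by
  obtain ⟨β, hβ, ρ, hρ, e⟩ := mem_relBoundaries.1 hx'
  obtain ⟨k, hk⟩ := hA'.exists_singMap_mem hβ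
  obtain ⟨l, hl⟩ := hB'.exists_singMap_mem hρ
  refine (Submodule.add_mem_iff_left _ ?_).1
    (add_singMap_iterMap_mem H hH0 hA hB hx (max k l))
  refine mem_relBoundaries.2 ⟨_, hk _ (le_max_left k l), _, hl _ (le_max_right k l), ?_⟩
  rw [← e, map_add]
  congr 1
  exact (singMap_singBoundary n _ β).symm

theorem nonempty_equiv_of_eventuallyMaps (H : C(ℝ × X, X)) (hH0 : ∀ x, H (0, x) = x) (n : ℕ)
    {A B A' B' : Set X} (hAA' : A ⊆ A') (hBB' : B ⊆ B')
    (hA : ∀ s ∈ Icc (0 : ℝ) 1, ∀ x ∈ A, H (s, x) ∈ A)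
    (hB : ∀ s ∈ Icc (0 : ℝ) 1, ∀ x ∈ B, H (s, x) ∈ B)
    (hA' : ∀ s ∈ Icc (0 : ℝ) 1, ∀ x ∈ A', H (s, x) ∈ A')
    (hB' : ∀ s ∈ Icc (0 : ℝ) 1, ∀ x ∈ B', H (s, x) ∈ B')
    (hAb : EventuallyMaps (homotopyAt H 1) A' A) (hBb : EventuallyMaps (homotopyAt H 1) B' B) :
    Nonempty (RelHomology n A B ≃ₗ[ZMod 2] RelHomology n A' B') := by
  refine nonempty_subQuotient_equiv LinearMap.id (fun x hx => relCycles_mono hAA' hBB' hx)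
    (fun x _ hx => relBoundaries_mono hAA' hBB' hx)
    (fun x hx hx' => mem_relBoundaries_of_eventuallyMaps H hH0 hA hB hAb hBb hx hx') (fun y hy => ?_)
  obtain ⟨k, hk⟩ := EventuallyMaps.exists_singMap_mem_relCycles hAb hBb hy
  refine ⟨_, hk k le_rfl, ?_⟩
  rw [LinearMap.id_apply, ZModModule.sub_eq_add, add_comm]
  exact add_singMap_iterMap_mem H hH0 hA' hB' hy k

theorem span_singleton_eq_top_iff {M : Type*} [AddCommGroup M] [Module (ZMod 2) M]
    (e : M ≃ₗ[ZMod 2] ZMod 2) (x : M) : Submodule.span (ZMod 2) {x} = ⊤ ↔ x ≠ 0 := by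
  constructor
  · rintro h rfl
    rw [Submodule.span_zero_singleton] at h
    have h1 : e.symm 1 ∈ (⊥ : Submodule (ZMod 2) M) := h ▸ Submodule.mem_top
    rw [Submodule.mem_bot, LinearEquiv.map_eq_zero_iff] at h1
    exact one_ne_zero h1
  · intro h
    rw [eq_top_iff]
    rintro y -
    have hx : e x = 1 := by
      have : e x ≠ 0 := fun h' => h ((LinearEquiv.map_eq_zero_iff e).1 h')
      generalize e x = c at this
      revert c
      decide
    refine Submodule.mem_span_singleton.2 ⟨e y, e.injective ?_⟩
    rw [map_smul, hx, smul_eq_mul, mul_one]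

/-- Over ℤ/2 a class generates a one-dimensional space as soon as it is nonzero, and a nonzero chain
has a nonempty compact image on which `f` attains its maximum. -/
theorem exists_mem_descendingMaxima {f : X → ℝ} (hf : Continuous f) {n : ℕ} {a : ℝ}
    (e : RelHomology n (sublevel f a) (sublevel f (-a)) ≃ₗ[ZMod 2] ZMod 2) {σ : SingChain n X}
    (hσ : σ ∈ relCycles n (sublevel f a) (sublevel f (-a)))
    (hσ' : σ ∉ relBoundaries n (sublevel f a) (sublevel f (-a))) {m : ℝ}
    (hm : σ ∈ chainsIn n (sublevel f m)) : ∃ m' ∈ descendingMaxima f n a, m' ≤ m := by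
  have h0 : σ ≠ 0 := by rintro rfl; exact hσ' (zero_mem _)
  obtain ⟨x, hx, hmax⟩ := (isCompact_chainImage σ).exists_isMaxOn (chainImage_nonempty h0)
    hf.continuousOn
  refine ⟨f x, ⟨⟨σ, hσ⟩, ?_, ⟨x, hx, rfl⟩, ?_⟩, chainImage_subset hm hx⟩
  · rw [span_singleton_eq_top_iff e, Ne, relClass_eq_zero]
    exact hσ'
  · rintro _ ⟨y, hy, rfl⟩
    exact hmax hy

theorem descendingMaxima_spec {f : X → ℝ} {n : ℕ} {a : ℝ}
    (e : RelHomology n (sublevel f a) (sublevel f (-a)) ≃ₗ[ZMod 2] ZMod 2) {m : ℝ}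
    (hm : m ∈ descendingMaxima f n a) :
    ∃ σ ∈ relCycles n (sublevel f a) (sublevel f (-a)),
      σ ∉ relBoundaries n (sublevel f a) (sublevel f (-a)) ∧ σ ∈ chainsIn n (sublevel f m) := by
  obtain ⟨σ, hσ, hmax⟩ := hm
  rw [span_singleton_eq_top_iff e, Ne, relClass_eq_zero] at hσ
  exact ⟨σ, σ.2, hσ, chainsIn_mono (fun x hx => hmax.2 ⟨x, hx, rfl⟩) (mem_chainsIn_chainImage _)⟩

theorem neg_le_of_mem_descendingMaxima {f : X → ℝ} {n : ℕ} {a : ℝ}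
    (e : RelHomology n (sublevel f a) (sublevel f (-a)) ≃ₗ[ZMod 2] ZMod 2) {m : ℝ}
    (hm : m ∈ descendingMaxima f n a) : -a ≤ m := by
  obtain ⟨σ, -, h, h'⟩ := descendingMaxima_spec e hm
  by_contra hc
  exact h (mem_relBoundaries.2 ⟨0, zero_mem _, σ,
    chainsIn_mono (fun x hx => le_trans hx (not_le.1 hc).le) h', by simp⟩)

theorem descendingMaxima_nonempty {f : X → ℝ} (hf : Continuous f) {n : ℕ} {a : ℝ}
    (e : RelHomology n (sublevel f a) (sublevel f (-a)) ≃ₗ[ZMod 2] ZMod 2) :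
    (descendingMaxima f n a).Nonempty := by
  obtain ⟨σ, hσ⟩ := Submodule.Quotient.mk_surjective _ (e.symm 1)
  have h : relClass σ ≠ 0 := by
    intro h
    rw [relClass, hσ, LinearEquiv.map_eq_zero_iff] at h
    exact one_ne_zero h
  obtain ⟨m, hm, -⟩ := exists_mem_descendingMaxima hf e σ.2
    (fun hc => h ((relClass_eq_zero σ).2 hc)) σ.2.1
  exact ⟨m, hm⟩

/-- If the homology is that of a sphere-like pair and the infima do not depend on the level, then
the minmax is well defined, and equal to these infima. -/
theorem minmaxWellDefined_of_sInf_eq {f : X → ℝ} (hf : Continuous f) {n : ℕ} {a₀ : ℝ}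
    (he : ∀ a ≥ a₀, Nonempty (RelHomology n (sublevel f a) (sublevel f (-a)) ≃ₗ[ZMod 2] ZMod 2))
    (hi : ∀ a ≥ a₀, ∀ i, i ≠ n → Subsingleton (RelHomology i (sublevel f a) (sublevel f (-a))))
    (hs : ∀ a ≥ a₀, sInf (descendingMaxima f n a) = sInf (descendingMaxima f n a₀)) :
    MinmaxWellDefined f n ∧ minmax f n = sInf (descendingMaxima f n a₀) := by
  have h : minmax f n = sInf (descendingMaxima f n a₀) := by
    refine Tendsto.limUnder_eq (tendsto_const_nhds.congr' ?_)
    filter_upwards [eventually_ge_atTop a₀] with a ha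
    exact (hs a ha).symm
  refine ⟨⟨a₀, fun a ha => ⟨he a ha, hi a ha, ?_⟩⟩, h⟩
  obtain ⟨e⟩ := he a ha
  rw [h, ← hs a ha]
  exact isGLB_csInf (descendingMaxima_nonempty hf e)
    ⟨-a, fun m hm => neg_le_of_mem_descendingMaxima e hm⟩

/-- On a compact set `f₁` is bounded by some B. Each step costs at least δ until `f₁` drops below
c', and `f₀ ≤ c` persists, so (B - c')/δ steps suffice. -/
theorem eventuallyMaps_sublevel {f₀ f₁ : X → ℝ} (hf₁ : Continuous f₁) (g : X → X) {c c' δ : ℝ}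
    (hδ : 0 < δ) (h₀ : ∀ x, f₀ (g x) ≤ f₀ x)
    (h : ∀ x, f₀ x ≤ c → f₁ (g x) ≤ max c' (f₁ x - δ)) :
    EventuallyMaps g (sublevel f₀ c) (sublevel f₁ c') := by
  intro K hK hKc
  obtain ⟨B, hB⟩ := (hK.image hf₁).bddAbove
  obtain ⟨k, hk⟩ := exists_nat_gt ((B - c') / δ)
  rw [div_lt_iff₀ hδ] at hk
  have key : ∀ j : ℕ, ∀ x ∈ K, f₀ (g^[j] x) ≤ c ∧ f₁ (g^[j] x) ≤ max c' (B - j * δ) := by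
    intro j x hx
    induction j with
    | zero => exact ⟨hKc hx, le_max_of_le_right (by simpa using hB ⟨x, hx, rfl⟩)⟩
    | succ j ih =>
      rw [Function.iterate_succ_apply']
      refine ⟨(h₀ _).trans ih.1, (h _ ih.1).trans (max_le (le_max_left _ _) ?_)⟩
      rcases le_max_iff.1 ih.2 with h' | h'
      · exact le_max_of_le_left (by linarith)
      · refine le_max_of_le_right ?_
        push_cast
        linarith
  refine ⟨k, fun j hj x hx => ((key j x hx).2.trans (max_le le_rfl ?_) : _ ≤ _)⟩
  have : (k : ℝ) ≤ j := by exact_mod_cast hj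
  nlinarith

/-- A homotopy that decreases two functions simultaneously, strictly so off a set where they
agree. -/
structure CommonDescent (f₀ f₁ : X → ℝ) (H : C(ℝ × X, X)) (D : Set X) (M δ : ℝ) : Prop where
  pos : 0 < δ
  zero : ∀ x, H (0, x) = x
  left_le : ∀ s ∈ Icc (0 : ℝ) 1, ∀ x, f₀ (H (s, x)) ≤ f₀ x
  right_le : ∀ s ∈ Icc (0 : ℝ) 1, ∀ x, f₁ (H (s, x)) ≤ f₁ x
  left_lt : ∀ x ∉ D, f₀ (H (1, x)) ≤ f₀ x - δ
  right_lt : ∀ x ∉ D, f₁ (H (1, x)) ≤ f₁ x - δ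
  eq_on : ∀ x ∈ D, f₀ x = f₁ x
  bound : ∀ x ∈ D, |f₀ x| < M

variable {f₀ f₁ : X → ℝ} {H : C(ℝ × X, X)} {D : Set X} {M δ : ℝ}

theorem CommonDescent.symm (h : CommonDescent f₀ f₁ H D M δ) : CommonDescent f₁ f₀ H D M δ :=
  ⟨h.pos, h.zero, h.right_le, h.left_le, h.right_lt, h.left_lt, fun x hx => (h.eq_on x hx).symm,
    fun x hx => h.eq_on x hx ▸ h.bound x hx⟩

theorem CommonDescent.left (h : CommonDescent f₀ f₁ H D M δ) : CommonDescent f₀ f₀ H D M δ :=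
  ⟨h.pos, h.zero, h.left_le, h.left_le, h.left_lt, h.left_lt, fun _ _ => rfl, h.bound⟩

/-- On `D` the two functions agree, so the bound on `f₀` is already the bound on `f₁`; off `D` there
is strict descent. -/
theorem CommonDescent.eventuallyMaps (h : CommonDescent f₀ f₁ H D M δ) (hf₁ : Continuous f₁) (c : ℝ) :
    EventuallyMaps (homotopyAt H 1) (sublevel f₀ c) (sublevel f₁ c) := by
  have h1 : (1 : ℝ) ∈ Icc (0 : ℝ) 1 := ⟨zero_le_one, le_rfl⟩
  refine eventuallyMaps_sublevel hf₁ _ h.pos (h.left_le 1 h1) fun x hx => ?_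
  by_cases hD : x ∈ D
  · refine le_max_of_le_left ((h.right_le 1 h1 x).trans ?_)
    rwa [← h.eq_on x hD]
  · exact le_max_of_le_right (h.right_lt x hD)

/-- Above level `M` the two levels may differ: `D` lies below `c'` anyway. -/
theorem CommonDescent.eventuallyMaps_pos (h : CommonDescent f₀ f₁ H D M δ) (hf₁ : Continuous f₁)
    (c : ℝ) {c' : ℝ} (hc' : M ≤ c') :
    EventuallyMaps (homotopyAt H 1) (sublevel f₀ c) (sublevel f₁ c') := by
  have h1 : (1 : ℝ) ∈ Icc (0 : ℝ) 1 := ⟨zero_le_one, le_rfl⟩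
  refine eventuallyMaps_sublevel hf₁ _ h.pos (h.left_le 1 h1) fun x hx => ?_
  by_cases hD : x ∈ D
  · refine le_max_of_le_left ((h.right_le 1 h1 x).trans ?_)
    rw [← h.eq_on x hD]
    exact ((abs_lt.1 (h.bound x hD)).2.trans_le hc').le
  · exact le_max_of_le_right (h.right_lt x hD)

/-- Below level -M the sublevel set misses `D`, so the descent never stops and any target level is
reached. -/
theorem CommonDescent.eventuallyMaps_neg (h : CommonDescent f₀ f₁ H D M δ) (hf₁ : Continuous f₁)
    {c : ℝ} (c' : ℝ) (hc : c ≤ -M) :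
    EventuallyMaps (homotopyAt H 1) (sublevel f₀ c) (sublevel f₁ c') := by
  have h1 : (1 : ℝ) ∈ Icc (0 : ℝ) 1 := ⟨zero_le_one, le_rfl⟩
  refine eventuallyMaps_sublevel hf₁ _ h.pos (h.left_le 1 h1) fun x hx => ?_
  by_cases hD : x ∈ D
  · exact absurd (abs_lt.1 (h.bound x hD)).1 (by linarith)
  · exact le_max_of_le_right (h.right_lt x hD)

/-- Both pairs are compared with the pair of intersections, which the homotopy preserves and into
which compact sets are eventually mapped. -/
theorem CommonDescent.nonempty_equiv (h : CommonDescent f₀ f₁ H D M δ) (hf₀ : Continuous f₀)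
    (hf₁ : Continuous f₁) {a₀ a₁ : ℝ} (ha₀ : M ≤ a₀) (ha₁ : M ≤ a₁) (n : ℕ) :
    Nonempty (RelHomology n (sublevel f₀ a₀) (sublevel f₀ (-a₀)) ≃ₗ[ZMod 2]
      RelHomology n (sublevel f₁ a₁) (sublevel f₁ (-a₁))) := by
  have h0 : ∀ c, ∀ s ∈ Icc (0 : ℝ) 1, ∀ x ∈ sublevel f₀ c, H (s, x) ∈ sublevel f₀ c :=
    fun c s hs x hx => (h.left_le s hs x).trans hx
  have h1 : ∀ c, ∀ s ∈ Icc (0 : ℝ) 1, ∀ x ∈ sublevel f₁ c, H (s, x) ∈ sublevel f₁ c :=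
    fun c s hs x hx => (h.right_le s hs x).trans hx
  have hi : ∀ c c', ∀ s ∈ Icc (0 : ℝ) 1, ∀ x ∈ sublevel f₀ c ∩ sublevel f₁ c',
      H (s, x) ∈ sublevel f₀ c ∩ sublevel f₁ c' :=
    fun c c' s hs x hx => ⟨h0 c s hs x hx.1, h1 c' s hs x hx.2⟩
  have one : (1 : ℝ) ∈ Icc (0 : ℝ) 1 := ⟨zero_le_one, le_rfl⟩
  obtain ⟨e₀⟩ := nonempty_equiv_of_eventuallyMaps H h.zero n inter_subset_left inter_subset_left
    (hi a₀ a₁) (hi (-a₀) (-a₁)) (h0 a₀) (h0 (-a₀))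
    ((eventuallyMaps_self (h0 a₀ 1 one)).inter (h.eventuallyMaps_pos hf₁ a₀ ha₁))
    ((eventuallyMaps_self (h0 (-a₀) 1 one)).inter (h.eventuallyMaps_neg hf₁ (-a₁) (neg_le_neg ha₀)))
  obtain ⟨e₁⟩ := nonempty_equiv_of_eventuallyMaps H h.zero n inter_subset_right inter_subset_right
    (hi a₀ a₁) (hi (-a₀) (-a₁)) (h1 a₁) (h1 (-a₁))
    ((h.symm.eventuallyMaps_pos hf₀ a₁ ha₀).inter (eventuallyMaps_self (h1 a₁ 1 one)))
    ((h.symm.eventuallyMaps_neg hf₀ (-a₀) (neg_le_neg ha₁)).inter (eventuallyMaps_self (h1 (-a₁) 1 one)))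
  exact ⟨e₀.symm.trans e₁⟩

/-- A descending cycle for `f₀` below level m, iterated long enough, is a relative cycle for `f₁`
below the same level m. Were it a boundary for `f₁`, it would be one for the intersections, hence
`σ` would be one for `f₀`. -/
theorem CommonDescent.exists_le (h : CommonDescent f₀ f₁ H D M δ)
    (hf₁ : Continuous f₁) {a₀ a₁ : ℝ} (ha₀ : M ≤ a₀) (ha₁ : M ≤ a₁) {n : ℕ}
    (e₀ : RelHomology n (sublevel f₀ a₀) (sublevel f₀ (-a₀)) ≃ₗ[ZMod 2] ZMod 2)
    (e₁ : RelHomology n (sublevel f₁ a₁) (sublevel f₁ (-a₁)) ≃ₗ[ZMod 2] ZMod 2)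
    (hf₀ : Continuous f₀) {m : ℝ} (hm : m ∈ descendingMaxima f₀ n a₀) :
    ∃ m' ∈ descendingMaxima f₁ n a₁, m' ≤ m := by
  have one : (1 : ℝ) ∈ Icc (0 : ℝ) 1 := ⟨zero_le_one, le_rfl⟩
  have h0 : ∀ c, ∀ s ∈ Icc (0 : ℝ) 1, ∀ x ∈ sublevel f₀ c, H (s, x) ∈ sublevel f₀ c :=
    fun c s hs x hx => (h.left_le s hs x).trans hx
  have h1 : ∀ c, ∀ s ∈ Icc (0 : ℝ) 1, ∀ x ∈ sublevel f₁ c, H (s, x) ∈ sublevel f₁ c :=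
    fun c s hs x hx => (h.right_le s hs x).trans hx
  have hi : ∀ c c', ∀ s ∈ Icc (0 : ℝ) 1, ∀ x ∈ sublevel f₀ c ∩ sublevel f₁ c',
      H (s, x) ∈ sublevel f₀ c ∩ sublevel f₁ c' :=
    fun c c' s hs x hx => ⟨h0 c s hs x hx.1, h1 c' s hs x hx.2⟩
  obtain ⟨σ, hσ, hσ', hσm⟩ := descendingMaxima_spec e₀ hm
  obtain ⟨k, hk⟩ := EventuallyMaps.exists_singMap_mem_relCycles (g := homotopyAt H 1)
    ((eventuallyMaps_self (h0 a₀ 1 one)).inter (h.eventuallyMaps_pos hf₁ a₀ ha₁))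
    ((eventuallyMaps_self (h0 (-a₀) 1 one)).inter (h.eventuallyMaps_neg hf₁ (-a₁) (neg_le_neg ha₀))) hσ
  obtain ⟨l, hl⟩ := (h.eventuallyMaps hf₁ m).exists_singMap_mem hσm
  have hc := hk _ (le_max_left k l)
  refine exists_mem_descendingMaxima hf₁ e₁
    (relCycles_mono inter_subset_right inter_subset_right hc) (fun hb => hσ' ?_)
    (hl _ (le_max_right k l))
  have hb' := mem_relBoundaries_of_eventuallyMaps H h.zero (hi a₀ a₁) (hi (-a₀) (-a₁))
    ((h.symm.eventuallyMaps_pos hf₀ a₁ ha₀).inter (eventuallyMaps_self (h1 a₁ 1 one)))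
    ((h.symm.eventuallyMaps_neg hf₀ (-a₀) (neg_le_neg ha₁)).inter (eventuallyMaps_self (h1 (-a₁) 1 one))) hc hb
  exact (Submodule.add_mem_iff_left _ (relBoundaries_mono inter_subset_left inter_subset_left hb')).1
    (add_singMap_iterMap_mem H h.zero (h0 a₀) (h0 (-a₀)) hσ _)

theorem CommonDescent.sInf_eq (h : CommonDescent f₀ f₁ H D M δ) (hf₀ : Continuous f₀)
    (hf₁ : Continuous f₁) {a₀ a₁ : ℝ} (ha₀ : M ≤ a₀) (ha₁ : M ≤ a₁) {n : ℕ}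
    (e₀ : RelHomology n (sublevel f₀ a₀) (sublevel f₀ (-a₀)) ≃ₗ[ZMod 2] ZMod 2)
    (e₁ : RelHomology n (sublevel f₁ a₁) (sublevel f₁ (-a₁)) ≃ₗ[ZMod 2] ZMod 2) :
    sInf (descendingMaxima f₀ n a₀) = sInf (descendingMaxima f₁ n a₁) := by
  refine le_antisymm (le_csInf (descendingMaxima_nonempty hf₁ e₁) fun m hm => ?_)
    (le_csInf (descendingMaxima_nonempty hf₀ e₀) fun m hm => ?_)
  · obtain ⟨m', hm', hle⟩ := h.symm.exists_le hf₀ ha₁ ha₀ e₁ e₀ hf₁ hm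
    exact (csInf_le ⟨-a₀, fun m hm => neg_le_of_mem_descendingMaxima e₀ hm⟩ hm').trans hle
  · obtain ⟨m', hm', hle⟩ := h.exists_le hf₁ ha₀ ha₁ e₀ e₁ hf₀ hm
    exact (csInf_le ⟨-a₁, fun m hm => neg_le_of_mem_descendingMaxima e₁ hm⟩ hm').trans hle

/-- Homology known for one function at one level propagates to both functions at all larger levels;
comparing a function with itself at two levels gives the independence of the level. -/
theorem CommonDescent.minmax (h : CommonDescent f₀ f₁ H D M δ) (hf₀ : Continuous f₀)
    (hf₁ : Continuous f₁) {n : ℕ} {a : ℝ}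
    (he : Nonempty (RelHomology n (sublevel f₁ a) (sublevel f₁ (-a)) ≃ₗ[ZMod 2] ZMod 2))
    (hi : ∀ i, i ≠ n → Subsingleton (RelHomology i (sublevel f₁ a) (sublevel f₁ (-a))))
    (ha : M ≤ a) :
    (MinmaxWellDefined f₀ n ∧ minmax f₀ n = sInf (descendingMaxima f₀ n a)) ∧
      (MinmaxWellDefined f₁ n ∧ minmax f₁ n = sInf (descendingMaxima f₁ n a)) ∧
      minmax f₀ n = minmax f₁ n := by
  obtain ⟨e⟩ := he
  have key : ∀ f, Continuous f → CommonDescent f f₁ H D M δ →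
      Nonempty (RelHomology n (sublevel f a) (sublevel f (-a)) ≃ₗ[ZMod 2] ZMod 2) ∧
        MinmaxWellDefined f n ∧ _root_.minmax f n = sInf (descendingMaxima f n a) := by
    intro f hf hd
    have e' : ∀ a' ≥ a, Nonempty (RelHomology n (sublevel f a') (sublevel f (-a')) ≃ₗ[ZMod 2]
        ZMod 2) := fun a' ha' => by
      obtain ⟨e'⟩ := hd.nonempty_equiv hf hf₁ (ha.trans ha') ha n
      exact ⟨e'.trans e⟩
    refine ⟨e' a le_rfl, minmaxWellDefined_of_sInf_eq hf e' (fun a' ha' i hin => ?_)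
      fun a' ha' => ?_⟩
    · obtain ⟨e'⟩ := hd.nonempty_equiv hf hf₁ (ha.trans ha') ha i
      have := hi i hin
      exact e'.toEquiv.subsingleton
    · obtain ⟨e₁⟩ := e' a' ha'
      obtain ⟨e₂⟩ := e' a le_rfl
      exact hd.left.sInf_eq hf hf (ha.trans ha') ha e₁ e₂
  obtain ⟨⟨e₀⟩, h₀, h₀'⟩ := key f₀ hf₀ h
  obtain ⟨-, h₁, h₁'⟩ := key f₁ hf₁ h.symm.left
  refine ⟨⟨h₀, h₀'⟩, ⟨h₁, h₁'⟩, ?_⟩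
  rw [h₀', h₁']
  exact h.sInf_eq hf₀ hf₁ ha ha e₀ e

end Deformation

/-! ### The homology of the sublevel sets of a quadratic form -/

section QuadraticSublevels

/-- Repeated doubling expels every compact set that avoids the origin beyond any given radius. -/
theorem relHomology_sphere (k : ℕ) {a : ℝ} (ha : 0 < a) (n : ℕ) :
    Nonempty (RelHomology n univ {w : Fin k → ℝ | a ≤ ∑ j, w j ^ 2} ≃ₗ[ZMod 2]
      RelHomology n univ {w : Fin k → ℝ | w ≠ 0}) := by
  have hc : Continuous fun p : ℝ × (Fin k → ℝ) => (1 + p.1) • p.2 := by fun_prop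
  have hq : Continuous fun w : Fin k → ℝ => ∑ j, w j ^ 2 := by fun_prop
  have hs : ∀ (c : ℝ) (w : Fin k → ℝ), ∑ j, (c • w) j ^ 2 = c ^ 2 * ∑ j, w j ^ 2 := by
    intro c w
    simp [Finset.mul_sum, mul_pow]
  have hnn : ∀ w : Fin k → ℝ, 0 ≤ ∑ j, w j ^ 2 := fun w =>
    Finset.sum_nonneg fun j _ => sq_nonneg _
  refine nonempty_equiv_of_eventuallyMaps ⟨_, hc⟩ (fun x => by simp) n (subset_refl _) ?_
    (fun _ _ _ _ => trivial) (fun s hs' x hx => ?_) (fun _ _ _ _ => trivial)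
    (fun s hs' x hx => ?_) (eventuallyMaps_self fun _ _ => trivial) ?_
  · rintro w hw rfl
    have : a ≤ ∑ j : Fin k, (0 : Fin k → ℝ) j ^ 2 := hw
    simp at this
    linarith
  · change a ≤ ∑ j, ((1 + s) • x) j ^ 2
    rw [hs]
    have hx' : a ≤ ∑ j, x j ^ 2 := hx
    nlinarith [hs'.1, hnn x, mul_nonneg hs'.1 (hnn x), mul_nonneg (sq_nonneg s) (hnn x)]
  · exact smul_ne_zero (by linarith [hs'.1]) hx
  · intro K hK hK0
    have hpos : ∀ w ∈ K, 0 < ∑ j, w j ^ 2 := fun w hw => by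
      refine lt_of_le_of_ne (hnn w) fun h => hK0 hw ?_
      ext j
      have := (Finset.sum_eq_zero_iff_of_nonneg fun j _ => sq_nonneg (w j)).1 h.symm j
        (Finset.mem_univ j)
      simpa using this
    obtain ⟨μ, hμ, hμK⟩ : ∃ μ > 0, ∀ w ∈ K, μ ≤ ∑ j, w j ^ 2 := by
      rcases K.eq_empty_or_nonempty with rfl | hne
      · exact ⟨1, one_pos, fun w hw => hw.elim⟩
      · obtain ⟨w, hw, hmin⟩ := hK.exists_isMinOn hne hq.continuousOn
        exact ⟨_, hpos w hw, fun y hy => hmin hy⟩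
    obtain ⟨k', hk'⟩ := pow_unbounded_of_one_lt (a / μ) (by norm_num : (1 : ℝ) < 4)
    rw [div_lt_iff₀ hμ] at hk'
    refine ⟨k', fun i hi w hw => ?_⟩
    have hit : ∀ i : ℕ, (homotopyAt (⟨_, hc⟩ : C(ℝ × (Fin k → ℝ), Fin k → ℝ)) 1)^[i] w =
        (2 : ℝ) ^ i • w := by
      intro i
      induction i with
      | zero => simp
      | succ i ih =>
        rw [Function.iterate_succ_apply', ih]
        change (1 + 1 : ℝ) • ((2 : ℝ) ^ i • w) = _
        rw [smul_smul, pow_succ']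
        norm_num
    change a ≤ ∑ j, ((homotopyAt _ 1)^[i] w) j ^ 2
    rw [hit, hs, ← pow_mul, mul_comm i 2, pow_mul]
    have h4 : (4 : ℝ) ^ k' ≤ (2 ^ 2) ^ i := by
      norm_num
      exact pow_le_pow_right₀ (by norm_num) hi
    calc a ≤ 4 ^ k' * μ := hk'.le
      _ ≤ _ := mul_le_mul h4 (hμK w hw) hμ.le (by positivity)

/-- Diagonalize by Sylvester's law: `p` reads the negative coordinates and `i` inserts them. The
homotopy shrinks the remaining coordinates, whose weights are nonnegative, so `Q` cannot increase.
-/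
theorem exists_negative_coordinates {E : Type*} [NormedAddCommGroup E] [NormedSpace ℝ E]
    [FiniteDimensional ℝ E] (Q : QuadraticForm ℝ E) :
    ∃ (p : E →ₗ[ℝ] (Fin (sigNeg Q) → ℝ)) (i : (Fin (sigNeg Q) → ℝ) →ₗ[ℝ] E),
      (∀ w, p (i w) = w) ∧ (∀ w, Q (i w) = -∑ j, w j ^ 2) ∧ (∀ x, -∑ j, p x j ^ 2 ≤ Q x) ∧
      ∀ s ∈ Icc (0 : ℝ) 1, ∀ x, Q (x - s • (x - i (p x))) ≤ Q x := by
  classical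
  obtain ⟨w, hw, ⟨e⟩⟩ := Q.equivalent_one_zero_neg_one_weighted_sum_squared
  have hk := QuadraticForm.sigNeg_of_equiv_weightedSumSquares ⟨e⟩
  let n : {l // w l < 0} ≃ Fin (sigNeg Q) := Fintype.equivFinOfCardEq (by
    rw [hk, ← Nat.card_eq_fintype_card, ← Nat.card_coe_set_eq]
    rfl)
  have hQ : ∀ x, Q x = ∑ l, w l * (e x l) ^ 2 := fun x => by
    rw [← e.map_app x, QuadraticMap.weightedSumSquares_apply]
    simp [pow_two]
  let p : E →ₗ[ℝ] (Fin (sigNeg Q) → ℝ) := LinearMap.pi fun j =>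
    (LinearMap.proj (n.symm j).1).comp e.toLinearEquiv.toLinearMap
  let i₀ : (Fin (sigNeg Q) → ℝ) →ₗ[ℝ] (Fin (Module.finrank ℝ E) → ℝ) := LinearMap.pi fun l =>
    if h : w l < 0 then LinearMap.proj (n ⟨l, h⟩) else 0
  let i : (Fin (sigNeg Q) → ℝ) →ₗ[ℝ] E := e.toLinearEquiv.symm.toLinearMap.comp i₀
  have hei : ∀ z, e (i z) = i₀ z := fun z => e.toLinearEquiv.apply_symm_apply (i₀ z)
  have hi₀ : ∀ z l (h : w l < 0), i₀ z l = z (n ⟨l, h⟩) := fun z l h => by simp [i₀, h]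
  have hi₀' : ∀ z l, ¬ w l < 0 → i₀ z l = 0 := fun z l h => by simp [i₀, h]
  have hp : ∀ x j, p x j = e x (n.symm j).1 := fun x j => rfl
  have hpi : ∀ z, p (i z) = z := fun z => by
    ext j
    rw [hp, hei, hi₀ _ _ (n.symm j).2]
    simp
  have hneg : ∀ l, w l < 0 → w l = -1 := fun l hl => by
    rcases hw l with h | h | h <;> linarith
  have hsum : ∀ y : Fin (Module.finrank ℝ E) → ℝ,
      -∑ j, y (n.symm j).1 ^ 2 = ∑ l with w l < 0, w l * y l ^ 2 := fun y => by
    rw [Equiv.sum_comp n.symm (fun l => y l.1 ^ 2), ← Finset.sum_neg_distrib,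
      Finset.sum_subtype (Finset.univ.filter fun l => w l < 0) (p := fun l => w l < 0)
        (fun l => by simp)]
    refine Finset.sum_congr rfl fun l _ => ?_
    rw [hneg l.1 l.2]; ring
  refine ⟨p, i, hpi, fun z => ?_, fun x => ?_, fun s hs x => ?_⟩
  · have h1 := hsum (e (i z))
    have h2 : ∀ j, e (i z) (n.symm j).1 = z j := fun j => congrFun (hpi z) j
    simp only [h2] at h1
    rw [hQ, h1, Finset.sum_filter]
    refine Finset.sum_congr rfl fun l _ => ?_
    split_ifs with h
    · rfl
    · rw [hei, hi₀' _ _ h]; ring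
  · have h1 := hsum (e x)
    simp only [hp]
    rw [h1, hQ, Finset.sum_filter]
    refine Finset.sum_le_sum fun l _ => ?_
    split_ifs with h
    · rfl
    · exact mul_nonneg (not_lt.1 h) (sq_nonneg _)
  · rw [hQ, hQ]
    refine Finset.sum_le_sum fun l _ => ?_
    have h1 : e (x - s • (x - i (p x))) l = e x l - s * (e x l - e (i (p x)) l) := by
      have : e (x - s • (x - i (p x))) = e x - s • (e x - e (i (p x))) := by
        change e.toLinearEquiv _ = e.toLinearEquiv _ - s • (e.toLinearEquiv _ - e.toLinearEquiv _)
        rw [map_sub, map_smul, map_sub]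
      rw [this]; rfl
    by_cases h : w l < 0
    · have h2 : e (i (p x)) l = e x l := by
        rw [hei, hi₀ _ _ h, hp]; simp
      rw [h1, h2, sub_self, mul_zero, sub_zero]
    · rw [h1, hei, hi₀' _ _ h]
      refine mul_le_mul_of_nonneg_left ?_ (not_lt.1 h)
      nlinarith [mul_nonneg (mul_nonneg hs.1 (sub_nonneg.2 hs.2)) (sq_nonneg (e x l)),
        mul_nonneg hs.1 (sq_nonneg (e x l))]

/-- The pair `(Q^a, Q^{-a})` has the homology of a relative sphere. -/
theorem relHomology_quadraticForm {E : Type*} [NormedAddCommGroup E] [NormedSpace ℝ E]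
    [FiniteDimensional ℝ E] (Q : QuadraticForm ℝ E) {a : ℝ} (ha : 0 < a) :
    Nonempty (RelHomology (sigNeg Q) (sublevel Q a) (sublevel Q (-a)) ≃ₗ[ZMod 2] ZMod 2) ∧
      ∀ n, n ≠ sigNeg Q → Subsingleton (RelHomology n (sublevel Q a) (sublevel Q (-a))) := by
  obtain ⟨p, i, hpi, hQi, hQp, hQs⟩ := exists_negative_coordinates Q
  have hp : Continuous p := p.continuous_of_finiteDimensional
  have hi : Continuous i := i.continuous_of_finiteDimensional
  have hnn : ∀ w : Fin (sigNeg Q) → ℝ, 0 ≤ ∑ j, w j ^ 2 := fun w =>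
    Finset.sum_nonneg fun j _ => sq_nonneg _
  have hc : Continuous fun q : ℝ × E => q.2 - q.1 • (q.2 - i (p q.2)) :=
    continuous_snd.sub (continuous_fst.smul (continuous_snd.sub
      (hi.comp (hp.comp continuous_snd))))
  have key : ∀ n, Nonempty (RelHomology n (sublevel Q a) (sublevel Q (-a)) ≃ₗ[ZMod 2]
      RelHomology n univ {w : Fin (sigNeg Q) → ℝ | w ≠ 0}) := fun n => by
    obtain ⟨e₁⟩ := relHomology_sphere (sigNeg Q) ha n
    -- The pair retracts onto the negative subspace, where `Q = -∑ w_j²`: the level a > 0 imposes no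
    -- condition there, and the level -a cuts out the exterior of a ball.
    obtain ⟨e₂⟩ := nonempty_relHomology_equiv n (U := sublevel Q a) (V := sublevel Q (-a))
      (U' := univ) (V' := {w : Fin (sigNeg Q) → ℝ | a ≤ ∑ j, w j ^ 2}) ⟨p, hp⟩
      (fun _ _ => trivial) (fun x (hx : Q x ≤ -a) => by
        change a ≤ ∑ j, p x j ^ 2
        linarith [hQp x])
      ⟨i, hi⟩ (fun w _ => by
        change Q (i w) ≤ a
        rw [hQi]; linarith [hnn w])
      (fun w (hw : a ≤ _) => by
        change Q (i w) ≤ -a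
        rw [hQi]; linarith) ⟨_, hc⟩ (fun x => by simp) (fun x => by simp)
      (fun s hs x hx => (hQs s hs x).trans hx) (fun s hs x hx => (hQs s hs x).trans hx)
      ⟨Prod.snd, continuous_snd⟩ (fun _ => rfl) (fun y => (hpi y).symm)
      (fun _ _ _ _ => trivial) (fun _ _ _ h => h)
    exact ⟨e₂.trans e₁⟩
  obtain ⟨⟨e⟩, h⟩ := relHomology_punctured (sigNeg Q)
  refine ⟨?_, fun n hn => ?_⟩
  · obtain ⟨e'⟩ := key (sigNeg Q)
    exact ⟨e'.trans e⟩
  · obtain ⟨e'⟩ := key n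
    have := h n hn
    exact e'.toEquiv.subsingleton

end QuadraticSublevels

/-! ### Mean value inequalities for Lipschitz functions -/

section ClarkeMeanValue

variable {E : Type*} [NormedAddCommGroup E] [InnerProductSpace ℝ E] [FiniteDimensional ℝ E]

/-- The function need not be differentiable at any point of the segment, but by Rademacher's theorem
almost every translate of each point is a point of differentiability. Hence average over
translations in a small ball, apply the mean value inequality to the average, and let the ball
shrink. -/
theorem LipschitzWith.sub_smul_le_of_fderiv_ge [MeasurableSpace E] [BorelSpace E] {g : E → ℝ}
    {K : ℝ≥0} (hg : LipschitzWith K g) {x v : E} {τ δ s : ℝ} (hv : ‖v‖ ≤ 1) (hs : 0 ≤ s)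
    (hsτ : s < τ)
    (h : ∀ y ∈ Metric.ball x τ, DifferentiableAt ℝ g y → δ ≤ fderiv ℝ g y v) :
    g (x - s • v) ≤ g x - s * δ := by
  refine le_of_forall_pos_le_add fun ε₀ hε₀ => ?_
  -- The first bound keeps the translated segment inside the ball of radius τ; the second controls
  -- the error of averaging at its two endpoints.
  obtain ⟨ε, hε, hετ, hεK⟩ : ∃ ε > 0, ε < τ - s ∧ 2 * K * ε ≤ ε₀ := by
    have h1 : (0 : ℝ) < 2 * K + 1 := by positivity
    refine ⟨min ((τ - s) / 2) (ε₀ / (2 * K + 1)), by have := sub_pos.2 hsτ; positivity, ?_, ?_⟩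
    · exact (min_le_left _ _).trans_lt (by linarith)
    · calc 2 * K * min ((τ - s) / 2) (ε₀ / (2 * K + 1)) ≤ (2 * K + 1) * (ε₀ / (2 * K + 1)) := by
            gcongr
            · linarith
            · exact min_le_right _ _
        _ = ε₀ := by field_simp
  let μ : Measure E := volume.restrict (Metric.ball 0 ε)
  have hfin : IsFiniteMeasure μ := ⟨by
    rw [Measure.restrict_apply_univ]; exact measure_ball_lt_top⟩
  let V : ℝ := μ.real univ
  have hV : 0 < V := by
    refine ENNReal.toReal_pos ?_ (measure_ne_top μ univ)
    rw [Measure.restrict_apply_univ]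
    exact (Metric.measure_ball_pos volume 0 hε).ne'
  let φ : ℝ → ℝ := fun r => ∫ u, g (x - r • v + u) ∂μ
  have hint : ∀ r : ℝ, Integrable (fun u => g (x - r • v + u)) μ := fun r => by
    have : IntegrableOn (fun u => g (x - r • v + u)) (Metric.closedBall 0 ε) :=
      (hg.continuous.comp (continuous_const.add continuous_id)).continuousOn.integrableOn_compact
        (isCompact_closedBall 0 ε)
    exact this.mono_set Metric.ball_subset_closedBall
  have hdiff : ∀ r : ℝ, ∀ᵐ u ∂μ, DifferentiableAt ℝ g (x - r • v + u) := fun r =>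
    ae_restrict_of_ae ((measurePreserving_add_left volume (x - r • v)).quasiMeasurePreserving.ae
      hg.ae_differentiableAt)
  have hderiv : ∀ r : ℝ, Integrable (fun u => -(fderiv ℝ g (x - r • v + u) v)) μ ∧
      HasDerivAt φ (∫ u, -(fderiv ℝ g (x - r • v + u) v) ∂μ) r := fun r => by
    refine hasDerivAt_integral_of_dominated_loc_of_lip (bound := fun _ => (K : ℝ))
      (F := fun r u => g (x - r • v + u)) univ_mem
      (Eventually.of_forall fun r => (hint r).aestronglyMeasurable) (hint r) ?_
      (ae_of_all _ fun u => ?_) (integrable_const _) ?_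
    · exact ((measurable_fderiv_apply_const ℝ g v).comp
        (measurable_const.add measurable_id)).neg.aestronglyMeasurable
    · refine LipschitzWith.lipschitzOnWith (LipschitzWith.of_dist_le_mul fun r₁ r₂ => ?_)
      refine (hg.dist_le_mul _ _).trans ?_
      rw [dist_add_right, dist_sub_left, dist_eq_norm, ← sub_smul, norm_smul, ← dist_eq_norm]
      simp only [Real.coe_nnabs, NNReal.abs_eq]
      exact mul_le_mul_of_nonneg_left (mul_le_of_le_one_right dist_nonneg hv) K.2
    · filter_upwards [hdiff r] with u hu
      have h1 : HasDerivAt (fun r : ℝ => x - r • v + u) (-v) r := by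
        simpa using (((hasDerivAt_id r).smul_const v).const_sub x).add_const u
      have := hu.hasFDerivAt.comp_hasDerivAt r h1
      rwa [map_neg] at this
  have hle : ∀ r ∈ Icc (0 : ℝ) s, deriv φ r ≤ -(δ * V) := fun r hr => by
    rw [(hderiv r).2.deriv]
    have h1 : ∫ u, -(fderiv ℝ g (x - r • v + u) v) ∂μ ≤ ∫ _, -δ ∂μ := by
      refine integral_mono_ae (hderiv r).1 (integrable_const _) ?_
      filter_upwards [hdiff r, ae_restrict_mem (measurableSet_ball (x := (0 : E)) (ε := ε))] with u hu hu'
      refine neg_le_neg (h _ ?_ hu)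
      rw [mem_ball_zero_iff] at hu'
      rw [Metric.mem_ball, dist_eq_norm]
      calc ‖x - r • v + u - x‖ = ‖u - r • v‖ := by congr 1; abel
        _ ≤ ‖u‖ + ‖r • v‖ := _root_.norm_sub_le _ _
        _ ≤ ‖u‖ + s := by
            rw [norm_smul, Real.norm_of_nonneg hr.1]
            have := mul_le_of_le_one_right hr.1 hv
            linarith [hr.2]
        _ < τ := by linarith
    refine h1.trans_eq ?_
    rw [integral_const, smul_eq_mul]
    ring
  have hφ : φ s - φ 0 ≤ -(δ * V) * (s - 0) := by
    refine Convex.image_sub_le_mul_sub_of_deriv_le (convex_Icc 0 s)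
      (fun r _ => (hderiv r).2.continuousAt.continuousWithinAt)
      (fun r _ => (hderiv r).2.differentiableAt.differentiableWithinAt)
      (fun r hr => hle r (interior_subset hr)) 0 ⟨le_rfl, hs⟩ s ⟨hs, le_rfl⟩ hs
  have happ : ∀ r : ℝ, |φ r - V * g (x - r • v)| ≤ V * (K * ε) := fun r => by
    have h1 : φ r - V * g (x - r • v) = ∫ u, (g (x - r • v + u) - g (x - r • v)) ∂μ := by
      rw [integral_sub (hint r) (integrable_const _), integral_const, smul_eq_mul]
    rw [h1, ← Real.norm_eq_abs]
    have h2 : ‖∫ u, (g (x - r • v + u) - g (x - r • v)) ∂μ‖ ≤ (K * ε) * μ.real univ := by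
      refine norm_integral_le_of_norm_le_const ?_
      filter_upwards [ae_restrict_mem (measurableSet_ball (x := (0 : E)) (ε := ε))] with u hu'
      rw [mem_ball_zero_iff] at hu'
      rw [← dist_eq_norm]
      refine (hg.dist_le_mul _ _).trans ?_
      rw [dist_self_add_left]
      exact mul_le_mul_of_nonneg_left hu'.le K.2
    rw [mul_comm V]
    exact h2
  have e1 := (abs_le.1 (happ s)).1
  have e2 := (abs_le.1 (happ 0)).2
  rw [zero_smul, sub_zero] at e2
  have e3 : V * g (x - s • v) ≤ V * (g x - s * δ + 2 * K * ε) := by nlinarith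
  linarith [le_of_mul_le_mul_left e3 hV]

/-- Only the values in the open ball matter, so the function may be replaced by a global Lipschitz
extension with the same derivatives there. -/
theorem LipschitzOnWith.sub_smul_le_of_fderiv_ge {g : E → ℝ} {x v : E} {τ δ s : ℝ} {K : ℝ≥0}
    (hg : LipschitzOnWith K g (Metric.ball x τ)) (hv : ‖v‖ ≤ 1) (hs : 0 ≤ s) (hsτ : s < τ)
    (h : ∀ y ∈ Metric.ball x τ, DifferentiableAt ℝ g y → δ ≤ fderiv ℝ g y v) :
    g (x - s • v) ≤ g x - s * δ := by
  borelize E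
  obtain ⟨f, hf, hfg⟩ := hg.extend_real
  have hx : x ∈ Metric.ball x τ := Metric.mem_ball_self (hs.trans_lt hsτ)
  have hx' : x - s • v ∈ Metric.ball x τ := by
    rw [Metric.mem_ball, dist_eq_norm, sub_sub_cancel_left, norm_neg, norm_smul,
      Real.norm_of_nonneg hs]
    exact (mul_le_of_le_one_right hs hv).trans_lt hsτ
  rw [hfg hx, hfg hx']
  refine hf.sub_smul_le_of_fderiv_ge hv hs hsτ fun y hy hd => ?_
  have he : g =ᶠ[𝓝 y] f := by
    filter_upwards [Metric.isOpen_ball.mem_nhds hy] with z hz using hfg hz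
  rw [← he.fderiv_eq]
  exact h y hy (hd.congr_of_eventuallyEq he)

theorem LipschitzOnWith.sub_smul_le_of_norm_fderiv_le {g : E → ℝ} {x v : E} {τ ℓ s : ℝ} {K : ℝ≥0}
    (hg : LipschitzOnWith K g (Metric.ball x τ)) (hv : ‖v‖ ≤ 1) (hs : 0 ≤ s) (hsτ : s < τ)
    (hℓ : 0 ≤ ℓ) (h : ∀ y ∈ Metric.ball x τ, DifferentiableAt ℝ g y → ‖fderiv ℝ g y‖ ≤ ℓ) :
    g (x - s • v) ≤ g x + s * ℓ := by
  have := hg.sub_smul_le_of_fderiv_ge hv hs hsτ (δ := -ℓ) fun y hy hd => by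
    have h1 := (fderiv ℝ g y).le_opNorm v
    have h2 := mul_le_mul (h y hy hd) hv (norm_nonneg _) hℓ
    rw [mul_one] at h2
    exact (abs_le.1 (h1.trans h2)).1
  linarith

theorem LipschitzWith.exists_differentiableAt_mem_ball {g : E → ℝ} {K : ℝ≥0}
    (hg : LipschitzWith K g) (x : E) {r : ℝ} (hr : 0 < r) :
    ∃ y ∈ Metric.ball x r, DifferentiableAt ℝ g y := by
  borelize E
  obtain ⟨y, hy, hd⟩ := (Measure.dense_of_ae (hg.ae_differentiableAt (μ := volume))).exists_mem_open
    Metric.isOpen_ball (Metric.nonempty_ball.2 hr)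
  exact ⟨y, hd, hy⟩

/-- The bound on derivatives survives limits, since it is closed, and the convex hull, since balls
are convex. -/
theorem norm_le_of_mem_clarkeDeriv {E : Type*} [NormedAddCommGroup E] [NormedSpace ℝ E] {g : E → ℝ} {K : ℝ≥0} (hg : LipschitzWith K g) {x : E}
    {w : E →L[ℝ] ℝ} (hw : w ∈ clarkeDeriv g x) : ‖w‖ ≤ K := by
  have : clarkeDeriv g x ⊆ Metric.closedBall 0 K := by
    refine convexHull_min (fun y hy => ?_) (convex_closedBall _ _)
    rw [mem_closedBall_zero_iff]
    have hcl : IsClosed {p : E × (E →L[ℝ] ℝ) | ‖p.2‖ ≤ K} :=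
      isClosed_le (by fun_prop) continuous_const
    refine hcl.closure_subset_iff.2 ?_ hy
    rintro p ⟨-, hp⟩
    change ‖p.2‖ ≤ K
    rw [hp]
    exact norm_fderiv_le_of_lipschitz ℝ hg
  exact mem_closedBall_zero_iff.1 (this hw)

/-- Limits of derivatives along bounded subsequences are Clarke derivatives. -/
theorem exists_mem_clarkeDeriv_of_tendsto {g : E → ℝ} {x : E} {y : ℕ → E} {B : ℝ}
    (hy : Tendsto y atTop (𝓝 x)) (hd : ∀ n, DifferentiableAt ℝ g (y n))
    (hB : ∀ n, ‖fderiv ℝ g (y n)‖ ≤ B) :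
    ∃ w ∈ {y | (x, y) ∈ closure
        {p : E × (E →L[ℝ] ℝ) | DifferentiableAt ℝ g p.1 ∧ p.2 = fderiv ℝ g p.1}},
      ∃ k : ℕ → ℕ, StrictMono k ∧ Tendsto (fun n => fderiv ℝ g (y (k n))) atTop (𝓝 w) := by
  obtain ⟨w, -, k, hk, hw⟩ := (isCompact_closedBall (0 : E →L[ℝ] ℝ) B).tendsto_subseq
    (x := fun n => fderiv ℝ g (y n)) (fun n => mem_closedBall_zero_iff.2 (hB n))
  refine ⟨w, mem_closure_of_tendsto (((hy.comp hk.tendsto_atTop)).prodMk_nhds hw)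
    (Eventually.of_forall fun n => ⟨hd _, rfl⟩), k, hk, hw⟩

/-- By Carathéodory's theorem the hull is a finite union of continuous images of products of copies
of `s` with a simplex. -/
theorem IsCompact.convexHull_of_finiteDimensional {F : Type*} [NormedAddCommGroup F]
    [NormedSpace ℝ F] [FiniteDimensional ℝ F] {s : Set F} (hs : IsCompact s) :
    IsCompact (convexHull ℝ s) := by
  let Φ : ∀ m : ℕ, (Fin m → F) × (Fin m → ℝ) → F := fun m p => ∑ i, p.2 i • p.1 i
  have hΦ : ∀ m, Continuous (Φ m) := fun m => by fun_prop
  have h : convexHull ℝ s = ⋃ m ∈ Iic (Module.finrank ℝ F + 1),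
      Φ m '' ((univ.pi fun _ => s) ×ˢ stdSimplex ℝ (Fin m)) := by
    ext x
    simp only [mem_iUnion]
    constructor
    · intro hx
      obtain ⟨ι, hι, z, w, hz, hai, hw, hw1, rfl⟩ := eq_pos_convex_span_of_mem_convexHull hx
      let e := Fintype.equivFin ι
      refine ⟨Fintype.card ι, ?_, (z ∘ e.symm, w ∘ e.symm), ⟨fun i _ => hz ⟨_, rfl⟩,
        fun i => (hw _).le, ?_⟩, ?_⟩
      · exact hai.card_le_finrank_succ.trans (by gcongr; exact Submodule.finrank_le _)
      · rw [← hw1]; exact Equiv.sum_comp e.symm w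
      · exact Equiv.sum_comp e.symm fun i => w i • z i
    · rintro ⟨m, -, p, ⟨hp, hp'⟩, rfl⟩
      exact (convex_convexHull ℝ s).sum_mem (fun i _ => hp'.1 i) hp'.2
        fun i _ => subset_convexHull ℝ s (hp i trivial)
  rw [h]
  refine (finite_Iic _).isCompact_biUnion fun m _ => ?_
  exact ((isCompact_univ_pi fun _ => hs).prod (isCompact_stdSimplex ℝ _)).image (hΦ m)

end ClarkeMeanValue

/-! ### Lipschitz perturbations of a nondegenerate quadratic form -/

section QuadraticDerivative

variable {E : Type*} [NormedAddCommGroup E] [NormedSpace ℝ E] [FiniteDimensional ℝ E]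

/-- The derivative of a quadratic form, as a continuous linear map into the dual space. -/
def quadDeriv (Q : QuadraticForm ℝ E) : E →L[ℝ] E →L[ℝ] ℝ :=
  LinearMap.toContinuousLinearMap
    ((LinearMap.toContinuousLinearMap : (E →ₗ[ℝ] ℝ) ≃ₗ[ℝ] (E →L[ℝ] ℝ)).toLinearMap ∘ₗ Q.polarBilin)

theorem quadDeriv_apply (Q : QuadraticForm ℝ E) (x y : E) :
    quadDeriv Q x y = Q (x + y) - Q x - Q y := rfl

theorem quadForm_eq_quadDeriv (Q : QuadraticForm ℝ E) (x : E) :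
    Q x = 2⁻¹ * quadDeriv Q x x := by
  rw [quadDeriv_apply, ← two_smul ℝ x, QuadraticMap.map_smul]
  simp only [smul_eq_mul]
  ring

theorem quadForm_sub_smul (Q : QuadraticForm ℝ E) (x v : E) (r : ℝ) :
    Q (x - r • v) = Q x - r * quadDeriv Q x v + r ^ 2 * Q v := by
  have h := quadDeriv_apply Q x ((-r) • v)
  rw [map_smul, QuadraticMap.map_smul] at h
  simp only [smul_eq_mul] at h
  have e : x - r • v = x + (-r) • v := by rw [neg_smul, sub_eq_add_neg]
  rw [e]
  linarith

theorem abs_quadForm_le (Q : QuadraticForm ℝ E) (x : E) : |Q x| ≤ ‖quadDeriv Q‖ * ‖x‖ ^ 2 := by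
  rw [quadForm_eq_quadDeriv, abs_mul]
  have h := (quadDeriv Q).le_opNorm₂ x x
  rw [Real.norm_eq_abs] at h
  rw [abs_of_pos (by norm_num : (0 : ℝ) < 2⁻¹)]
  nlinarith [abs_nonneg (quadDeriv Q x x)]

theorem hasFDerivAt_quadForm (Q : QuadraticForm ℝ E) (x : E) :
    HasFDerivAt (fun y => Q y) (quadDeriv Q x) x := by
  have h := ((quadDeriv Q).hasFDerivAt_of_bilinear (hasFDerivAt_id x) (hasFDerivAt_id x)).const_mul
    (2⁻¹ : ℝ)
  have e : (fun y => Q y) = fun y => 2⁻¹ * quadDeriv Q (id y) (id y) :=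
    funext fun y => quadForm_eq_quadDeriv Q y
  rw [e]
  refine h.congr_fderiv ?_
  ext v
  change 2⁻¹ * (quadDeriv Q x v + quadDeriv Q v x) = quadDeriv Q x v
  have : quadDeriv Q v x = quadDeriv Q x v := by
    rw [quadDeriv_apply, quadDeriv_apply, add_comm v x]; ring
  rw [this]; ring

theorem continuous_quadForm (Q : QuadraticForm ℝ E) : Continuous fun x => Q x :=
  continuous_iff_continuousAt.2 fun x => (hasFDerivAt_quadForm Q x).continuousAt

theorem exists_lipschitzOnWith_quadForm (Q : QuadraticForm ℝ E) (x : E) (r : ℝ) :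
    ∃ K, LipschitzOnWith K (fun y => Q y) (Metric.ball x r) := by
  refine ⟨(‖quadDeriv Q‖ * (‖x‖ + |r|)).toNNReal,
    (convex_ball x r).lipschitzOnWith_of_nnnorm_hasFDerivWithin_le
      (fun y _ => (hasFDerivAt_quadForm Q y).hasFDerivWithinAt) fun y hy => ?_⟩
  rw [← NNReal.coe_le_coe, coe_nnnorm, Real.coe_toNNReal _ (by positivity)]
  refine ((quadDeriv Q).le_opNorm y).trans ?_
  have : ‖y‖ ≤ ‖x‖ + |r| := by
    rw [Metric.mem_ball, dist_eq_norm] at hy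
    have := norm_le_norm_add_norm_sub' y x
    linarith [le_abs_self r]
  gcongr

end QuadraticDerivative

/-! ### A descent step common to two perturbations of a quadratic form -/

section CommonStep

variable {E : Type*} [NormedAddCommGroup E] [InnerProductSpace ℝ E] [FiniteDimensional ℝ E]
  {Q : QuadraticForm ℝ E}

/-- Compactness turns the strict pointwise inequality into a uniform gap, valid also slightly inside
the ball of radius b. Violations stay bounded because ‖DQ(x)‖ ≥ c‖x‖ while the derivatives of ψ are
at most L, and a limit of violations yields a forbidden Clarke derivative. -/
theorem exists_uniform_gap {c : ℝ} (hc : 0 < c) (hQ : ∀ x, c * ‖x‖ ≤ ‖quadDeriv Q x‖)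
    {ψ : E → ℝ} {L : ℝ≥0} (hψ : LipschitzWith L ψ) {b : ℝ}
    (hb : ∀ x, b ≤ ‖x‖ → ∀ w ∈ clarkeDeriv ψ x, ‖w‖ < ‖quadDeriv Q x‖) :
    ∃ κ > 0, ∀ x, b - κ ≤ ‖x‖ → ∀ y ∈ Metric.ball x κ, DifferentiableAt ℝ ψ y →
      ‖fderiv ℝ ψ y‖ ≤ ‖quadDeriv Q x‖ - κ := by
  by_contra! hcon
  choose x hx y hy hd hlt using fun n : ℕ => hcon (1 / ((n : ℝ) + 1)) (by positivity)
  have hn : Tendsto (fun n : ℕ => 1 / ((n : ℝ) + 1)) atTop (𝓝 0) :=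
    tendsto_one_div_add_atTop_nhds_zero_nat
  have hn1 : ∀ n : ℕ, 1 / ((n : ℝ) + 1) ≤ 1 := fun n => by
    rw [div_le_one (by positivity)]
    linarith [(Nat.cast_nonneg n : (0 : ℝ) ≤ n)]
  have hL : ∀ n, ‖fderiv ℝ ψ (y n)‖ ≤ L := fun n => norm_fderiv_le_of_lipschitz ℝ hψ
  obtain ⟨a, -, k, hk, ha⟩ := (isCompact_closedBall (0 : E) ((L + 1) / c)).tendsto_subseq
    (x := x) fun n => by
      rw [mem_closedBall_zero_iff, le_div_iff₀ hc, mul_comm]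
      linarith [hQ (x n), hlt n, hL n, hn1 n]
  have hya : Tendsto (y ∘ k) atTop (𝓝 a) := by
    refine tendsto_of_tendsto_of_dist ha ?_
    refine squeeze_zero (fun _ => dist_nonneg) (fun n => ?_) (hn.comp hk.tendsto_atTop)
    rw [dist_comm]
    exact (Metric.mem_ball.1 (hy (k n))).le
  obtain ⟨w, hw, l, hl, hwl⟩ := exists_mem_clarkeDeriv_of_tendsto hya (fun n => hd _) fun n => hL _
  have hb' : b ≤ ‖a‖ := by
    refine le_of_tendsto_of_tendsto (b := atTop) (f := fun n => b - 1 / ((k n : ℝ) + 1)) ?_ ha.norm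
      (Eventually.of_forall fun n => hx _)
    simpa using (hn.comp hk.tendsto_atTop).const_sub b
  refine absurd (hb a hb' w (subset_convexHull ℝ _ hw)) (not_lt.2 ?_)
  have h1 : Tendsto (fun n => ‖quadDeriv Q (x (k (l n)))‖ - 1 / ((k (l n) : ℝ) + 1)) atTop
      (𝓝 (‖quadDeriv Q a‖ - 0)) :=
    ((((quadDeriv Q).continuous.tendsto a).comp (ha.comp hl.tendsto_atTop)).norm).sub
      (hn.comp (hk.tendsto_atTop.comp hl.tendsto_atTop))
  rw [sub_zero] at h1
  exact le_of_tendsto_of_tendsto h1 hwl.norm (Eventually.of_forall fun n => (hlt _).le)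

/-- The normalized gradient of `Q`, regularized near the origin. -/
def quadDirection (Q : QuadraticForm ℝ E) (κ : ℝ) (x : E) : E :=
  (max ‖quadDeriv Q x‖ κ)⁻¹ • (InnerProductSpace.toDual ℝ E).symm (quadDeriv Q x)

theorem continuous_quadDirection {κ : ℝ} (hκ : 0 < κ) : Continuous (quadDirection Q κ) := by
  refine Continuous.smul (Continuous.inv₀ (by fun_prop) fun x => ?_) ?_
  · exact (hκ.trans_le (le_max_right _ _)).ne'
  · exact (InnerProductSpace.toDual ℝ E).symm.continuous.comp (quadDeriv Q).continuous

theorem norm_quadDirection_le {κ : ℝ} (hκ : 0 < κ) (x : E) : ‖quadDirection Q κ x‖ ≤ 1 := by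
  have : 0 < max ‖quadDeriv Q x‖ κ := hκ.trans_le (le_max_right _ _)
  rw [quadDirection, norm_smul, norm_inv, LinearIsometryEquiv.norm_map,
    Real.norm_of_nonneg this.le, inv_mul_le_one₀ this]
  exact le_max_left _ _

theorem quadDeriv_quadDirection {κ : ℝ} {x : E} (hx : κ ≤ ‖quadDeriv Q x‖) :
    quadDeriv Q x (quadDirection Q κ x) = ‖quadDeriv Q x‖ := by
  have h : quadDeriv Q x ((InnerProductSpace.toDual ℝ E).symm (quadDeriv Q x)) =
      ‖quadDeriv Q x‖ ^ 2 := by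
    rw [← InnerProductSpace.toDual_symm_apply (𝕜 := ℝ), real_inner_self_eq_norm_sq,
      LinearIsometryEquiv.norm_map]
  rw [quadDirection, map_smul, h, max_eq_left hx, smul_eq_mul, sq, ← mul_assoc, inv_mul_mul_self]

/-- The direction of descent depends on `Q` only, hence serves both perturbations. An Euler step
replaces a flow, as sublevel sets only need to be mapped into one another. -/
theorem exists_commonDescent {c : ℝ} (hc : 0 < c) (hQ : ∀ x, c * ‖x‖ ≤ ‖quadDeriv Q x‖)
    {ψ₀ ψ₁ : E → ℝ} {L₀ L₁ : ℝ≥0} (hψ₀ : LipschitzWith L₀ ψ₀) (hψ₁ : LipschitzWith L₁ ψ₁) {b : ℝ}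
    (heq : ∀ x, ‖x‖ ≤ b → ψ₀ x = ψ₁ x)
    (hb₀ : ∀ x, b ≤ ‖x‖ → ∀ w ∈ clarkeDeriv ψ₀ x, ‖w‖ < ‖quadDeriv Q x‖)
    (hb₁ : ∀ x, b ≤ ‖x‖ → ∀ w ∈ clarkeDeriv ψ₁ x, ‖w‖ < ‖quadDeriv Q x‖) :
    ∃ H D M δ, CommonDescent (fun x => ψ₀ x + Q x) (fun x => ψ₁ x + Q x) H D M δ := by
  obtain ⟨κ₀, hκ₀, h₀⟩ := exists_uniform_gap hc hQ hψ₀ hb₀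
  obtain ⟨κ₁, hκ₁, h₁⟩ := exists_uniform_gap hc hQ hψ₁ hb₁
  set κ := min κ₀ κ₁ with hκdef
  have hκ : 0 < κ := lt_min hκ₀ hκ₁
  have hcontQ := continuous_quadForm Q
  set C := ‖quadDeriv Q‖ with hCdef
  have hC : 0 ≤ C := norm_nonneg (quadDeriv Q)
  -- The first term keeps the step inside the balls where the gap holds; the second makes the
  -- quadratic error r²C at most half of the gain rκ.
  set τ := min (κ / 2) (κ / (2 * (C + 1))) with hτdef
  have hτ : 0 < τ := by positivity
  have hτκ : τ < κ := (min_le_left _ _).trans_lt (by linarith)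
  have hτC : τ * C ≤ κ / 2 := by
    calc τ * C ≤ κ / (2 * (C + 1)) * (C + 1) :=
          mul_le_mul (min_le_right _ _) (by linarith) hC (by positivity)
      _ = κ / 2 := by field_simp
  -- the Euler step decreases both functions
  have hstep : ∀ (ψ : E → ℝ) (L : ℝ≥0), LipschitzWith L ψ → (∃ κ' ≥ κ, ∀ x, b - κ' ≤ ‖x‖ →
      ∀ y ∈ Metric.ball x κ', DifferentiableAt ℝ ψ y → ‖fderiv ℝ ψ y‖ ≤ ‖quadDeriv Q x‖ - κ') →
      ∀ x, b - κ ≤ ‖x‖ → ∀ r, 0 ≤ r → r ≤ τ →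
        ψ (x - r • quadDirection Q κ x) + Q (x - r • quadDirection Q κ x) ≤
          ψ x + Q x - r * (κ / 2) := by
    rintro ψ L hψ ⟨κ', hκ', h⟩ x hx r hr hrτ
    have hx' : b - κ' ≤ ‖x‖ := by linarith
    -- A single point of differentiability shows ‖DQ(x)‖ ≥ κ', so the regularization in
    -- `quadDirection` is inactive at `x`.
    obtain ⟨y, hy, hd⟩ := hψ.exists_differentiableAt_mem_ball x (hκ.trans_le hκ')
    have hxκ : 0 ≤ ‖quadDeriv Q x‖ - κ' := (norm_nonneg _).trans (h x hx' y hy hd)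
    have hn := norm_quadDirection_le (Q := Q) hκ x
    have e1 := (hψ.lipschitzOnWith (s := Metric.ball x κ')).sub_smul_le_of_norm_fderiv_le hn hr
      (hrτ.trans_lt (hτκ.trans_le hκ')) hxκ (h x hx')
    rw [quadForm_sub_smul, quadDeriv_quadDirection (by linarith)]
    have e2 : Q (quadDirection Q κ x) ≤ C := by
      refine (le_abs_self _).trans ((abs_quadForm_le Q _).trans ?_)
      exact mul_le_of_le_one_right hC (pow_le_one₀ (norm_nonneg _) hn)
    have e3 : r ^ 2 * Q (quadDirection Q κ x) ≤ r * (κ / 2) := by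
      calc r ^ 2 * Q (quadDirection Q κ x) ≤ r ^ 2 * C := by gcongr
        _ = r * (r * C) := by ring
        _ ≤ r * (κ / 2) := by
          gcongr
          exact (mul_le_mul_of_nonneg_right hrτ hC).trans hτC
    have e4 : r * (‖quadDeriv Q x‖ - κ') ≤ r * (‖quadDeriv Q x‖ - κ) := by gcongr
    linarith
  have hstep₀ := hstep ψ₀ L₀ hψ₀ ⟨κ₀, min_le_left _ _, h₀⟩
  have hstep₁ := hstep ψ₁ L₁ hψ₁ ⟨κ₁, min_le_right _ _, h₁⟩
  -- The cut-off is 0 for |x| ≤ b - κ, where nothing is known, and 1 for |x| ≥ b, so that the full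
  -- step is made outside the ball.
  let χ : E → ℝ := fun x => min 1 (max 0 ((‖x‖ - (b - κ)) / κ))
  have hχ0 : ∀ x, 0 ≤ χ x := fun x => le_min zero_le_one (le_max_left _ _)
  have hχ1 : ∀ x, χ x ≤ 1 := fun x => min_le_left _ _
  have hχz : ∀ x, ¬ b - κ ≤ ‖x‖ → χ x = 0 := fun x hx => by
    have : (‖x‖ - (b - κ)) / κ ≤ 0 := div_nonpos_of_nonpos_of_nonneg (by linarith) hκ.le
    simp [χ, max_eq_left this]
  have hχo : ∀ x, b ≤ ‖x‖ → χ x = 1 := fun x hx => by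
    have : 1 ≤ (‖x‖ - (b - κ)) / κ := by rw [le_div_iff₀ hκ]; linarith
    exact min_eq_left (this.trans (le_max_right _ _))
  have hχc : Continuous χ := by fun_prop
  have hH : Continuous fun p : ℝ × E => p.2 - (p.1 * τ * χ p.2) • quadDirection Q κ p.2 := by
    have := continuous_quadDirection (Q := Q) hκ
    fun_prop
  have hle : ∀ ψ : E → ℝ, (∀ x, b - κ ≤ ‖x‖ → ∀ r, 0 ≤ r → r ≤ τ →
        ψ (x - r • quadDirection Q κ x) + Q (x - r • quadDirection Q κ x) ≤
          ψ x + Q x - r * (κ / 2)) → ∀ s ∈ Icc (0 : ℝ) 1, ∀ x,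
      ψ (x - (s * τ * χ x) • quadDirection Q κ x) + Q (x - (s * τ * χ x) • quadDirection Q κ x) ≤
        ψ x + Q x := by
    intro ψ h s hs x
    by_cases hx : b - κ ≤ ‖x‖
    · have hr : 0 ≤ s * τ * χ x := mul_nonneg (mul_nonneg hs.1 hτ.le) (hχ0 x)
      refine (h x hx _ hr ?_).trans ?_
      · calc s * τ * χ x ≤ 1 * τ * 1 := mul_le_mul (mul_le_mul_of_nonneg_right hs.2 hτ.le)
              (hχ1 x) (hχ0 x) (by positivity)
          _ = τ := by ring
      · have := mul_nonneg hr (half_pos hκ).le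
        linarith
    · rw [hχz x hx]; simp
  have hlt : ∀ ψ : E → ℝ, (∀ x, b - κ ≤ ‖x‖ → ∀ r, 0 ≤ r → r ≤ τ →
        ψ (x - r • quadDirection Q κ x) + Q (x - r • quadDirection Q κ x) ≤
          ψ x + Q x - r * (κ / 2)) → ∀ x ∉ Metric.closedBall (0 : E) b,
      ψ (x - (1 * τ * χ x) • quadDirection Q κ x) + Q (x - (1 * τ * χ x) • quadDirection Q κ x) ≤
        ψ x + Q x - τ * (κ / 2) := by
    intro ψ h x hx
    rw [mem_closedBall_zero_iff, not_le] at hx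
    rw [hχo x hx.le, one_mul, mul_one]
    exact h x (by linarith) τ hτ.le le_rfl
  obtain ⟨M, hM⟩ := ((isCompact_closedBall (0 : E) b).image
    (f := fun x => |ψ₀ x + Q x|) (by have := hψ₀.continuous; fun_prop)).bddAbove
  exact ⟨⟨_, hH⟩, Metric.closedBall 0 b, M + 1, τ * (κ / 2), by positivity, fun x => by simp,
    hle ψ₀ hstep₀, hle ψ₁ hstep₁, hlt ψ₀ hstep₀, hlt ψ₁ hstep₁,
    fun x hx => by rw [heq x (mem_closedBall_zero_iff.1 hx)],
    fun x hx => (hM ⟨x, hx, rfl⟩).trans_lt (by linarith)⟩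

end CommonStep

/-! ### The minmax of a Lipschitz perturbation of a nondegenerate quadratic form -/

section LipschitzMinmax

/-- The Lipschitz constant does not depend on a: the derivative of the rescaled cut-off is of order
1/a, while ψ is of order a on its support. -/
theorem lipschitzWith_cutoff_mul {E : Type*} [NormedAddCommGroup E] [NormedSpace ℝ E] {θ ψ : E → ℝ} {Lθ L : ℝ≥0} {R B : ℝ≥0} (hθ : LipschitzWith Lθ θ)
    (h01 : ∀ x, θ x ∈ Icc (0 : ℝ) 1) (hR : ∀ x, (R : ℝ) ≤ ‖x‖ → θ x = 0)
    (hψ : LipschitzWith L ψ) (hB : |ψ 0| ≤ B) {a : ℝ} (ha : 1 ≤ a) :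
    LipschitzWith (L + Lθ * (B + L * R)) fun x => θ (a⁻¹ • x) * ψ x := by
  have ha0 : 0 < a := by linarith
  have key : ∀ x y, ‖a⁻¹ • x‖ ≤ R → |θ (a⁻¹ • x) * ψ x - θ (a⁻¹ • y) * ψ y| ≤
      (L + Lθ * (B + L * R)) * ‖x - y‖ := by
    intro x y hx
    have h1 : |ψ x - ψ y| ≤ L * ‖x - y‖ := by
      simpa only [dist_eq_norm, Real.norm_eq_abs] using hψ.dist_le_mul x y
    have h2 : |θ (a⁻¹ • x) - θ (a⁻¹ • y)| ≤ Lθ * (a⁻¹ * ‖x - y‖) := by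
      have := hθ.dist_le_mul (a⁻¹ • x) (a⁻¹ • y)
      rwa [dist_eq_norm, dist_eq_norm, ← smul_sub, norm_smul, norm_inv,
        Real.norm_of_nonneg ha0.le, Real.norm_eq_abs] at this
    have hx' : ‖x‖ ≤ a * R := by
      rwa [norm_smul, norm_inv, Real.norm_of_nonneg ha0.le, inv_mul_le_iff₀ ha0] at hx
    have h3 : |ψ x| ≤ a * (B + L * R) := by
      have h := hψ.dist_le_mul x 0
      rw [dist_zero_right, Real.dist_eq] at h
      have h' := abs_sub_abs_le_abs_sub (ψ x) (ψ 0)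
      have h4 : (L : ℝ) * ‖x‖ ≤ L * (a * R) := by gcongr
      have h5 : (B : ℝ) ≤ a * B := le_mul_of_one_le_left B.2 ha
      calc |ψ x| ≤ B + L * (a * R) := by linarith
        _ ≤ a * B + L * (a * R) := by linarith
        _ = a * (B + L * R) := by ring
    -- The splitting evaluates the undifferenced factor ψ only at `x`, the point known to lie in the
    -- rescaled ball.
    have e : θ (a⁻¹ • x) * ψ x - θ (a⁻¹ • y) * ψ y =
        θ (a⁻¹ • y) * (ψ x - ψ y) + (θ (a⁻¹ • x) - θ (a⁻¹ • y)) * ψ x := by ring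
    rw [e]
    refine (abs_add_le _ _).trans ?_
    rw [abs_mul, abs_mul, abs_of_nonneg (h01 _).1, add_mul]
    refine add_le_add ?_ ?_
    · calc θ (a⁻¹ • y) * |ψ x - ψ y| ≤ 1 * (L * ‖x - y‖) :=
            mul_le_mul (h01 _).2 h1 (abs_nonneg _) zero_le_one
        _ = L * ‖x - y‖ := one_mul _
    · calc |θ (a⁻¹ • x) - θ (a⁻¹ • y)| * |ψ x|
          ≤ (Lθ * (a⁻¹ * ‖x - y‖)) * (a * (B + L * R)) :=
            mul_le_mul h2 h3 (abs_nonneg _) (by positivity)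
        _ = Lθ * (B + L * R) * ‖x - y‖ := by field_simp
  refine LipschitzWith.of_dist_le_mul fun x y => ?_
  rw [Real.dist_eq, dist_eq_norm]
  push_cast
  rcases le_total ‖a⁻¹ • x‖ R with hx | hx
  · exact key x y hx
  rcases le_total ‖a⁻¹ • y‖ R with hy | hy
  · rw [abs_sub_comm, norm_sub_rev]
    exact key y x hy
  · rw [hR _ hx, hR _ hy, zero_mul, zero_mul, sub_zero, abs_zero]
    positivity

variable {E : Type*} [NormedAddCommGroup E] [InnerProductSpace ℝ E] [FiniteDimensional ℝ E]
  {Q : QuadraticForm ℝ E}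

theorem norm_lt_of_mem_clarkeDeriv {c : ℝ} (hc : 0 < c) (hQ : ∀ x, c * ‖x‖ ≤ ‖quadDeriv Q x‖)
    {ψ : E → ℝ} {L : ℝ≥0} (hψ : LipschitzWith L ψ) {b : ℝ} (hb : L < c * b) (x : E) (hx : b ≤ ‖x‖)
    (w : E →L[ℝ] ℝ) (hw : w ∈ clarkeDeriv ψ x) : ‖w‖ < ‖quadDeriv Q x‖ :=
  calc ‖w‖ ≤ L := norm_le_of_mem_clarkeDeriv hψ hw
    _ < c * b := hb
    _ ≤ c * ‖x‖ := by gcongr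
    _ ≤ ‖quadDeriv Q x‖ := hQ x

/-- The minmax of a Lipschitz perturbation of a nondegenerate quadratic form is well defined. -/
theorem minmaxWellDefined_add_quadForm {c : ℝ} (hc : 0 < c) (hQ : ∀ x, c * ‖x‖ ≤ ‖quadDeriv Q x‖)
    {ψ : E → ℝ} {L : ℝ≥0} (hψ : LipschitzWith L ψ) :
    MinmaxWellDefined (fun x => ψ x + Q x) (sigNeg Q) := by
  let θ : E → ℝ := fun x => max 0 (min 1 (2 - ‖x‖))
  have hθ : LipschitzWith 1 θ := by
    have h : LipschitzWith 1 fun x : E => 2 - ‖x‖ := by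
      simpa using (LipschitzWith.const (2 : ℝ)).sub (lipschitzWith_one_norm (E := E))
    exact (h.const_min 1).const_max 0
  have h01 : ∀ x, θ x ∈ Icc (0 : ℝ) 1 := fun x =>
    ⟨le_max_left _ _, max_le zero_le_one (min_le_left _ _)⟩
  have hθ0 : ∀ x, ((2 : ℝ≥0) : ℝ) ≤ ‖x‖ → θ x = 0 := fun x hx =>
    max_eq_left ((min_le_right _ _).trans (by simpa using hx))
  have hθ1 : ∀ x, ‖x‖ ≤ 1 → θ x = 1 := fun x hx => by
    have : min 1 (2 - ‖x‖) = 1 := min_eq_left (by linarith)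
    simp [θ, this]
  set L' : ℝ≥0 := L + 1 * (‖ψ 0‖₊ + L * 2) with hL'
  -- The radius a is chosen after L', which is possible because L' is a Lipschitz constant of the
  -- truncation at every scale a ≥ 1.
  obtain ⟨a, ha1, haL⟩ : ∃ a : ℝ, 1 ≤ a ∧ L' < c * a := by
    refine ⟨max 1 ((L' + 1) / c), le_max_left _ _, ?_⟩
    calc (L' : ℝ) < c * ((L' + 1) / c) := by rw [mul_div_cancel₀ _ hc.ne']; linarith
      _ ≤ _ := by gcongr; exact le_max_right _ _
  have ha0 : 0 < a := by linarith
  have hψ₁ : LipschitzWith L' fun x => θ (a⁻¹ • x) * ψ x :=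
    lipschitzWith_cutoff_mul hθ h01 hθ0 hψ (by simp) ha1
  have hLL' : L ≤ L' := le_add_of_nonneg_right zero_le
  have hLa : (L : ℝ) < c * a := lt_of_le_of_lt (by exact_mod_cast hLL') haL
  obtain ⟨H, D, M, δ, hd⟩ := exists_commonDescent hc hQ hψ hψ₁ (b := a)
    (fun x hx => by
      rw [hθ1, one_mul]
      rwa [norm_smul, norm_inv, Real.norm_of_nonneg ha0.le, inv_mul_le_one₀ ha0])
    (norm_lt_of_mem_clarkeDeriv hc hQ hψ hLa) (norm_lt_of_mem_clarkeDeriv hc hQ hψ₁ haL)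
  have hcQ := continuous_quadForm Q
  have hc₁ := hψ₁.continuous
  obtain ⟨B, hB⟩ := ((isCompact_closedBall (0 : E) (2 * a)).image
    (f := fun x => max |θ (a⁻¹ • x) * ψ x + Q x| |Q x|) (by fun_prop)).bddAbove
  -- The truncated function equals `Q` outside the ball of radius 2a, and inside that ball both are
  -- bounded by B; so their sublevel sets agree at every level r with |r| > B.
  have hsub : ∀ r : ℝ, B < |r| → sublevel (fun x => θ (a⁻¹ • x) * ψ x + Q x) r = sublevel Q r := by
    intro r hr
    ext x
    change θ (a⁻¹ • x) * ψ x + Q x ≤ r ↔ Q x ≤ r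
    by_cases hx : ‖x‖ ≤ 2 * a
    · have h := hB ⟨x, mem_closedBall_zero_iff.2 hx, rfl⟩
      have h1 := (le_max_left _ _).trans h
      have h2 := (le_max_right _ _).trans h
      rw [abs_le] at h1 h2
      rcases lt_abs.1 hr with h3 | h3 <;> constructor <;> intro <;> linarith
    · rw [hθ0, zero_mul, zero_add]
      rw [norm_smul, norm_inv, Real.norm_of_nonneg ha0.le, le_inv_mul_iff₀ ha0]
      push_cast
      linarith
  set a' := max M (max 1 (B + 1)) with ha'
  have ha'1 : 1 ≤ a' := (le_max_left _ _).trans (le_max_right _ _)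
  have ha'B : B < a' := lt_of_lt_of_le (lt_add_one B) ((le_max_right _ _).trans (le_max_right _ _))
  obtain ⟨he, hi⟩ := relHomology_quadraticForm Q (a := a') (by linarith)
  rw [← hsub a' (ha'B.trans_le (le_abs_self _)),
    ← hsub (-a') (by rw [abs_neg]; exact ha'B.trans_le (le_abs_self _))] at he hi
  have hcψ := hψ.continuous
  exact (hd.minmax (by fun_prop) (by fun_prop) he hi (le_max_left _ _)).1.1

/-- Two Lipschitz perturbations of a quadratic form that agree on a ball, and that have no critical
points outside, have the same minmax. -/
theorem minmax_add_quadForm_eq {c : ℝ} (hc : 0 < c) (hQ : ∀ x, c * ‖x‖ ≤ ‖quadDeriv Q x‖)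
    {ψ₀ ψ₁ : E → ℝ} {L₀ L₁ : ℝ≥0} (hψ₀ : LipschitzWith L₀ ψ₀) (hψ₁ : LipschitzWith L₁ ψ₁) {b : ℝ}
    (heq : ∀ x, ‖x‖ ≤ b → ψ₀ x = ψ₁ x)
    (hb₀ : ∀ x, b ≤ ‖x‖ → ∀ w ∈ clarkeDeriv ψ₀ x, ‖w‖ < ‖quadDeriv Q x‖)
    (hb₁ : ∀ x, b ≤ ‖x‖ → ∀ w ∈ clarkeDeriv ψ₁ x, ‖w‖ < ‖quadDeriv Q x‖) :
    minmax (fun x => ψ₀ x + Q x) (sigNeg Q) = minmax (fun x => ψ₁ x + Q x) (sigNeg Q) := by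
  obtain ⟨H, D, M, δ, hd⟩ := exists_commonDescent hc hQ hψ₀ hψ₁ heq hb₀ hb₁
  obtain ⟨a₀, ha₀⟩ := minmaxWellDefined_add_quadForm hc hQ hψ₁
  have hcQ := continuous_quadForm Q
  have hc₀ := hψ₀.continuous
  have hc₁ := hψ₁.continuous
  obtain ⟨he, hi, -⟩ := ha₀ (max M a₀) (le_max_right _ _)
  exact (hd.minmax (by fun_prop) (by fun_prop) he hi (le_max_left _ _)).2.2

/-! ### The minmax is a critical value -/

theorem fderiv_of_differentiableAt_add_quadForm {ψ : E → ℝ} {y : E}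
    (hd : DifferentiableAt ℝ (fun x => ψ x + Q x) y) :
    fderiv ℝ (fun x => ψ x + Q x) y = fderiv ℝ ψ y + quadDeriv Q y := by
  have hq := hasFDerivAt_quadForm Q y
  have hψ : DifferentiableAt ℝ ψ y := by
    refine (hd.sub hq.differentiableAt).congr_of_eventuallyEq (Eventually.of_forall fun x => ?_)
    exact (add_sub_cancel_right (ψ x) (Q x)).symm
  exact (hψ.hasFDerivAt.add hq).fderiv

theorem norm_fderiv_add_quadForm_le {ψ : E → ℝ} {L : ℝ≥0} (hψ : LipschitzWith L ψ) {y : E}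
    (hd : DifferentiableAt ℝ (fun x => ψ x + Q x) y) :
    ‖fderiv ℝ (fun x => ψ x + Q x) y‖ ≤ L + ‖quadDeriv Q‖ * ‖y‖ := by
  rw [fderiv_of_differentiableAt_add_quadForm hd]
  exact (norm_add_le _ _).trans
    (add_le_add (norm_fderiv_le_of_lipschitz ℝ hψ) ((quadDeriv Q).le_opNorm y))

/-- Away from the Clarke critical points, all derivatives at nearby points are bounded below in some
common direction. -/
theorem exists_direction_of_zero_notMem_clarkeDeriv {ψ : E → ℝ} {L : ℝ≥0}
    (hψ : LipschitzWith L ψ) {a : E}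
    (ha : (0 : E →L[ℝ] ℝ) ∉ clarkeDeriv (fun x => ψ x + Q x) a) :
    ∃ v : E, ‖v‖ ≤ 1 ∧ ∃ u > 0, ∀ w ∈ clarkeDeriv (fun x => ψ x + Q x) a, u < w v := by
  set f := fun x => ψ x + Q x with hf
  let S : Set (E × (E →L[ℝ] ℝ)) := {p | DifferentiableAt ℝ f p.1 ∧ p.2 = fderiv ℝ f p.1}
  let P : Set (E →L[ℝ] ℝ) := {y | (a, y) ∈ closure S}
  have hPb : P ⊆ Metric.closedBall 0 (L + ‖quadDeriv Q‖ * ‖a‖) := by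
    intro w hw
    rw [mem_closedBall_zero_iff]
    have hcl : IsClosed {p : E × (E →L[ℝ] ℝ) | ‖p.2‖ ≤ L + ‖quadDeriv Q‖ * ‖p.1‖} :=
      isClosed_le (by fun_prop) (by fun_prop)
    refine hcl.closure_subset_iff.2 ?_ hw
    rintro p ⟨hd, hp⟩
    change ‖p.2‖ ≤ _
    rw [hp]
    exact norm_fderiv_add_quadForm_le hψ hd
  have hP : IsCompact P := (isCompact_closedBall _ _).of_isClosed_subset
    (isClosed_closure.preimage (Continuous.prodMk_right a)) hPb
  -- Separate 0 from the compact convex Clarke derivative. The separating functional on the dual is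
  -- evaluation at a vector, found through the Riesz isomorphism.
  obtain ⟨Φ, u, hu0, hu⟩ := geometric_hahn_banach_point_closed (convex_convexHull ℝ P)
    hP.convexHull_of_finiteDimensional.isClosed ha
  rw [map_zero] at hu0
  let J := InnerProductSpace.toDual ℝ E
  let v : E := J.symm (LinearMap.toContinuousLinearMap
    { toFun := fun z => Φ (J z), map_add' := fun _ _ => by simp, map_smul' := fun _ _ => by simp })
  have hv : ∀ w : E →L[ℝ] ℝ, w v = Φ w := fun w => by
    obtain ⟨z, rfl⟩ := J.surjective w
    have h1 : J z v = inner ℝ z v := InnerProductSpace.toDual_apply_apply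
    have h2 : inner ℝ v z = Φ (J z) := InnerProductSpace.toDual_symm_apply
    rw [h1, real_inner_comm, h2]
  have hpos : 0 < ‖v‖ + 1 := by positivity
  refine ⟨(‖v‖ + 1)⁻¹ • v, ?_, (‖v‖ + 1)⁻¹ * u, by positivity, fun w hw => ?_⟩
  · rw [norm_smul, norm_inv, Real.norm_of_nonneg hpos.le, inv_mul_le_one₀ hpos]
    linarith
  · rw [map_smul, hv, smul_eq_mul]
    exact mul_lt_mul_of_pos_left (hu w hw) (by positivity)

/-- A compactness argument of Palais–Smale type: points near level γ without a good direction stay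
bounded and accumulate at a point of level γ, where the separating direction contradicts their
choice. -/
theorem exists_uniform_direction {c : ℝ} (hc : 0 < c) (hQ : ∀ x, c * ‖x‖ ≤ ‖quadDeriv Q x‖)
    {ψ : E → ℝ} {L : ℝ≥0} (hψ : LipschitzWith L ψ) {γ : ℝ}
    (hγ : ¬ IsClarkeCriticalValue (fun x => ψ x + Q x) γ) :
    ∃ ε > 0, ∀ x, |ψ x + Q x - γ| ≤ ε → ∃ v : E, ‖v‖ ≤ 1 ∧ ∀ y ∈ Metric.ball x ε,
      DifferentiableAt ℝ (fun x => ψ x + Q x) y → ε ≤ fderiv ℝ (fun x => ψ x + Q x) y v := by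
  set f := fun x => ψ x + Q x with hf
  have hcQ := continuous_quadForm Q
  have hcψ := hψ.continuous
  have hfc : Continuous f := by fun_prop
  by_contra! hcon
  choose x hx hcon using fun n : ℕ => hcon (1 / ((n : ℝ) + 1)) (by positivity)
  have hn : Tendsto (fun n : ℕ => 1 / ((n : ℝ) + 1)) atTop (𝓝 0) :=
    tendsto_one_div_add_atTop_nhds_zero_nat
  have hn1 : ∀ n : ℕ, 1 / ((n : ℝ) + 1) ≤ 1 := fun n => by
    rw [div_le_one (by positivity)]
    linarith [(Nat.cast_nonneg n : (0 : ℝ) ≤ n)]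
  set C := ‖quadDeriv Q‖ with hC
  have hC0 : 0 ≤ C := norm_nonneg (quadDeriv Q)
  have hbd : ∀ n, ‖x n‖ ≤ (L + C + 1) / c := by
    intro n
    rw [le_div_iff₀ hc, mul_comm]
    by_contra! hlt
    have h1 : 1 ≤ ‖quadDeriv Q (x n)‖ := by linarith [hQ (x n), L.2]
    -- Far from the origin the normalized gradient of `Q` is itself a good direction: the derivative
    -- along it is at least ‖DQ(x)‖ - C - L.
    have hv := norm_quadDirection_le (Q := Q) one_pos (x n)
    obtain ⟨y, hy, hd, hlt'⟩ := hcon n _ hv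
    rw [fderiv_of_differentiableAt_add_quadForm hd] at hlt'
    set v := quadDirection Q 1 (x n)
    change fderiv ℝ ψ y v + quadDeriv Q y v < _ at hlt'
    have e1 : -L ≤ fderiv ℝ ψ y v := by
      have h := (fderiv ℝ ψ y).le_opNorm v
      have h' : ‖fderiv ℝ ψ y‖ * ‖v‖ ≤ L * 1 :=
        mul_le_mul (norm_fderiv_le_of_lipschitz ℝ hψ) hv (norm_nonneg _) L.2
      rw [mul_one] at h'
      exact (abs_le.1 (h.trans h')).1
    have e2 : |quadDeriv Q (y - x n) v| ≤ C := by
      refine ((quadDeriv Q).le_opNorm₂ _ _).trans ?_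
      rw [mul_assoc]
      refine mul_le_of_le_one_right hC0 (mul_le_one₀ ?_ (norm_nonneg _) hv)
      rw [Metric.mem_ball, dist_eq_norm] at hy
      exact hy.le.trans (hn1 n)
    have e3 := quadDeriv_quadDirection (Q := Q) h1
    rw [map_sub] at e2
    change |quadDeriv Q y v - quadDeriv Q (x n) v| ≤ C at e2
    have e4 := (abs_le.1 e2).1
    change quadDeriv Q (x n) v = _ at e3
    linarith [hQ (x n), hn1 n]
  obtain ⟨a, -, k, hk, ha⟩ := (isCompact_closedBall (0 : E) ((L + C + 1) / c)).tendsto_subseq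
    (x := x) fun n => mem_closedBall_zero_iff.2 (hbd n)
  have hfa : f a = γ := by
    have h1 : Tendsto (fun n => |f (x (k n)) - γ|) atTop (𝓝 |f a - γ|) :=
      (((hfc.tendsto a).comp ha).sub_const γ).abs
    have h2 := le_of_tendsto_of_tendsto h1 (hn.comp hk.tendsto_atTop)
      (Eventually.of_forall fun n => hx _)
    exact sub_eq_zero.1 (abs_nonpos_iff.1 h2)
  obtain ⟨v, hv, u, hu, hw⟩ := exists_direction_of_zero_notMem_clarkeDeriv hψ
    (a := a) fun h => hγ ⟨a, h, hfa⟩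
  choose y hy hd hlt using fun n => hcon (k n) v hv
  have hya : Tendsto y atTop (𝓝 a) := by
    refine tendsto_of_tendsto_of_dist ha ?_
    refine squeeze_zero (fun _ => dist_nonneg) (fun n => ?_) (hn.comp hk.tendsto_atTop)
    rw [dist_comm]
    exact (Metric.mem_ball.1 (hy n)).le
  have hyb : ∀ n, ‖fderiv ℝ f (y n)‖ ≤ L + C * ((L + C + 1) / c + 1) := fun n => by
    refine (norm_fderiv_add_quadForm_le hψ (hd n)).trans ?_
    have h1 := hy n
    rw [Metric.mem_ball, dist_eq_norm] at h1
    have h2 := norm_le_norm_add_norm_sub' (y n) (x (k n))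
    have : ‖y n‖ ≤ (L + C + 1) / c + 1 := by linarith [hbd (k n), hn1 (k n)]
    gcongr
  obtain ⟨w, hwP, l, hl, hlw⟩ := exists_mem_clarkeDeriv_of_tendsto hya hd hyb
  have h0 : w v ≤ 0 := by
    refine le_of_tendsto_of_tendsto (b := atTop) (f := fun n => fderiv ℝ f (y (l n)) v) ?_
      (hn.comp (hk.tendsto_atTop.comp hl.tendsto_atTop)) (Eventually.of_forall fun n => (hlt _).le)
    exact ((ContinuousLinearMap.apply ℝ ℝ v).continuous.tendsto w).comp hlw
  linarith [hw w (subset_convexHull ℝ _ hwP)]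

/-- A homotopy that pushes the sublevel sets down through a level that is not critical. -/
theorem exists_deformation {c : ℝ} (hc : 0 < c) (hQ : ∀ x, c * ‖x‖ ≤ ‖quadDeriv Q x‖)
    {ψ : E → ℝ} {L : ℝ≥0} (hψ : LipschitzWith L ψ) {γ : ℝ}
    (hγ : ¬ IsClarkeCriticalValue (fun x => ψ x + Q x) γ) :
    ∃ H : C(ℝ × E, E), (∀ x, H (0, x) = x) ∧
      (∀ s ∈ Icc (0 : ℝ) 1, ∀ x, ψ (H (s, x)) + Q (H (s, x)) ≤ ψ x + Q x) ∧
      ∃ ε > 0, ∀ x, ψ x + Q x ≤ γ + ε → ψ (H (1, x)) + Q (H (1, x)) ≤ γ - ε := by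
  obtain ⟨ε, hε, h⟩ := exists_uniform_direction hc hQ hψ hγ
  set f := fun x => ψ x + Q x with hf
  have hcQ := continuous_quadForm Q
  have hcψ := hψ.continuous
  have hfc : Continuous f := by fun_prop
  -- The admissible directions at a point form a convex set, and a direction chosen at `x` remains
  -- admissible nearby since the ball has been halved; a partition of unity then gives a continuous
  -- field. Away from level γ no condition is imposed.
  obtain ⟨V, hV⟩ := exists_continuous_forall_mem_convex_of_local_const
    (t := fun x : E => {v : E | |f x - γ| ≤ ε / 2 → ‖v‖ ≤ 1 ∧ ∀ y ∈ Metric.ball x (ε / 2),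
      DifferentiableAt ℝ f y → ε ≤ fderiv ℝ f y v})
    (fun x v hv w hw p q hp hq hpq hx => by
      obtain ⟨hv1, hv2⟩ := hv hx
      obtain ⟨hw1, hw2⟩ := hw hx
      refine ⟨?_, fun y hy hd => ?_⟩
      · refine (norm_add_le _ _).trans ?_
        rw [norm_smul, norm_smul, Real.norm_of_nonneg hp, Real.norm_of_nonneg hq]
        nlinarith
      · rw [map_add, map_smul, map_smul, smul_eq_mul, smul_eq_mul]
        nlinarith [hv2 y hy hd, hw2 y hy hd])
    (fun x => by
      by_cases hx : |f x - γ| ≤ ε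
      · obtain ⟨v, hv, hv'⟩ := h x hx
        refine ⟨v, ?_⟩
        filter_upwards [Metric.ball_mem_nhds x (half_pos hε)] with x' hx' _
        refine ⟨hv, fun y hy hd => hv' y ?_ hd⟩
        have := dist_triangle y x' x
        rw [Metric.mem_ball] at *
        linarith
      · refine ⟨0, ?_⟩
        have : ∀ᶠ x' in 𝓝 x, ε / 2 < |f x' - γ| :=
          ContinuousAt.eventually_lt continuousAt_const (by fun_prop) (by linarith [not_le.1 hx])
        filter_upwards [this] with x' hx' hx''
        exact absurd hx'' (not_le.2 hx'))
  let lam : E → ℝ := fun x => max 0 (min 1 (2 - |f x - γ| / (ε / 4)))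
  have hlam0 : ∀ x, 0 ≤ lam x := fun x => le_max_left _ _
  have hlam1 : ∀ x, lam x ≤ 1 := fun x => max_le zero_le_one (min_le_left _ _)
  have hlamz : ∀ x, ε / 2 < |f x - γ| → lam x = 0 := fun x hx => by
    have : 2 ≤ |f x - γ| / (ε / 4) := by rw [le_div_iff₀ (by positivity)]; linarith
    exact max_eq_left ((min_le_right _ _).trans (by linarith))
  have hlamo : ∀ x, |f x - γ| ≤ ε / 4 → lam x = 1 := fun x hx => by
    have : |f x - γ| / (ε / 4) ≤ 1 := by rw [div_le_iff₀ (by positivity)]; linarith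
    have h' : min 1 (2 - |f x - γ| / (ε / 4)) = 1 := min_eq_left (by linarith)
    simp [lam, h']
  have hlamc : Continuous lam := by fun_prop
  have hH : Continuous fun p : ℝ × E => p.2 - (p.1 * (ε / 4) * lam p.2) • V p.2 := by fun_prop
  have hdec : ∀ s ∈ Icc (0 : ℝ) 1, ∀ x,
      f (x - (s * (ε / 4) * lam x) • V x) ≤ f x - s * (ε / 4) * lam x * ε := by
    intro s hs x
    by_cases hx : |f x - γ| ≤ ε / 2
    · obtain ⟨hv1, hv2⟩ := hV x hx
      have h0 : 0 ≤ s * (ε / 4) * lam x := mul_nonneg (mul_nonneg hs.1 (by positivity)) (hlam0 x)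
      have h1 : s * (ε / 4) * lam x ≤ ε / 4 := by
        calc s * (ε / 4) * lam x ≤ 1 * (ε / 4) * 1 := mul_le_mul
              (mul_le_mul_of_nonneg_right hs.2 (by positivity)) (hlam1 x) (hlam0 x) (by positivity)
          _ = ε / 4 := by ring
      obtain ⟨K, hK⟩ := exists_lipschitzOnWith_quadForm Q x (ε / 2)
      exact ((hψ.lipschitzOnWith (s := Metric.ball x (ε / 2))).add hK).sub_smul_le_of_fderiv_ge hv1
        h0 (by linarith) hv2
    · simp [hlamz x (not_le.1 hx)]
  have hle : ∀ s ∈ Icc (0 : ℝ) 1, ∀ x, f (x - (s * (ε / 4) * lam x) • V x) ≤ f x := by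
    intro s hs x
    have h0 : 0 ≤ s * (ε / 4) * lam x := mul_nonneg (mul_nonneg hs.1 (by positivity)) (hlam0 x)
    have := mul_nonneg h0 hε.le
    linarith [hdec s hs x]
  -- With ρ this minimum, points at levels between γ - ρ and γ + ρ lie where the cut-off is 1 and
  -- lose ε²/4 ≥ 2ρ in a full step.
  refine ⟨⟨_, hH⟩, fun x => by simp, hle, min (ε / 4) (ε / 4 * ε / 2), by positivity,
    fun x hx => ?_⟩
  set ρ := min (ε / 4) (ε / 4 * ε / 2) with hρ
  have hρ1 : ρ ≤ ε / 4 := min_le_left _ _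
  have hρ2 : ρ ≤ ε / 4 * ε / 2 := min_le_right _ _
  change f x ≤ γ + ρ at hx
  change f (x - (1 * (ε / 4) * lam x) • V x) ≤ γ - ρ
  by_cases hx' : f x ≤ γ - ρ
  · exact (hle 1 ⟨zero_le_one, le_rfl⟩ x).trans hx'
  · have hone := hlamo x (by rw [abs_le]; constructor <;> linarith)
    have := hdec 1 ⟨zero_le_one, le_rfl⟩ x
    rw [hone] at this ⊢
    linarith

/-- The minmax is a critical value. -/
theorem isClarkeCriticalValue_minmax {c : ℝ} (hc : 0 < c)
    (hQ : ∀ x, c * ‖x‖ ≤ ‖quadDeriv Q x‖) {ψ : E → ℝ} {L : ℝ≥0} (hψ : LipschitzWith L ψ) :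
    IsClarkeCriticalValue (fun x => ψ x + Q x) (minmax (fun x => ψ x + Q x) (sigNeg Q)) := by
  by_contra hγ
  obtain ⟨a, ha⟩ := minmaxWellDefined_add_quadForm hc hQ hψ
  obtain ⟨⟨e⟩, -, hglb⟩ := ha a le_rfl
  obtain ⟨H, hH0, hHle, ε, hε, hpush⟩ := exists_deformation hc hQ hψ hγ
  have hcQ := continuous_quadForm Q
  have hcψ := hψ.continuous
  have hfc : Continuous fun x => ψ x + Q x := by fun_prop
  obtain ⟨m, hm, hmε⟩ : ∃ m ∈ descendingMaxima (fun x => ψ x + Q x) (sigNeg Q) a,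
      m < minmax (fun x => ψ x + Q x) (sigNeg Q) + ε := by
    by_contra! hcon
    linarith [hglb.2 hcon]
  obtain ⟨σ, hσ, hσ', hσm⟩ := descendingMaxima_spec e hm
  have hmaps : ∀ r : ℝ, ∀ s ∈ Icc (0 : ℝ) 1, ∀ x ∈ sublevel (fun x => ψ x + Q x) r,
      H (s, x) ∈ sublevel (fun x => ψ x + Q x) r := fun r s hs x hx => (hHle s hs x).trans hx
  have h1 : (1 : ℝ) ∈ Icc (0 : ℝ) 1 := ⟨zero_le_one, le_rfl⟩
  have hadd := homotopy_add_mem_relBoundaries H (hmaps a) (hmaps (-a)) hσ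
  rw [show homotopyAt H 0 = ContinuousMap.id E from ContinuousMap.ext hH0, singMap_id] at hadd
  -- The pushed cycle is still a descending cycle, but its maximum is at most the minmax minus ε.
  obtain ⟨m', hm', hle⟩ := exists_mem_descendingMaxima hfc e
    (singMap_mem_relCycles (homotopyAt H 1) (hmaps a 1 h1) (hmaps (-a) 1 h1) hσ)
    (fun hb => hσ' ((Submodule.add_mem_iff_left _ hb).1 hadd))
    (singMap_mem_chainsIn (homotopyAt H 1) (fun x hx => hpush x (le_trans hx hmε.le)) hσm)
  linarith [hglb.1 hm']

end LipschitzMinmax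

/-! ### Hamiltonian flows -/

section PartialDerivative

variable {P W : Type*} [NormedAddCommGroup P] [NormedSpace ℝ P] [NormedAddCommGroup W]
  [NormedSpace ℝ W] {F : ℝ × P → W} {I : Set ℝ}

theorem hasFDerivAt_partial {m : WithTop ℕ∞} (hF : ContDiffOn ℝ (m + 1) F (I ×ˢ univ))
    {τ : ℝ} (hτ : τ ∈ I) (z : P) :
    HasFDerivAt (fun z => F (τ, z))
      ((fderivWithin ℝ F (I ×ˢ univ) (τ, z)).comp (ContinuousLinearMap.inr ℝ ℝ P)) z := by
  have h1 : HasFDerivWithinAt F (fderivWithin ℝ F (I ×ˢ univ) (τ, z)) (I ×ˢ univ) (τ, z) :=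
    ((hF.differentiableOn (by simp)) (τ, z) ⟨hτ, trivial⟩).hasFDerivWithinAt
  have h2 : HasFDerivWithinAt (fun z : P => (τ, z)) (ContinuousLinearMap.inr ℝ ℝ P) univ z :=
    (hasFDerivAt_prodMk_right τ z).hasFDerivWithinAt
  exact hasFDerivWithinAt_univ.1 (h1.comp z h2 fun _ _ => ⟨hτ, trivial⟩)

/-- The spatial derivative is the full derivative within the slab composed with the inclusion of the
spatial directions, so it loses exactly one order of regularity jointly in time and space. -/
theorem contDiffOn_fderiv_partial (hI : UniqueDiffOn ℝ I) {m : WithTop ℕ∞}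
    (hF : ContDiffOn ℝ (m + 1) F (I ×ˢ univ)) :
    ContDiffOn ℝ m (fun p : ℝ × P => fderiv ℝ (fun z => F (p.1, z)) p.2) (I ×ˢ univ) := by
  refine ContDiffOn.congr (((hF.fderivWithin (hI.prod uniqueDiffOn_univ) le_rfl).clm_comp
    (contDiffOn_const (c := ContinuousLinearMap.inr ℝ ℝ P)))) ?_
  rintro ⟨τ, z⟩ ⟨hτ, -⟩
  exact (hasFDerivAt_partial hF hτ z).fderiv

end PartialDerivative

/-! ### Estimates on Hamiltonian flows and their generating functions -/

section HamiltonianFlow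

variable {d : ℕ}

/-- The position, as a linear map. -/
def Phase.posL (d : ℕ) : Phase d →L[ℝ] Base d :=
  LinearMap.toContinuousLinearMap
    { toFun := Phase.pos, map_add' := fun _ _ => rfl, map_smul' := fun _ _ => rfl }

/-- The momentum, as a linear map. -/
def Phase.momL (d : ℕ) : Phase d →L[ℝ] Base d :=
  LinearMap.toContinuousLinearMap
    { toFun := Phase.mom, map_add' := fun _ _ => rfl, map_smul' := fun _ _ => rfl }

theorem Phase.pos_sub (z w : Phase d) : Phase.pos (z - w) = Phase.pos z - Phase.pos w := rfl

theorem Phase.mom_sub (z w : Phase d) : Phase.mom (z - w) = Phase.mom z - Phase.mom w := rfl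

theorem Phase.mk_sub (x y x' y' : Base d) :
    Phase.mk x y - Phase.mk x' y' = Phase.mk (x - x') (y - y') := by
  ext (i | i) <;> rfl

theorem Phase.mk_pos_mom (z : Phase d) : Phase.mk (Phase.pos z) (Phase.mom z) = z := by
  ext (i | i) <;> rfl

theorem Phase.norm_mk_sq (x y : Base d) : ‖Phase.mk x y‖ ^ 2 = ‖x‖ ^ 2 + ‖y‖ ^ 2 := by
  rw [EuclideanSpace.norm_sq_eq, EuclideanSpace.norm_sq_eq, EuclideanSpace.norm_sq_eq,
    Fintype.sum_sum_type]
  rfl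

theorem Phase.norm_sq (z : Phase d) : ‖z‖ ^ 2 = ‖Phase.pos z‖ ^ 2 + ‖Phase.mom z‖ ^ 2 := by
  rw [← Phase.norm_mk_sq, Phase.mk_pos_mom]

theorem Phase.norm_pos_le (z : Phase d) : ‖Phase.pos z‖ ≤ ‖z‖ := by
  refine abs_le_of_sq_le_sq' ?_ (norm_nonneg _) |>.2
  rw [Phase.norm_sq z]; nlinarith [sq_nonneg ‖Phase.mom z‖]

theorem Phase.norm_mom_le (z : Phase d) : ‖Phase.mom z‖ ≤ ‖z‖ := by
  refine abs_le_of_sq_le_sq' ?_ (norm_nonneg _) |>.2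
  rw [Phase.norm_sq z]; nlinarith [sq_nonneg ‖Phase.pos z‖]

theorem Phase.norm_mk_le (x y : Base d) : ‖Phase.mk x y‖ ≤ ‖x‖ + ‖y‖ := by
  refine abs_le_of_sq_le_sq' ?_ (by positivity) |>.2
  rw [Phase.norm_mk_sq]; nlinarith [mul_nonneg (norm_nonneg x) (norm_nonneg y)]

/-- The symplectic rotation. -/
def sympRot (d : ℕ) : Phase d →L[ℝ] Phase d :=
  LinearMap.toContinuousLinearMap
    { toFun := fun w => Phase.mk (Phase.mom w) (-Phase.pos w)
      map_add' := fun z w => by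
        ext (i | i)
        · rfl
        · exact neg_add _ _
      map_smul' := fun r w => by
        ext (i | i)
        · rfl
        · exact (mul_neg r _).symm }

theorem norm_sympRot (w : Phase d) : ‖sympRot d w‖ = ‖w‖ := by
  have h : ‖sympRot d w‖ ^ 2 = ‖w‖ ^ 2 := by
    change ‖Phase.mk (Phase.mom w) (-Phase.pos w)‖ ^ 2 = _
    rw [Phase.norm_mk_sq, norm_neg, Phase.norm_sq w, add_comm]
  exact (sq_eq_sq₀ (norm_nonneg _) (norm_nonneg _)).1 h

/-- The field is an isometric image of the differential, so bounds on the derivatives of `h`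
transfer to it with the same constants. -/
theorem hamField_eq (h : Phase d → ℝ) (z : Phase d) :
    hamField h z = sympRot d ((InnerProductSpace.toDual ℝ (Phase d)).symm (fderiv ℝ h z)) := rfl

theorem norm_hamField (h : Phase d → ℝ) (z : Phase d) : ‖hamField h z‖ = ‖fderiv ℝ h z‖ := by
  rw [hamField_eq, norm_sympRot, LinearIsometryEquiv.norm_map]

theorem norm_hamField_sub (h : Phase d → ℝ) (z w : Phase d) :
    ‖hamField h z - hamField h w‖ = ‖fderiv ℝ h z - fderiv ℝ h w‖ := by
  rw [hamField_eq, hamField_eq, ← map_sub, norm_sympRot, ← map_sub, LinearIsometryEquiv.norm_map]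

/-- Uniform regularity of a time-dependent Hamiltonian on `[0, T]`. -/
structure HamRegular (H : ℝ → Phase d → ℝ) (T : ℝ) (c M : ℝ≥0) : Prop where
  continuousOn : ContinuousOn (fun p : ℝ × Phase d => H p.1 p.2) (Icc 0 T ×ˢ univ)
  continuousOn_field :
    ContinuousOn (fun p : ℝ × Phase d => hamField (H p.1) p.2) (Icc 0 T ×ˢ univ)
  lipschitz_field : ∀ τ ∈ Icc 0 T, LipschitzWith c (hamField (H τ))
  norm_field_le : ∀ τ ∈ Icc 0 T, ∀ z, ‖hamField (H τ) z‖ ≤ M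
  lipschitz : ∀ τ ∈ Icc 0 T, LipschitzWith M (H τ)

/-- The first two spatial derivatives vanish off `C` and are continuous on the compact set [0,T] ×
C, hence bounded. -/
theorem exists_hamRegular {T : ℝ} (hT : 0 < T) {H : ℝ → Phase d → ℝ}
    (hH : ContDiffOn ℝ 2 (fun p : ℝ × Phase d => H p.1 p.2) (Icc 0 T ×ˢ univ))
    (hHc : ∃ C : Set (Phase d), IsCompact C ∧ ∀ τ ∈ Icc 0 T, ∀ z ∉ C, H τ z = 0) :
    ∃ M, HamRegular H T (hamBound H T).toNNReal M := by
  obtain ⟨C, hC, hC0⟩ := hHc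
  have hI : UniqueDiffOn ℝ (Icc 0 T) := uniqueDiffOn_Icc hT
  have hH2 : ContDiffOn ℝ (1 + 1) (fun p : ℝ × Phase d => H p.1 p.2) (Icc 0 T ×ˢ univ) := by
    rwa [one_add_one_eq_two]
  have hD1 : ContDiffOn ℝ 1 (fun p : ℝ × Phase d => fderiv ℝ (H p.1) p.2) (Icc 0 T ×ˢ univ) :=
    contDiffOn_fderiv_partial hI hH2
  have hD1' : ContDiffOn ℝ (0 + 1) (fun p : ℝ × Phase d => fderiv ℝ (H p.1) p.2)
      (Icc 0 T ×ˢ univ) := by rwa [zero_add]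
  have hD2 : ContDiffOn ℝ 0 (fun p : ℝ × Phase d => fderiv ℝ (fderiv ℝ (H p.1)) p.2)
      (Icc 0 T ×ˢ univ) := contDiffOn_fderiv_partial hI hD1'
  have hdiff : ∀ τ ∈ Icc 0 T, Differentiable ℝ (H τ) := fun τ hτ z =>
    (hasFDerivAt_partial hH2 hτ z).differentiableAt
  have hdiff' : ∀ τ ∈ Icc 0 T, Differentiable ℝ (fderiv ℝ (H τ)) := fun τ hτ z =>
    (hasFDerivAt_partial hD1' hτ z).differentiableAt
  have hloc : ∀ τ ∈ Icc 0 T, ∀ z ∉ C, fderiv ℝ (H τ) z = 0 := fun τ hτ z hz => by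
    have : H τ =ᶠ[𝓝 z] fun _ => 0 := by
      filter_upwards [hC.isClosed.isOpen_compl.mem_nhds hz] with y hy using hC0 τ hτ y hy
    rw [this.fderiv_eq]; simp
  have hloc' : ∀ τ ∈ Icc 0 T, ∀ z ∉ C, fderiv ℝ (fderiv ℝ (H τ)) z = 0 := fun τ hτ z hz => by
    have : fderiv ℝ (H τ) =ᶠ[𝓝 z] fun _ => 0 := by
      filter_upwards [hC.isClosed.isOpen_compl.mem_nhds hz] with y hy using hloc τ hτ y hy
    rw [this.fderiv_eq]; simp
  have hK : IsCompact (Icc 0 T ×ˢ C) := isCompact_Icc.prod hC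
  have hsub : Icc 0 T ×ˢ C ⊆ Icc 0 T ×ˢ (univ : Set (Phase d)) :=
    prod_mono le_rfl (subset_univ _)
  obtain ⟨M₁, hM₁⟩ := hK.bddAbove_image
    (continuous_norm.comp_continuousOn (hD1.continuousOn.mono hsub))
  obtain ⟨M₂, hM₂⟩ := hK.bddAbove_image
    ((continuous_norm (E := Phase d →L[ℝ] Phase d →L[ℝ] ℝ)).comp_continuousOn (hD2.continuousOn.mono hsub))
  have hb1 : ∀ τ ∈ Icc 0 T, ∀ z, ‖fderiv ℝ (H τ) z‖ ≤ max M₁ 0 := fun τ hτ z => by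
    by_cases hz : z ∈ C
    · exact (hM₁ ⟨(τ, z), ⟨hτ, hz⟩, rfl⟩).trans (le_max_left _ _)
    · rw [hloc τ hτ z hz, norm_zero]; exact le_max_right _ _
  have hb2 : ∀ τ ∈ Icc 0 T, ∀ z, ‖fderiv ℝ (fderiv ℝ (H τ)) z‖ ≤ max M₂ 0 := fun τ hτ z => by
    by_cases hz : z ∈ C
    · exact (hM₂ ⟨(τ, z), ⟨hτ, hz⟩, rfl⟩).trans (le_max_left _ _)
    · rw [hloc' τ hτ z hz]
      exact (norm_zero (E := Phase d →L[ℝ] Phase d →L[ℝ] ℝ)).trans_le (le_max_right _ _)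
  -- Boundedness matters here: the real `sSup` of an unbounded set would be the default value 0.
  have hc : ∀ τ ∈ Icc 0 T, ∀ z, ‖fderiv ℝ (fderiv ℝ (H τ)) z‖ ≤ hamBound H T := fun τ hτ z =>
    le_csSup ⟨max M₂ 0, by rintro _ ⟨τ, hτ, z, rfl⟩; exact hb2 τ hτ z⟩ ⟨τ, hτ, z, rfl⟩
  refine ⟨(max M₁ 0).toNNReal, hH.continuousOn, ?_, fun τ hτ => ?_, fun τ hτ z => ?_,
    fun τ hτ => ?_⟩
  · exact (sympRot d).continuous.comp_continuousOn
      ((InnerProductSpace.toDual ℝ (Phase d)).symm.continuous.comp_continuousOn hD1.continuousOn)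
  · have h := lipschitzWith_of_nnnorm_fderiv_le (𝕜 := ℝ) (C := (hamBound H T).toNNReal)
      (hdiff' τ hτ) fun z => by
        rw [← norm_toNNReal]; exact Real.toNNReal_le_toNNReal (hc τ hτ z)
    refine LipschitzWith.of_dist_le_mul fun z w => ?_
    have := h.dist_le_mul z w
    rwa [dist_eq_norm, norm_hamField_sub, ← dist_eq_norm]
  · rw [norm_hamField, Real.coe_toNNReal _ (le_max_right _ _)]
    exact hb1 τ hτ z
  · refine lipschitzWith_of_nnnorm_fderiv_le (𝕜 := ℝ) (hdiff τ hτ) fun z => ?_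
    rw [← norm_toNNReal]; exact Real.toNNReal_le_toNNReal (hb1 τ hτ z)

theorem isHamTrajectory_hamFlow {H : ℝ → Phase d → ℝ} {T s : ℝ} {z : Phase d}
    (hex : ∃ γ, IsHamTrajectory H T s z γ) :
    IsHamTrajectory H T s z fun τ => hamFlow H T s τ z := by
  have e : (fun τ => hamFlow H T s τ z) = hex.choose := by
    funext τ
    rw [hamFlow, dif_pos hex]
  rw [e]
  exact hex.choose_spec

namespace HamRegular

variable {H : ℝ → Phase d → ℝ} {T : ℝ} {c M : ℝ≥0}

theorem continuousOn_field_comp (h : HamRegular H T c M) {γ : ℝ → Phase d}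
    (hγ : ContinuousOn γ (Icc 0 T)) : ContinuousOn (fun τ => hamField (H τ) (γ τ)) (Icc 0 T) :=
  ContinuousOn.comp (g := fun p : ℝ × Phase d => hamField (H p.1) p.2) (f := fun τ => (τ, γ τ))
    h.continuousOn_field (continuousOn_id.prodMk hγ) fun _ hτ => ⟨hτ, trivial⟩

theorem isHamTrajectory (h : HamRegular H T c M) {s : ℝ} (hs : s ∈ Icc 0 T) (z : Phase d) :
    IsHamTrajectory H T s z fun τ => hamFlow H T s τ z := by
  have hT : 0 ≤ T := hs.1.trans hs.2
  -- The field is bounded by M, so solutions stay within MT of `z`; a ball of that radius gives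
  -- existence on the whole of [0,T], on both sides of s.
  have hpl : IsPicardLindelof (fun τ => hamField (H τ)) (⟨s, hs⟩ : Icc 0 T) z
      (M * T.toNNReal) 0 M c :=
    { lipschitzOnWith := fun τ hτ => (h.lipschitz_field τ hτ).lipschitzOnWith
      continuousOn := fun x _ => h.continuousOn_field_comp continuousOn_const
      norm_le := fun τ hτ x _ => h.norm_field_le τ hτ x
      mul_max_le := by
        push_cast
        rw [Real.coe_toNNReal _ hT, sub_zero, sub_zero]
        exact mul_le_mul_of_nonneg_left (max_le (by linarith [hs.1]) hs.2) M.coe_nonneg }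
  obtain ⟨γ, hγ⟩ := hpl.exists_eq_forall_mem_Icc_hasDerivWithinAt₀
  exact isHamTrajectory_hamFlow ⟨γ, hγ⟩

theorem hamFlow_self (h : HamRegular H T c M) {s : ℝ} (hs : s ∈ Icc 0 T) (z : Phase d) :
    hamFlow H T s s z = z := (h.isHamTrajectory hs z).1

theorem hasDerivWithinAt_hamFlow (h : HamRegular H T c M) {s τ : ℝ} (hs : s ∈ Icc 0 T)
    (hτ : τ ∈ Icc 0 T) (z : Phase d) :
    HasDerivWithinAt (fun τ => hamFlow H T s τ z) (hamField (H τ) (hamFlow H T s τ z))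
      (Icc 0 T) τ := (h.isHamTrajectory hs z).2 τ hτ

theorem continuousOn_hamFlow (h : HamRegular H T c M) {s : ℝ} (hs : s ∈ Icc 0 T) (z : Phase d) :
    ContinuousOn (fun τ => hamFlow H T s τ z) (Icc 0 T) := fun _ hτ =>
  (h.hasDerivWithinAt_hamFlow hs hτ z).continuousWithinAt

theorem hasDerivWithinAt_hamFlow_Ici (h : HamRegular H T c M) {s t τ : ℝ} (hs : s ∈ Icc 0 T)
    (ht : t ≤ T) (hτ : τ ∈ Ico s t) (z : Phase d) :
    HasDerivWithinAt (fun τ => hamFlow H T s τ z) (hamField (H τ) (hamFlow H T s τ z))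
      (Ici τ) τ := by
  refine (h.hasDerivWithinAt_hamFlow hs ⟨hs.1.trans hτ.1, hτ.2.le.trans ht⟩ z).mono_of_mem_nhdsWithin
    (mem_of_superset (Icc_mem_nhdsGE (hτ.2.trans_le ht)) ?_)
  exact Icc_subset_Icc_left (hs.1.trans hτ.1)

theorem norm_hamFlow_sub_self_le (h : HamRegular H T c M) {s τ : ℝ} (hs : 0 ≤ s) (hsτ : s ≤ τ)
    (hτ : τ ≤ T) (z : Phase d) : ‖hamFlow H T s τ z - z‖ ≤ M * (τ - s) := by
  have hs' : s ∈ Icc 0 T := ⟨hs, hsτ.trans hτ⟩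
  have := norm_image_sub_le_of_norm_deriv_right_le_segment (a := s) (b := τ) (C := M)
    ((h.continuousOn_hamFlow hs' z).mono (Icc_subset_Icc hs hτ))
    (fun r hr => h.hasDerivWithinAt_hamFlow_Ici hs' hτ hr z)
    (fun r hr => h.norm_field_le r ⟨hs.trans hr.1, hr.2.le.trans hτ⟩ _) τ ⟨hsτ, le_rfl⟩
  rwa [h.hamFlow_self hs'] at this

/-- Gronwall's inequality for the difference between the flow and the identity. -/
theorem norm_hamFlow_sub_sub_le (h : HamRegular H T c M) {s τ : ℝ} (hs : 0 ≤ s) (hsτ : s ≤ τ)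
    (hτ : τ ≤ T) (z w : Phase d) :
    ‖(hamFlow H T s τ z - hamFlow H T s τ w) - (z - w)‖ ≤
      (Real.exp (c * (τ - s)) - 1) * ‖z - w‖ := by
  have hs' : s ∈ Icc 0 T := ⟨hs, hsτ.trans hτ⟩
  -- Subtracting z - w makes the initial value 0 and turns the Lipschitz bound into growth rate c
  -- with forcing c‖z - w‖; hence the factor e^{c(τ-s)} - 1.
  have key := norm_le_gronwallBound_of_norm_deriv_right_le (a := s) (b := τ) (δ := 0) (K := c)
    (ε := c * ‖z - w‖) (f := fun r => (hamFlow H T s r z - hamFlow H T s r w) - (z - w))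
    (f' := fun r => hamField (H r) (hamFlow H T s r z) - hamField (H r) (hamFlow H T s r w))
    ((((h.continuousOn_hamFlow hs' z).sub (h.continuousOn_hamFlow hs' w)).sub
      continuousOn_const).mono (Icc_subset_Icc hs hτ))
    (fun r hr => ((h.hasDerivWithinAt_hamFlow_Ici hs' hτ hr z).sub
      (h.hasDerivWithinAt_hamFlow_Ici hs' hτ hr w)).sub_const _)
    (by simp [h.hamFlow_self hs'])
    (fun r hr => by
      have h1 := (h.lipschitz_field r ⟨hs.trans hr.1, hr.2.le.trans hτ⟩).dist_le_mul
        (hamFlow H T s r z) (hamFlow H T s r w)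
      rw [dist_eq_norm, dist_eq_norm] at h1
      refine h1.trans ?_
      rw [← mul_add]
      gcongr
      exact norm_le_norm_sub_add _ _) τ ⟨hsτ, le_rfl⟩
  refine key.trans_eq ?_
  rcases eq_or_ne (c : ℝ) 0 with hc | hc
  · simp [hc, gronwallBound_K0]
  · rw [gronwallBound_of_K_ne_0 hc]
    field_simp
    ring

theorem norm_hamFlow_sub_le (h : HamRegular H T c M) {s τ : ℝ} (hs : 0 ≤ s) (hsτ : s ≤ τ)
    (hτ : τ ≤ T) (z w : Phase d) :
    ‖hamFlow H T s τ z - hamFlow H T s τ w‖ ≤ Real.exp (c * T) * ‖z - w‖ := by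
  have h1 := h.norm_hamFlow_sub_sub_le hs hsτ hτ z w
  have h2 := norm_le_norm_sub_add (hamFlow H T s τ z - hamFlow H T s τ w) (z - w)
  have h3 : Real.exp (c * (τ - s)) * ‖z - w‖ ≤ Real.exp (c * T) * ‖z - w‖ := by
    gcongr
    linarith
  linarith

/-- The momentum is unchanged by α, so α minus the identity is the position part of the flow minus
the identity. -/
theorem norm_alphaMap_sub_sub_le (h : HamRegular H T c M) {s t : ℝ} (hs : 0 ≤ s) (hst : s ≤ t)
    (ht : t ≤ T) (z w : Phase d) :
    ‖(alphaMap H T s t z - alphaMap H T s t w) - (z - w)‖ ≤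
      (Real.exp (c * (t - s)) - 1) * ‖z - w‖ := by
  have e : (alphaMap H T s t z - alphaMap H T s t w) - (z - w) =
      Phase.mk (Phase.pos ((hamFlow H T s t z - hamFlow H T s t w) - (z - w))) 0 := by
    ext (i | i)
    · rfl
    · exact sub_self _
  rw [e]
  refine (Phase.norm_mk_le _ _).trans ?_
  rw [norm_zero, add_zero]
  exact (Phase.norm_pos_le _).trans (h.norm_hamFlow_sub_sub_le hs hst ht z w)

/-- This is where ln 2 enters: it makes α minus the identity a contraction. -/
theorem exp_sub_one_lt_one {s t : ℝ} (hc : (t - s) * c < Real.log 2) :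
    Real.exp (c * (t - s)) - 1 < 1 := by
  have : Real.exp (c * (t - s)) < 2 := by
    rw [← Real.lt_log_iff_exp_lt two_pos, mul_comm]
    exact hc
  linarith

/-- Solving α(z) = p means finding a fixed point of the contraction z ↦ p - (α(z) - z). -/
theorem surjective_alphaMap (h : HamRegular H T c M) {s t : ℝ} (hs : 0 ≤ s) (hst : s ≤ t)
    (ht : t ≤ T) (hc : (t - s) * c < Real.log 2) : Function.Surjective (alphaMap H T s t) := by
  intro p
  have hk0 : 0 ≤ Real.exp (c * (t - s)) - 1 := by
    have := Real.one_le_exp (mul_nonneg c.coe_nonneg (sub_nonneg.2 hst))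
    linarith
  have hcontr : ContractingWith (Real.exp (c * (t - s)) - 1).toNNReal
      fun z => p - (alphaMap H T s t z - z) := by
    refine ⟨?_, LipschitzWith.of_dist_le_mul fun z w => ?_⟩
    · rw [Real.toNNReal_lt_one]; exact exp_sub_one_lt_one hc
    · rw [Real.coe_toNNReal _ hk0, dist_eq_norm, dist_eq_norm]
      refine le_trans (le_of_eq ?_) (h.norm_alphaMap_sub_sub_le hs hst ht z w)
      rw [← norm_neg]
      congr 1
      abel
  have hz := hcontr.fixedPoint_isFixedPt
  refine ⟨ContractingWith.fixedPoint _ hcontr, ?_⟩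
  generalize ContractingWith.fixedPoint _ hcontr = z at hz
  have hz' : p - (alphaMap H T s t z - z) = z := hz
  rw [sub_eq_iff_eq_add, add_sub_cancel] at hz'
  exact hz'.symm

theorem alphaMap_invFun (h : HamRegular H T c M) {s t : ℝ} (hs : 0 ≤ s) (hst : s ≤ t)
    (ht : t ≤ T) (hc : (t - s) * c < Real.log 2) (p : Phase d) :
    alphaMap H T s t (Function.invFun (alphaMap H T s t) p) = p :=
  Function.rightInverse_invFun (h.surjective_alphaMap hs hst ht hc) p

theorem norm_invFun_alphaMap_sub_le (h : HamRegular H T c M) {s t : ℝ} (hs : 0 ≤ s)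
    (hst : s ≤ t) (ht : t ≤ T) (hc : (t - s) * c < Real.log 2) (p q : Phase d) :
    ‖Function.invFun (alphaMap H T s t) p - Function.invFun (alphaMap H T s t) q‖ ≤
      (2 - Real.exp (c * (t - s)))⁻¹ * ‖p - q‖ := by
  have h1 := h.norm_alphaMap_sub_sub_le hs hst ht (Function.invFun (alphaMap H T s t) p)
    (Function.invFun (alphaMap H T s t) q)
  rw [h.alphaMap_invFun hs hst ht hc, h.alphaMap_invFun hs hst ht hc] at h1
  have h2 := norm_sub_norm_le (Function.invFun (alphaMap H T s t) p -
    Function.invFun (alphaMap H T s t) q) (p - q)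
  rw [norm_sub_rev] at h1
  have := exp_sub_one_lt_one hc
  rw [← div_eq_inv_mul, le_div_iff₀ (by linarith)]
  linarith

/-- The integrand of the generating function, along the trajectory issued from `z`. -/
def action (H : ℝ → Phase d → ℝ) (T s : ℝ) (z : Phase d) (τ : ℝ) : ℝ :=
  inner ℝ (Phase.mom (hamFlow H T s τ z - z)) (Phase.pos (hamField (H τ) (hamFlow H T s τ z)))
    - H τ (hamFlow H T s τ z)

theorem continuousOn_action (h : HamRegular H T c M) {s : ℝ} (hs : s ∈ Icc 0 T) (z : Phase d) :
    ContinuousOn (action H T s z) (Icc 0 T) := by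
  have h1 := h.continuousOn_hamFlow hs z
  have h2 : ContinuousOn (fun τ => H τ (hamFlow H T s τ z)) (Icc 0 T) :=
    ContinuousOn.comp (g := fun p : ℝ × Phase d => H p.1 p.2)
      (f := fun τ => (τ, hamFlow H T s τ z)) h.continuousOn (continuousOn_id.prodMk h1)
      fun τ hτ => ⟨hτ, trivial⟩
  refine ContinuousOn.sub (ContinuousOn.inner ?_ ?_) h2
  · exact (Phase.momL d).continuous.comp_continuousOn (h1.sub continuousOn_const)
  · exact (Phase.posL d).continuous.comp_continuousOn (h.continuousOn_field_comp h1)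

/-- The action is Lipschitz in the initial point, uniformly, because it pairs two factors that are
both bounded and Lipschitz: the displacement Y - y is bounded by MT even though Y is not. -/
theorem abs_action_sub_le (h : HamRegular H T c M) {s τ : ℝ} (hs : 0 ≤ s) (hsτ : s ≤ τ)
    (hτ : τ ≤ T) (z w : Phase d) :
    |action H T s z τ - action H T s w τ| ≤
      ((Real.exp (c * T) + 1) * M + M * T * (c * Real.exp (c * T)) + M * Real.exp (c * T)) *
        ‖z - w‖ := by
  have hτ' : τ ∈ Icc 0 T := ⟨hs.trans hsτ, hτ⟩
  have hfl := h.norm_hamFlow_sub_le hs hsτ hτ z w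
  set A := Real.exp (c * T)
  set u := hamFlow H T s τ z with hu
  set v := hamFlow H T s τ w with hv
  have e : action H T s z τ - action H T s w τ =
      inner ℝ (Phase.mom ((u - z) - (v - w))) (Phase.pos (hamField (H τ) u)) +
      inner ℝ (Phase.mom (v - w)) (Phase.pos (hamField (H τ) u - hamField (H τ) v)) -
      (H τ u - H τ v) := by
    rw [Phase.mom_sub (u - z), Phase.pos_sub, inner_sub_left, inner_sub_right, action, action]
    ring
  rw [e]
  have h1 : |inner ℝ (Phase.mom ((u - z) - (v - w))) (Phase.pos (hamField (H τ) u))| ≤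
      (A + 1) * ‖z - w‖ * M := by
    refine (abs_real_inner_le_norm _ _).trans (mul_le_mul ((Phase.norm_mom_le _).trans ?_)
      ((Phase.norm_pos_le _).trans (h.norm_field_le τ hτ' u)) (norm_nonneg _) (by positivity))
    calc ‖(u - z) - (v - w)‖ = ‖(u - v) - (z - w)‖ := by congr 1; abel
      _ ≤ ‖u - v‖ + ‖z - w‖ := norm_sub_le _ _
      _ ≤ (A + 1) * ‖z - w‖ := by linarith
  have h2 : |inner ℝ (Phase.mom (v - w)) (Phase.pos (hamField (H τ) u - hamField (H τ) v))| ≤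
      (M * T) * (c * (A * ‖z - w‖)) := by
    have hT : 0 ≤ T := hτ'.1.trans hτ'.2
    refine (abs_real_inner_le_norm _ _).trans (mul_le_mul ((Phase.norm_mom_le _).trans ?_)
      ((Phase.norm_pos_le _).trans ?_) (norm_nonneg _) (by positivity))
    · refine (h.norm_hamFlow_sub_self_le hs hsτ hτ w).trans ?_
      gcongr
      linarith
    · have := (h.lipschitz_field τ hτ').dist_le_mul u v
      rw [dist_eq_norm, dist_eq_norm] at this
      exact this.trans (by gcongr)
  have h3 : |H τ u - H τ v| ≤ M * (A * ‖z - w‖) := by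
    have := (h.lipschitz τ hτ').dist_le_mul u v
    rw [dist_eq_norm, dist_eq_norm, Real.norm_eq_abs] at this
    exact this.trans (by gcongr)
  refine (abs_sub _ _).trans ((add_le_add (abs_add_le _ _) le_rfl).trans ?_)
  calc _ ≤ (A + 1) * ‖z - w‖ * M + (M * T) * (c * (A * ‖z - w‖)) + M * (A * ‖z - w‖) := by
        gcongr
    _ = _ := by ring

/-- Since α preserves the momentum, `y` is the initial momentum of the trajectory, and Hamilton's
equation replaces the derivative of the position. -/
theorem genFun_eq (h : HamRegular H T c M) {s t : ℝ} (hT : 0 < T) (hs : 0 ≤ s) (hst : s ≤ t)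
    (ht : t ≤ T) (hc : (t - s) * c < Real.log 2) (X y : Base d) :
    genFun H T s t X y =
      ∫ τ in s..t, action H T s (Function.invFun (alphaMap H T s t) (Phase.mk X y)) τ := by
  rw [genFun]
  set z := Function.invFun (alphaMap H T s t) (Phase.mk X y) with hz
  have hy : Phase.mom z = y := by
    have := congrArg Phase.mom (h.alphaMap_invFun hs hst ht hc (Phase.mk X y))
    exact this
  refine intervalIntegral.integral_congr fun τ hτ => ?_
  rw [uIcc_of_le hst] at hτ
  have hτ' : τ ∈ Icc 0 T := ⟨hs.trans hτ.1, hτ.2.trans ht⟩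
  have hd : HasDerivWithinAt (fun τ' => Phase.pos (hamFlow H T s τ' z))
      (Phase.pos (hamField (H τ) (hamFlow H T s τ z))) (Icc 0 T) τ :=
    (Phase.posL d).hasFDerivAt.comp_hasDerivWithinAt τ
      (h.hasDerivWithinAt_hamFlow ⟨hs, hst.trans ht⟩ hτ' z)
  change inner ℝ _ _ - _ = _
  rw [hd.derivWithin (uniqueDiffOn_Icc hT τ hτ'), ← hy]
  rfl

/-- The generating function is globally Lipschitz. -/
theorem exists_lipschitz_genFun (h : HamRegular H T c M) {s t : ℝ} (hT : 0 < T) (hs : 0 ≤ s)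
    (hst : s ≤ t) (ht : t ≤ T) (hc : (t - s) * c < Real.log 2) :
    ∃ G : ℝ, 0 ≤ G ∧ ∀ X y X' y', |genFun H T s t X y - genFun H T s t X' y'| ≤
      G * (‖X - X'‖ + ‖y - y'‖) := by
  have hlt := exp_sub_one_lt_one hc
  have hpos : 0 < 2 - Real.exp (c * (t - s)) := by linarith
  set G := (Real.exp (c * T) + 1) * M + M * T * (c * Real.exp (c * T)) + M * Real.exp (c * T)
  have hG : 0 ≤ G := by positivity
  refine ⟨G * (2 - Real.exp (c * (t - s)))⁻¹ * (t - s),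
    mul_nonneg (by positivity) (sub_nonneg.2 hst), fun X y X' y' => ?_⟩
  have hs' : s ∈ Icc 0 T := ⟨hs, hst.trans ht⟩
  have hint : ∀ z, IntervalIntegrable (action H T s z) volume s t := fun z =>
    ((h.continuousOn_action hs' z).mono (by
      rw [uIcc_of_le hst]; exact Icc_subset_Icc hs ht)).intervalIntegrable
  rw [h.genFun_eq hT hs hst ht hc, h.genFun_eq hT hs hst ht hc,
    ← intervalIntegral.integral_sub (hint _) (hint _), ← Real.norm_eq_abs]
  have hinv := h.norm_invFun_alphaMap_sub_le hs hst ht hc (Phase.mk X y) (Phase.mk X' y')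
  rw [Phase.mk_sub] at hinv
  have hmk := Phase.norm_mk_le (X - X') (y - y')
  refine (intervalIntegral.norm_integral_le_of_norm_le_const (C := G *
    ((2 - Real.exp (c * (t - s)))⁻¹ * (‖X - X'‖ + ‖y - y'‖))) fun τ hτ => ?_).trans_eq ?_
  · rw [uIoc_of_le hst] at hτ
    refine (h.abs_action_sub_le hs hτ.1.le (hτ.2.trans ht) _ _).trans ?_
    refine mul_le_mul_of_nonneg_left (hinv.trans ?_) hG
    gcongr
  · rw [abs_of_nonneg (sub_nonneg.2 hst)]
    ring

end HamRegular

end HamiltonianFlow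

/-! ### The generating family -/

section GeneratingFamily

variable {d N : ℕ}

/-- The point of the fibre with given positions and momenta. -/
def Fibre.mk (p q : Fin N → Base d) : Fibre d N :=
  WithLp.toLp 2 fun k => Sum.elim (p k.1) (q k.1) k.2

theorem Fibre.pos_mk (p q : Fin N → Base d) (i : Fin N) : Fibre.pos (Fibre.mk p q) i = p i := rfl

theorem Fibre.mom_mk (p q : Fin N → Base d) (i : Fin N) : Fibre.mom (Fibre.mk p q) i = q i := rfl

theorem Fibre.sum_norm_sq (η : Fibre d N) :
    ‖η‖ ^ 2 = ∑ i, (‖Fibre.pos η i‖ ^ 2 + ‖Fibre.mom η i‖ ^ 2) := by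
  rw [EuclideanSpace.norm_sq_eq, Fintype.sum_prod_type]
  refine Finset.sum_congr rfl fun i _ => ?_
  rw [EuclideanSpace.norm_sq_eq, EuclideanSpace.norm_sq_eq, Fintype.sum_sum_type]
  rfl

theorem Fibre.sq_add_sq_le (η : Fibre d N) (i : Fin N) :
    ‖Fibre.pos η i‖ ^ 2 + ‖Fibre.mom η i‖ ^ 2 ≤ ‖η‖ ^ 2 := by
  rw [Fibre.sum_norm_sq]
  exact Finset.single_le_sum (f := fun i => ‖Fibre.pos η i‖ ^ 2 + ‖Fibre.mom η i‖ ^ 2)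
    (fun _ _ => by positivity) (Finset.mem_univ i)

theorem Fibre.norm_pos_le (η : Fibre d N) (i : Fin N) : ‖Fibre.pos η i‖ ≤ ‖η‖ := by
  refine abs_le_of_sq_le_sq' ?_ (norm_nonneg _) |>.2
  linarith [Fibre.sq_add_sq_le η i, sq_nonneg ‖Fibre.mom η i‖]

theorem Fibre.norm_mom_le (η : Fibre d N) (i : Fin N) : ‖Fibre.mom η i‖ ≤ ‖η‖ := by
  refine abs_le_of_sq_le_sq' ?_ (norm_nonneg _) |>.2
  linarith [Fibre.sq_add_sq_le η i, sq_nonneg ‖Fibre.pos η i‖]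

theorem node_last (x : Base d) (η : Fibre d N) : node x η (Fin.last N) = x := by
  simp [node]

theorem node_castSucc (x : Base d) (η : Fibre d N) (i : Fin N) :
    node x η i.castSucc = Fibre.pos η i := by
  simp [node]

theorem node_sub (x x' : Base d) (η η' : Fibre d N) (j : Fin (N + 1)) :
    node x η j - node x' η' j = node (x - x') (η - η') j := by
  refine Fin.lastCases ?_ (fun i => ?_) j
  · simp only [node_last]
  · simp only [node_castSucc]; rfl

theorem norm_node_le (x : Base d) (η : Fibre d N) (j : Fin (N + 1)) :
    ‖node x η j‖ ≤ ‖x‖ + ‖η‖ := by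
  refine Fin.lastCases ?_ (fun i => ?_) j
  · rw [node_last]; linarith [norm_nonneg η]
  · rw [node_castSucc]; linarith [norm_nonneg x, Fibre.norm_pos_le η i]

theorem quadForm_apply (η : Fibre d N) : quadForm d N η =
    ∑ i : Fin N, inner ℝ (node 0 η i.succ - node 0 η i.castSucc) (Fibre.mom η i) := rfl

theorem quadDeriv_quadForm_apply (η η' : Fibre d N) : quadDeriv (quadForm d N) η η' =
    ∑ i : Fin N, inner ℝ (node 0 η i.succ - node 0 η i.castSucc) (Fibre.mom η' i) +
      ∑ i : Fin N, inner ℝ (node 0 η' i.succ - node 0 η' i.castSucc) (Fibre.mom η i) := by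
  exact LinearMap.BilinMap.polar_toQuadraticMap _ _

/-- Positions obtained by summing backwards from the end node 0: their successive increments are the
prescribed vectors `q`. -/
theorem node_mk_neg_sum (q : Fin N → Base d) (j : Fin (N + 1)) :
    node 0 (Fibre.mk (fun k => -∑ i ∈ Finset.univ.filter (k ≤ ·), q i) 0) j =
      -∑ i ∈ Finset.univ.filter (fun i : Fin N => j ≤ i.castSucc), q i := by
  refine Fin.lastCases ?_ (fun k => ?_) j
  · rw [node_last, Finset.filter_false_of_mem, Finset.sum_empty, neg_zero]
    exact fun i _ => not_le.2 (Fin.castSucc_lt_last i)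
  · rw [node_castSucc, Fibre.pos_mk]
    rfl

/-- Testing against momenta equal to the increments of positions kills these increments, hence all
positions since the last node is 0. Testing against positions whose increments are the momenta then
kills the momenta. -/
theorem quadDeriv_quadForm_injective {η : Fibre d N} (h : quadDeriv (quadForm d N) η = 0) :
    η = 0 := by
  have h1 : ∀ i : Fin N, node 0 η i.succ - node 0 η i.castSucc = 0 := by
    have h2 : quadDeriv (quadForm d N) η
        (Fibre.mk 0 fun i => node 0 η i.succ - node 0 η i.castSucc) = 0 := by rw [h]; rfl
    have h3 : ∀ q : Fin N → Base d, ∀ j, node 0 (Fibre.mk 0 q) j = 0 := fun q j => by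
      refine Fin.lastCases ?_ (fun i => ?_) j
      · rw [node_last]
      · rw [node_castSucc]; rfl
    rw [quadDeriv_quadForm_apply] at h2
    simp only [h3, sub_zero, inner_zero_left, Finset.sum_const_zero, add_zero, Fibre.mom_mk,
      real_inner_self_eq_norm_sq] at h2
    intro i
    have := (Finset.sum_eq_zero_iff_of_nonneg fun i _ => sq_nonneg _).1 h2 i (Finset.mem_univ i)
    exact norm_eq_zero.1 (pow_eq_zero_iff two_ne_zero |>.1 this)
  have hnode : ∀ j : Fin (N + 1), node 0 η j = 0 := fun j => by
    induction j using Fin.reverseInduction with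
    | last => rw [node_last]
    | cast i ih =>
      have := h1 i
      rwa [ih, zero_sub, neg_eq_zero] at this
  have h4 : ∀ i, Fibre.mom η i = 0 := by
    set η' : Fibre d N :=
      Fibre.mk (fun k => -∑ i ∈ Finset.univ.filter (k ≤ ·), Fibre.mom η i) 0 with hη'
    have h2 : quadDeriv (quadForm d N) η η' = 0 := by rw [h]; rfl
    have h3 : ∀ i : Fin N, node 0 η' i.succ - node 0 η' i.castSucc = Fibre.mom η i := fun i => by
      rw [hη', node_mk_neg_sum, node_mk_neg_sum]
      have e : Finset.univ.filter (fun k : Fin N => i.castSucc ≤ k.castSucc) =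
          insert i (Finset.univ.filter (fun k : Fin N => i.succ ≤ k.castSucc)) := by
        ext k
        simp only [Finset.mem_filter, Finset.mem_univ, true_and, Finset.mem_insert, Fin.le_def,
          Fin.val_castSucc, Fin.val_succ, Fin.ext_iff]
        omega
      rw [e, Finset.sum_insert (by simp [Fin.le_def])]
      abel
    rw [quadDeriv_quadForm_apply] at h2
    simp only [h3, hnode, sub_zero, inner_zero_left, Finset.sum_const_zero, zero_add,
      real_inner_self_eq_norm_sq] at h2
    intro i
    have := (Finset.sum_eq_zero_iff_of_nonneg fun i _ => sq_nonneg _).1 h2 i (Finset.mem_univ i)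
    exact norm_eq_zero.1 (pow_eq_zero_iff two_ne_zero |>.1 this)
  have h5 : ∀ i, Fibre.pos η i = 0 := fun i => by rw [← node_castSucc 0]; exact hnode _
  have h6 : ‖η‖ ^ 2 = 0 := by
    rw [Fibre.sum_norm_sq]
    exact Finset.sum_eq_zero fun i _ => by rw [h4, h5]; simp
  exact norm_eq_zero.1 (pow_eq_zero_iff two_ne_zero |>.1 h6)

theorem exists_quadForm_nondegenerate (d N : ℕ) :
    ∃ c > 0, ∀ η : Fibre d N, c * ‖η‖ ≤ ‖quadDeriv (quadForm d N) η‖ := by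
  obtain ⟨K, hK, h⟩ := LinearMap.exists_antilipschitzWith
    (quadDeriv (quadForm d N)).toLinearMap
    (LinearMap.ker_eq_bot'.2 fun η hη => quadDeriv_quadForm_injective hη)
  have hK' : (0 : ℝ) < K := hK
  refine ⟨(K : ℝ)⁻¹, by positivity, fun η => ?_⟩
  rw [inv_mul_le_iff₀ hK']
  have := h.le_mul_dist η 0
  rw [map_zero, dist_zero_right, dist_zero_right] at this
  exact this

theorem fderiv_quadForm (η : Fibre d N) :
    fderiv ℝ (fun η' => quadForm d N η') η = quadDeriv (quadForm d N) η :=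
  (hasFDerivAt_quadForm _ η).fderiv

/-- Nodes are affine in (x, η), so subtracting `Q` cancels every bilinear term except x · y_{N-1},
which is linear in η. -/
theorem genFamily_sub_quadForm (H : ℝ → Phase d → ℝ) (T : ℝ) (v : Base d → ℝ)
    (t : Fin (N + 1) → ℝ) (x : Base d) (η : Fibre d N) :
    genFamily H T v t x η - quadForm d N η = v (node x η 0)
      + ∑ i : Fin N, genFun H T (t i.castSucc) (t i.succ) (node x η i.succ) (Fibre.mom η i)
      + ∑ i : Fin N, inner ℝ (node x (0 : Fibre d N) i.succ - node x (0 : Fibre d N) i.castSucc)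
          (Fibre.mom η i) := by
  have e : ∀ j, node x (0 : Fibre d N) j = node x η j - node 0 η j := fun j => by
    rw [node_sub, sub_zero, sub_self]
  rw [genFamily, quadForm_apply, add_sub_assoc, ← Finset.sum_sub_distrib]
  congr 1
  refine Finset.sum_congr rfl fun i _ => ?_
  rw [e, e, ← inner_sub_left]
  congr 1
  abel

/-- The difference between the generating family and its quadratic part is Lipschitz in the fibre
variable, locally uniformly in the base. -/
theorem exists_lipschitz_genFamily_sub {H : ℝ → Phase d → ℝ} {T : ℝ} {c M : ℝ≥0}
    (h : HamRegular H T c M) (hT : 0 < T) {v : Base d → ℝ} {Lv : ℝ≥0} (hv : LipschitzWith Lv v)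
    {t : Fin (N + 1) → ℝ} (ht : Monotone t) (ht0 : 0 ≤ t 0) (htT : t (Fin.last N) ≤ T)
    (hstep : ∀ i : Fin N, (t i.succ - t i.castSucc) * c < Real.log 2) :
    ∃ A : ℝ≥0, ∀ (ρ : ℝ≥0) (x : Base d), ‖x‖ ≤ ρ →
      LipschitzWith (A * (1 + ρ)) (fun η => genFamily H T v t x η - quadForm d N η) ∧
      |genFamily H T v t x 0 - quadForm d N 0| ≤ A * (1 + ρ) := by
  choose G hG0 hG using fun i : Fin N => h.exists_lipschitz_genFun hT
    (ht0.trans (ht (Fin.zero_le _))) (ht (Fin.castSucc_le_succ i))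
    ((ht (Fin.le_last _)).trans htT) (hstep i)
  have hv' : ∀ a b, |v a - v b| ≤ Lv * ‖a - b‖ := fun a b => by
    have := hv.dist_le_mul a b
    rwa [dist_eq_norm, dist_eq_norm, Real.norm_eq_abs] at this
  set B : ℝ := |v 0| + ∑ i : Fin N, |genFun H T (t i.castSucc) (t i.succ) 0 0| with hB
  have hB0 : 0 ≤ B := by positivity
  -- The constant collects the Lipschitz constants of v and of the generating functions, the linear
  -- term, whose slope grows with |x| ≤ ρ (whence the factor 1 + ρ), and the values at the origin.
  set A : ℝ := Lv + ∑ i, G i * 2 + N * 2 + B with hA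
  have hGs : 0 ≤ ∑ i, G i * 2 := Finset.sum_nonneg fun i _ => mul_nonneg (hG0 i) zero_le_two
  have hA0 : 0 ≤ A := by positivity
  refine ⟨A.toNNReal, fun ρ x hx => ⟨LipschitzWith.of_dist_le_mul fun η η' => ?_, ?_⟩⟩
  · push_cast
    rw [Real.coe_toNNReal _ hA0, Real.dist_eq, dist_eq_norm, genFamily_sub_quadForm,
      genFamily_sub_quadForm]
    set δ := ‖η - η'‖ with hδ
    have hδ0 : 0 ≤ δ := norm_nonneg _
    have hnode : ∀ j, ‖node x η j - node x η' j‖ ≤ δ := fun j => by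
      rw [node_sub, sub_self]
      simpa using norm_node_le 0 (η - η') j
    have hmom : ∀ i, ‖Fibre.mom η i - Fibre.mom η' i‖ ≤ δ := fun i => Fibre.norm_mom_le (η - η') i
    have e1 : |v (node x η 0) - v (node x η' 0)| ≤ Lv * δ :=
      (hv' _ _).trans (mul_le_mul_of_nonneg_left (hnode 0) Lv.coe_nonneg)
    have e2 : |∑ i : Fin N, genFun H T (t i.castSucc) (t i.succ) (node x η i.succ) (Fibre.mom η i)
        - ∑ i : Fin N, genFun H T (t i.castSucc) (t i.succ) (node x η' i.succ) (Fibre.mom η' i)| ≤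
        (∑ i, G i * 2) * δ := by
      rw [← Finset.sum_sub_distrib, Finset.sum_mul]
      refine (Finset.abs_sum_le_sum_abs _ _).trans (Finset.sum_le_sum fun i _ => ?_)
      refine (hG i _ _ _ _).trans ?_
      rw [mul_assoc]
      exact mul_le_mul_of_nonneg_left (by linarith [hnode i.succ, hmom i]) (hG0 i)
    have e3 : |∑ i : Fin N, inner ℝ (node x (0 : Fibre d N) i.succ
          - node x (0 : Fibre d N) i.castSucc) (Fibre.mom η i)
        - ∑ i : Fin N, inner ℝ (node x (0 : Fibre d N) i.succ
          - node x (0 : Fibre d N) i.castSucc) (Fibre.mom η' i)| ≤ N * 2 * ρ * δ := by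
      rw [← Finset.sum_sub_distrib]
      have : ∀ i ∈ (Finset.univ : Finset (Fin N)), |inner ℝ (node x (0 : Fibre d N) i.succ
          - node x (0 : Fibre d N) i.castSucc) (Fibre.mom η i) - inner ℝ
          (node x (0 : Fibre d N) i.succ - node x (0 : Fibre d N) i.castSucc) (Fibre.mom η' i)| ≤
          2 * ρ * δ := fun i _ => by
        rw [← inner_sub_right]
        refine (abs_real_inner_le_norm _ _).trans (mul_le_mul ?_ (hmom i) (norm_nonneg _)
          (by positivity))
        have h1 := norm_node_le x (0 : Fibre d N) i.succ
        have h2 := norm_node_le x (0 : Fibre d N) i.castSucc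
        rw [norm_zero, add_zero] at h1 h2
        exact (norm_sub_le _ _).trans (by linarith)
      refine (Finset.abs_sum_le_sum_abs _ _).trans ((Finset.sum_le_sum this).trans_eq ?_)
      rw [Finset.sum_const, Finset.card_univ, Fintype.card_fin, nsmul_eq_mul]
      ring
    have hρ : (0 : ℝ) ≤ ρ := ρ.coe_nonneg
    have key : (Lv : ℝ) * δ + (∑ i, G i * 2) * δ + N * 2 * ρ * δ ≤ A * (1 + ρ) * δ := by
      rw [← add_mul, ← add_mul]
      refine mul_le_mul_of_nonneg_right ?_ hδ0
      have h1 : 0 ≤ ((Lv : ℝ) + ∑ i, G i * 2 + B) * ρ := by positivity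
      have h2 : (0 : ℝ) ≤ N * 2 := by positivity
      rw [hA]
      linarith
    refine le_trans ?_ key
    rw [abs_le] at e1 e2 e3 ⊢
    constructor <;> linarith
  · rw [Real.coe_toNNReal _ hA0, genFamily_sub_quadForm]
    have hm : ∀ i, Fibre.mom (0 : Fibre d N) i = 0 := fun i => rfl
    have hnode : ∀ j, ‖node x (0 : Fibre d N) j‖ ≤ ρ := fun j => by
      have := norm_node_le x (0 : Fibre d N) j
      rw [norm_zero, add_zero] at this
      exact this.trans hx
    simp only [hm, inner_zero_right, Finset.sum_const_zero, add_zero]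
    have e1 : |v (node x (0 : Fibre d N) 0)| ≤ |v 0| + Lv * ρ := by
      have h1 := hv' (node x (0 : Fibre d N) 0) 0
      rw [sub_zero] at h1
      have h2 := abs_sub_abs_le_abs_sub (v (node x (0 : Fibre d N) 0)) (v 0)
      have h3 := mul_le_mul_of_nonneg_left (hnode 0) Lv.coe_nonneg
      linarith
    have e2 : |∑ i : Fin N, genFun H T (t i.castSucc) (t i.succ) (node x (0 : Fibre d N) i.succ) 0|
        ≤ ∑ i : Fin N, |genFun H T (t i.castSucc) (t i.succ) 0 0| + (∑ i, G i * 2) * ρ := by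
      rw [Finset.sum_mul, ← Finset.sum_add_distrib]
      refine (Finset.abs_sum_le_sum_abs _ _).trans (Finset.sum_le_sum fun i _ => ?_)
      have h1 := hG i (node x (0 : Fibre d N) i.succ) 0 0 0
      rw [sub_zero, sub_zero, norm_zero, add_zero] at h1
      have h2 := abs_sub_abs_le_abs_sub
        (genFun H T (t i.castSucc) (t i.succ) (node x (0 : Fibre d N) i.succ) 0)
        (genFun H T (t i.castSucc) (t i.succ) 0 0)
      have h3 := mul_le_mul_of_nonneg_left (hnode i.succ) (hG0 i)
      have h4 := mul_nonneg (hG0 i) ρ.coe_nonneg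
      linarith
    have hρ : (0 : ℝ) ≤ ρ := ρ.coe_nonneg
    have key : B + ((Lv : ℝ) + ∑ i, G i * 2) * ρ ≤ A * (1 + ρ) := by
      have h1 : 0 ≤ ((N : ℝ) * 2 + B) * ρ := by positivity
      have h2 : (0 : ℝ) ≤ Lv + ∑ i, G i * 2 + N * 2 := by positivity
      rw [hA]
      linarith
    refine (abs_add_le _ _).trans (le_trans ?_ key)
    linarith

/-! ### Truncations of the generating family -/

theorem IsCutoff.exists_lipschitz {θ : Fibre d N → ℝ} (hθ : IsCutoff θ) :
    ∃ Lθ R : ℝ≥0, LipschitzWith Lθ θ ∧ ∀ η, (R : ℝ) ≤ ‖η‖ → θ η = 0 := by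
  obtain ⟨hs, hc, -, -⟩ := hθ
  obtain ⟨Lθ, hL⟩ := hs.lipschitzWith_of_hasCompactSupport hc (by simp)
  obtain ⟨R, hR⟩ := hc.isCompact.isBounded.subset_closedBall 0
  refine ⟨Lθ, (max R 0 + 1).toNNReal, hL, fun η hη => ?_⟩
  rw [Real.coe_toNNReal _ (by positivity)] at hη
  by_contra hne
  have := mem_closedBall_zero_iff.1 (hR (subset_tsupport θ hne))
  linarith [le_max_left R 0]

theorem truncFamily_sub_quadForm (S : Base d → Fibre d N → ℝ) (θ : Fibre d N → ℝ) (a : ℝ)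
    (x : Base d) (η : Fibre d N) :
    truncFamily S θ a x η - quadForm d N η = θ (a⁻¹ • η) * (S x η - quadForm d N η) :=
  add_sub_cancel_right _ _

/-- Here a is any positive number and the constant may depend on it: the rescaled cut-off is treated
as a cut-off at scale 1. -/
theorem exists_lipschitz_truncFamily_sub {S : Base d → Fibre d N → ℝ} {θ : Fibre d N → ℝ}
    (hθ : IsCutoff θ) {x : Base d} {L : ℝ≥0}
    (hS : LipschitzWith L fun η => S x η - quadForm d N η) {a : ℝ} (ha : 0 < a) :
    ∃ L', LipschitzWith L' fun η => truncFamily S θ a x η - quadForm d N η := by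
  obtain ⟨Lθ, R, hL, hR⟩ := hθ.exists_lipschitz
  have h1 : LipschitzWith (Lθ * ‖a⁻¹‖₊) fun η => θ (a⁻¹ • η) := hL.comp (lipschitzWith_smul a⁻¹)
  have h2 := lipschitzWith_cutoff_mul (R := a.toNNReal * R) (B := ‖S x 0 - quadForm d N 0‖₊) h1
    (fun η => hθ.2.2.1 _) (fun η hη => hR _ (by
      push_cast at hη
      rw [Real.coe_toNNReal _ ha.le] at hη
      rw [norm_smul, norm_inv, Real.norm_of_nonneg ha.le, le_inv_mul_iff₀ ha]
      exact hη)) hS (by simp) le_rfl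
  simp only [inv_one, one_smul] at h2
  exact ⟨_, by simpa only [truncFamily_sub_quadForm] using h2⟩

/-- The Lipschitz constant of the truncations is the same for all a ≥ 1, while the radius r a up to
which the cut-off equals 1 grows with a; once c r a exceeds this constant, DQ dominates outside that
radius. -/
theorem exists_isTruncationConstant {S : Base d → Fibre d N → ℝ} {K : Set (Base d)}
    {θ : Fibre d N → ℝ} (hθ : IsCutoff θ) {L : ℝ≥0}
    (hS : ∀ x ∈ K, LipschitzWith L (fun η => S x η - quadForm d N η) ∧
      |S x 0 - quadForm d N 0| ≤ L) :
    ∃ a₀ : ℝ, ∀ a ≥ a₀, IsTruncationConstant S K θ a := by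
  obtain ⟨c, hc, hQ⟩ := exists_quadForm_nondegenerate d N
  obtain ⟨Lθ, R, hL, hR⟩ := hθ.exists_lipschitz
  obtain ⟨r, hr, hr1⟩ : ∃ r > 0, ∀ η, ‖η‖ ≤ r → θ η = 1 := by
    obtain ⟨ε, hε, h⟩ := Metric.eventually_nhds_iff.1 hθ.2.2.2
    refine ⟨ε / 2, by positivity, fun η hη => h ?_⟩
    rw [dist_zero_right]
    linarith
  set L' : ℝ≥0 := L + Lθ * (L + L * R) with hL'
  refine ⟨max 1 ((L' + 1) / (c * r)), fun a ha => ?_⟩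
  have ha1 : 1 ≤ a := (le_max_left _ _).trans ha
  have ha0 : 0 < a := by linarith
  have hb : (L' : ℝ) < c * (r * a) := by
    have h1 := (le_max_right _ _).trans ha
    rw [div_le_iff₀ (by positivity)] at h1
    nlinarith
  have hLL' : (L : ℝ) ≤ L' := NNReal.coe_le_coe.2 (le_add_of_nonneg_right zero_le)
  refine ⟨ha0, r * a, fun η hη => hr1 _ ?_, fun x hx η hη w hw => ?_⟩
  · rw [norm_smul, norm_inv, Real.norm_of_nonneg ha0.le, inv_mul_le_iff₀ ha0, mul_comm]
    exact hη
  · rw [fderiv_quadForm]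
    obtain ⟨hx1, hx2⟩ := hS x hx
    rcases hw with hw | hw
    · exact norm_lt_of_mem_clarkeDeriv hc hQ hx1 (hLL'.trans_lt hb) η hη w hw
    · simp only [truncFamily_sub_quadForm] at hw
      exact norm_lt_of_mem_clarkeDeriv hc hQ
        (lipschitzWith_cutoff_mul hL hθ.2.2.1 hR hx1 hx2 ha1) hb η hη w hw

end GeneratingFamily

end

/-! ### The proposition -/

theorem proposition2p11 (d N : ℕ) (hN : 1 ≤ N) (T : ℝ) (hT : 0 < T)
    -- a `C²` Hamiltonian on `[0, T] × T*ℝ^d` with compact support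
    (H : ℝ → Phase d → ℝ)
    (hH : ContDiffOn ℝ 2 (fun p : ℝ × Phase d => H p.1 p.2) (Icc 0 T ×ˢ univ))
    (hHc : ∃ C : Set (Phase d), IsCompact C ∧ ∀ τ ∈ Icc 0 T, ∀ z ∉ C, H τ z = 0)
    -- a globally Lipschitz function
    (v : Base d → ℝ) (hv : ∃ c : ℝ≥0, LipschitzWith c v)
    -- a subdivision `0 ≤ t_0 ≤ t_1 ≤ … ≤ t_N ≤ T` with steps less than `c_H⁻¹ log 2`
    (t : Fin (N + 1) → ℝ) (ht : Monotone t) (ht0 : 0 ≤ t 0) (htT : t (Fin.last N) ≤ T)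
    (hstep : ∀ i : Fin N, (t i.succ - t i.castSucc) * hamBound H T < Real.log 2) :
    (∀ x : Base d,
      MinmaxWellDefined (genFamily H T v t x) (sigNeg (quadForm d N)) ∧
      IsClarkeCriticalValue (genFamily H T v t x)
        (minmax (genFamily H T v t x) (sigNeg (quadForm d N)))) ∧
    ∀ K : Set (Base d), IsCompact K → ∀ θ : Fibre d N → ℝ, IsCutoff θ →
      (∃ a₀ : ℝ, ∀ a ≥ a₀, IsTruncationConstant (genFamily H T v t) K θ a) ∧
      ∀ a : ℝ, IsTruncationConstant (genFamily H T v t) K θ a → ∀ x ∈ K,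
        MinmaxWellDefined (truncFamily (genFamily H T v t) θ a x) (sigNeg (quadForm d N)) ∧
        minmax (genFamily H T v t x) (sigNeg (quadForm d N)) =
          minmax (truncFamily (genFamily H T v t) θ a x) (sigNeg (quadForm d N)) := by
  obtain ⟨M, hreg⟩ := exists_hamRegular hT hH hHc
  obtain ⟨Lv, hLv⟩ := hv
  -- Nonnegativity of c_H identifies it with the nonnegative real used as the Lipschitz constant of
  -- the Hamiltonian field.
  have hbound : 0 ≤ hamBound H T := Real.sSup_nonneg (by
    rintro _ ⟨τ, -, z, rfl⟩
    exact norm_nonneg (fderiv ℝ (fderiv ℝ (H τ)) z))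
  obtain ⟨A, hA⟩ := exists_lipschitz_genFamily_sub hreg hT hLv ht ht0 htT
    (by rwa [Real.coe_toNNReal _ hbound])
  obtain ⟨c, hc, hQ⟩ := exists_quadForm_nondegenerate d N
  have hlip : ∀ x, LipschitzWith (A * (1 + ‖x‖₊))
      fun η => genFamily H T v t x η - quadForm d N η := fun x => (hA ‖x‖₊ x le_rfl).1
  have hS : ∀ x, genFamily H T v t x =
      fun η => (genFamily H T v t x η - quadForm d N η) + quadForm d N η := fun x =>
    funext fun η => (sub_add_cancel _ _).symm
  refine ⟨fun x => ?_, fun K hK θ hθ => ⟨?_, fun a ha x hx => ?_⟩⟩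
  · rw [hS x]
    exact ⟨minmaxWellDefined_add_quadForm hc hQ (hlip x),
      isClarkeCriticalValue_minmax hc hQ (hlip x)⟩
  · obtain ⟨ρ, hρ⟩ := hK.isBounded.subset_closedBall 0
    refine exists_isTruncationConstant (L := A * (1 + ρ.toNNReal)) hθ fun x hx => ?_
    have hx' : ‖x‖ ≤ ρ.toNNReal :=
      (mem_closedBall_zero_iff.1 (hρ hx)).trans (Real.le_coe_toNNReal ρ)
    have := hA _ x hx'
    push_cast
    exact this
  · obtain ⟨ha0, b, hb1, hb⟩ := ha
    -- A given truncation constant need not be at least 1, so only a Lipschitz constant depending on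
    -- a is available; the domination outside the ball comes from the definition of a truncation
    -- constant.
    obtain ⟨L', hL'⟩ := exists_lipschitz_truncFamily_sub hθ (hlip x) ha0
    have hSK : truncFamily (genFamily H T v t) θ a x = fun η =>
        (truncFamily (genFamily H T v t) θ a x η - quadForm d N η) + quadForm d N η :=
      funext fun η => (sub_add_cancel _ _).symm
    rw [hS x, hSK]
    refine ⟨minmaxWellDefined_add_quadForm hc hQ hL',
      minmax_add_quadForm_eq hc hQ (hlip x) hL' (b := b) (fun η hη => ?_)
        (fun η hη w hw => ?_) (fun η hη w hw => ?_)⟩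
    · rw [truncFamily_sub_quadForm, hb1 η hη, one_mul]
    · rw [← fderiv_quadForm]
      exact hb x hx η hη w (Or.inl hw)
    · rw [← fderiv_quadForm]
      exact hb x hx η hη w (Or.inr hw)
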